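/- Let $0<p<1$, $\lambda\ge 0$ and $q\in[0,1]$ be fixed. For $d>0$ let $a=a(d)$, $b=b(d)$, $c=c(d)$ be real numbers with $pa+(1-p)b=pb+(1-p)c=1$ and $d(1-b)^2=\lambda$, and put $\psi=\begin{pmatrix}a&b\\b&c\end{pmatrix}$ (for $d$ large all entries are positive). Consider the stochastic block model on $\{1,\dots,n\}$: the labels $X_1,\dots,X_n\in\{1,2\}$ are i.i.d. with $\mathbb P(X_i=1)=p$; given the labels, the edges $\{i,j\}$ of the graph $G$ are independent, with probabilities $\frac dn\psi(X_i,X_j)$ (truncated to $[0,1]$, which changes nothing for $d$ large and then $n$ large). The label of each vertex is revealed with probability $q$, independently of everything else. An estimator $T=(T_1,\dots,T_n)\in\{1,2\}^n$ is a function of $G$ and of the revealed labels, and $$P_{succ}(T)=\frac1n\sum_{i=1}^n\big(\mathbb P(T_i=1\mid X_i=1)+\mathbb P(T_i=2\mid X_i=2)-1\big).$$ For an information $\mathcal I$, the likelihood ratio test of $X_i$ based on $\mathcal I$ answers $1$ if $\log\frac{\mathbb P(X_i=1\mid\mathcal I)}{\mathbb P(X_i=2\mid\mathcal I)}\ge\log\frac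 p{1-p}$ and $2$ otherwise. Let - $T^{opt}(G,q)$ be the test whose $i$-th component is the likelihood ratio test based on $G$ and all revealed labels (including which vertices are revealed); - $T^{loc}_r$ be the test whose $i$-th component is the likelihood ratio test based on the ball $[G]_r$ of radius $r$ around $i$ (the induced subgraph on the vertices at distance at most $r$ from $i$) and the revealed labels of the vertices at distance exactly $r$ from $i$; - $T^{BP}_r$ be the belief propagation test, $T^{BP}_{r,i}=1$ if $\log\frac{\nu^{r}_{i}(1)}{\nu^{r}_{i}(2)}\ge\log\frac p{1-p}$ and $2$ otherwise, where, with $p(1)=p$ and $p(2)=1-p$, the message of $v$ to its parent $u$ is $\nu^{0}_{v\to u}(x)=p(x)\mathbf 1_{x=X_v}$ if $v$ is revealed, $\nu^{0}_{v\to u}(x)=p(x)$ otherwise, $\nu^{t+1}_{v\to u}(x)=p(x)\prod_{w\sim v,\,w\ne u}\sum_{x'}\psi(x,x')\,\nu^{t}_{w\to v}(x')$, and $\nu^r_i$ is given by the same formulas without a parent. A test is $r$-local if, for each $i$, its $i$-th component is a function of the graph induced on the ball of radius $r$ around $i$ and of the labels revealed in this ball. Let $$G(\mu)=\frac{\lambda}{(1-p)^2}\,\mathbb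 E\Big[\frac1{p+(1-p)\exp(\sqrt\mu Z-\mu/2)}-1\Big],\quad Z\sim\mathcal N(0,1),\qquad \mu_1=\frac{q\lambda}{p(1-p)},\quad \mu_{k+1}=G(\mu_k),$$ and, for $\mu>0$, $S(\mu)=2\,\mathbb P(\mathcal N(\mu/2,\mu)>0)-1$, extended by continuity by $S(0)=0$. Then the limit $\mu_\infty=\lim_k\mu_k\in[0,\infty)$ exists and $$\liminf_{d\to\infty}\liminf_{n\to\infty}P_{succ}\big(T^{opt}(G,q)\big)\ \ge\ S(\mu_\infty).$$ Moreover the bound is achieved by local tests: $T^{loc}_r$ and $T^{BP}_r$ are $r$-local, and $$\lim_{r\to\infty}\lim_{d\to\infty}\lim_{n\to\infty}P_{succ}(T^{loc}_r)=\lim_{r\to\infty}\lim_{d\to\infty}\lim_{n\to\infty}P_{succ}(T^{BP}_r)=S(\mu_\infty),$$ where all these limits exist (the limits over $n$ for all sufficiently large $d$). -/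

import Mathlib

open Filter Topology MeasureTheory ProbabilityTheory

noncomputable section

namespace SBM

/-! The labels (communities) `1` and `2` are the elements `0` and `1` of `Fin 2`. -/

/-- Prior probability of a label: `p` for the first community, `1 - p` for the second one. -/
def prior (p : ℝ) (x : Fin 2) : ℝ := if x = 0 then p else 1 - p

/-- The affinity matrix `ψ` with rows `(a, b)` and `(b, c)`. -/
def affinity (a b c : ℝ) : Matrix (Fin 2) (Fin 2) ℝ := !![a, b; b, c]

/-- The edge probability `(d / n) ψ x x'`. It is truncated to `[0, 1]`, so that the model is a
probability model for all values of the parameters; if `ψ ≥ 0` then nothing is truncated as soon as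
`n` is large. -/
def edgeProb (ψ : Matrix (Fin 2) (Fin 2) ℝ) (d : ℝ) (n : ℕ) (x x' : Fin 2) : ℝ :=
  max 0 (min 1 (d / n * ψ x x'))

/-- An outcome `(x, g, E)`: the labels of the vertices, the graph, and the set of the vertices
whose label is revealed. -/
abbrev Outcome (n : ℕ) : Type := (Fin n → Fin 2) × SimpleGraph (Fin n) × Finset (Fin n)

open scoped Classical in
/-- Probability of an outcome of the stochastic block model with revealed labels: the labels are
independent with law `prior p`; given the labels, the edges are independent Bernoulli variables with
means `edgeProb`; each vertex is revealed with probability `q`, independently of everything else. -/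
def weight (p q : ℝ) (ψ : Matrix (Fin 2) (Fin 2) ℝ) (d : ℝ) {n : ℕ} (ω : Outcome n) : ℝ :=
  (∏ i, prior p (ω.1 i)) *
  (∏ e : Fin n × Fin n with e.1 < e.2,
    if ω.2.1.Adj e.1 e.2 then edgeProb ψ d n (ω.1 e.1) (ω.1 e.2)
    else 1 - edgeProb ψ d n (ω.1 e.1) (ω.1 e.2)) *
  ∏ i, if i ∈ ω.2.2 then q else 1 - q

open scoped Classical in
/-- Probability of an event. -/
def prob (p q : ℝ) (ψ : Matrix (Fin 2) (Fin 2) ℝ) (d : ℝ) {n : ℕ} (A : Outcome n → Prop) : ℝ :=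
  ∑ ω : Outcome n with A ω, weight p q ψ d ω

/-- Conditional probability of `A` given `B`. -/
def condProb (p q : ℝ) (ψ : Matrix (Fin 2) (Fin 2) ℝ) (d : ℝ) {n : ℕ}
    (A B : Outcome n → Prop) : ℝ :=
  prob p q ψ d (fun ω => A ω ∧ B ω) / prob p q ψ d B

/-- The observed labels of a graph on `n` vertices: `some x` at a revealed vertex with label `x`,
and `none` at a vertex that is not revealed. -/
abbrev Labels (n : ℕ) : Type := Fin n → Option (Fin 2)

/-- The labels observed in an outcome. -/
def observed {n : ℕ} (ω : Outcome n) : Labels n :=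
  fun v => if v ∈ ω.2.2 then some (ω.1 v) else none

/-- An estimator `T = (T_1, …, T_n)` of the labels is a function of the graph and of the observed
labels. -/
abbrev Estimator (n : ℕ) : Type := SimpleGraph (Fin n) → Labels n → Fin n → Fin 2

/-- The rescaled average success probability
`(1 / n) ∑ i, (P(T_i = 1 | X_i = 1) + P(T_i = 2 | X_i = 2) - 1)`. -/
def pSucc (p q : ℝ) (ψ : Matrix (Fin 2) (Fin 2) ℝ) (d : ℝ) (n : ℕ) (T : Estimator n) : ℝ :=
  1 / (n : ℝ) * ∑ i : Fin n,
    (condProb p q ψ d (fun ω => T ω.2.1 (observed ω) i = 0) (fun ω => ω.1 i = 0)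
      + condProb p q ψ d (fun ω => T ω.2.1 (observed ω) i = 1) (fun ω => ω.1 i = 1) - 1)

/-- `log (u / v)` in `[-∞, ∞]` for `u, v ≥ 0`, with `log 0 = -∞` and `log (u / 0) = ∞` if
`u > 0`. -/
def logRatio (u v : ℝ) : EReal := ENNReal.log (ENNReal.ofReal u / ENNReal.ofReal v)

open scoped Classical in
/-- The likelihood ratio decision: label `1` if `log (u / v) ≥ log (p / (1 - p))`, and label `2`
otherwise. -/
def decision (p u v : ℝ) : Fin 2 := if logRatio p (1 - p) ≤ logRatio u v then 0 else 1

/-- The optimal test: the decision based on the conditional law of `X_i` given the graph and the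
observed labels. -/
def optTest (p q : ℝ) (ψ : Matrix (Fin 2) (Fin 2) ℝ) (d : ℝ) (n : ℕ) : Estimator n :=
  fun g y i =>
    decision p
      (condProb p q ψ d (fun ω => ω.1 i = 0) (fun ω => ω.2.1 = g ∧ observed ω = y))
      (condProb p q ψ d (fun ω => ω.1 i = 1) (fun ω => ω.2.1 = g ∧ observed ω = y))

/-! ### Local tests -/

/-- The vertices at graph distance at most `r` from `i`. -/
def ball {n : ℕ} (g : SimpleGraph (Fin n)) (r : ℕ) (i : Fin n) : Set (Fin n) :=
  {v | g.edist i v ≤ r}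

/-- The graph induced by `g` on the ball of radius `r` around `i` (with isolated points added
outside of the ball). -/
def ballGraph {n : ℕ} (g : SimpleGraph (Fin n)) (r : ℕ) (i : Fin n) : SimpleGraph (Fin n) :=
  (g.induce (ball g r i)).spanningCoe

/-- `T` is `r`-local: each `T_i` is a function of the graph induced on the ball of radius `r`
around `i` and of the labels observed in this ball. -/
def IsLocal (r : ℕ) {n : ℕ} (T : Estimator n) : Prop :=
  ∀ (i : Fin n) (g g' : SimpleGraph (Fin n)) (y y' : Labels n),
    ball g r i = ball g' r i → ballGraph g r i = ballGraph g' r i →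
    (∀ v ∈ ball g r i, y v = y' v) → T g y i = T g' y' i

open scoped Classical in
/-- The labels observed at the vertices at distance exactly `r` from `i`. -/
def boundaryLabels {n : ℕ} (g : SimpleGraph (Fin n)) (y : Labels n) (r : ℕ) (i : Fin n) :
    Labels n :=
  fun v => if g.edist i v = r then y v else none

/-- The event that the ball of radius `r` around `i` and the labels observed on its boundary are
the same as in the observation `(g, y)`. -/
def SameBall {n : ℕ} (r : ℕ) (i : Fin n) (g : SimpleGraph (Fin n)) (y : Labels n)
    (ω : Outcome n) : Prop :=
  ball ω.2.1 r i = ball g r i ∧ ballGraph ω.2.1 r i = ballGraph g r i ∧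
    boundaryLabels ω.2.1 (observed ω) r i = boundaryLabels g y r i

/-- The local test: the decision based on the conditional law of `X_i` given the ball of radius `r`
around `i` and the labels observed on the boundary of this ball. -/
def locTest (p q : ℝ) (ψ : Matrix (Fin 2) (Fin 2) ℝ) (d : ℝ) (r n : ℕ) : Estimator n :=
  fun g y i =>
    decision p
      (condProb p q ψ d (fun ω => ω.1 i = 0) (SameBall r i g y))
      (condProb p q ψ d (fun ω => ω.1 i = 1) (SameBall r i g y))

open scoped Classical in
/-- The belief propagation messages. `bpMessage p ψ g y t v u` is the message of the vertex `v`,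
as a function of its label, after `t` iterations; `u` is the parent of `v`, with `u = none` if `v`
is the root. -/
def bpMessage (p : ℝ) (ψ : Matrix (Fin 2) (Fin 2) ℝ) {n : ℕ} (g : SimpleGraph (Fin n))
    (y : Labels n) : ℕ → Fin n → Option (Fin n) → Fin 2 → ℝ
  | 0, v, _, x => if y v = none ∨ y v = some x then prior p x else 0
  | t + 1, v, u, x =>
      prior p x * ∏ w : Fin n with g.Adj v w ∧ some w ≠ u,
        ∑ x' : Fin 2, ψ x x' * bpMessage p ψ g y t w (some v) x'

/-- The belief propagation test: the decision based on the message computed at the root `i` after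
`r` iterations (which is the recursion over the tree of depth `r` rooted at `i`, started from the
labels observed at depth `r`, if the ball of radius `r` is a tree). -/
def bpTest (p : ℝ) (ψ : Matrix (Fin 2) (Fin 2) ℝ) (r n : ℕ) : Estimator n :=
  fun g y i => decision p (bpMessage p ψ g y r i none 0) (bpMessage p ψ g y r i none 1)

/-! ### The limiting recursion -/

/-- `G(μ) = λ / (1 - p)² E[1 / (p + (1 - p) exp (√μ Z - μ / 2)) - 1]` with `Z ∼ N(0, 1)`. -/
def gMap (p lam μ : ℝ) : ℝ :=
  lam / (1 - p) ^ 2 *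
    ∫ z, (1 / (p + (1 - p) * Real.exp (√μ * z - μ / 2)) - 1) ∂(gaussianReal 0 1)

/-- The sequence `μ_1 = q λ / (p (1 - p))`, `μ_{k+1} = G(μ_k)`; `muSeq p q lam k` is
`μ_{k+1}`. -/
def muSeq (p q lam : ℝ) : ℕ → ℝ
  | 0 => q * lam / (p * (1 - p))
  | k + 1 => gMap p lam (muSeq p q lam k)

/-- `2 P(N(μ/2, μ) > 0) - 1` for `μ > 0`, extended by its limit `0` to `μ = 0`. -/
def gaussSucc (μ : ℝ) : ℝ :=
  if μ = 0 then 0 else 2 * (gaussianReal (μ / 2) μ.toNNReal).real (Set.Ioi 0) - 1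

/-- `lim_{r → ∞} lim_{d → ∞} lim_{n → ∞} F r d n = l`, where all the limits exist (the innermost one
for all large `d`). -/
def IteratedLimit (F : ℕ → ℝ → ℕ → ℝ) (l : ℝ) : Prop :=
  ∃ (u : ℕ → ℝ → ℝ) (v : ℕ → ℝ),
    (∀ r, ∀ᶠ d in atTop, Tendsto (F r d) atTop (𝓝 (u r d))) ∧
    (∀ r, Tendsto (u r) atTop (𝓝 (v r))) ∧
    Tendsto v atTop (𝓝 l)

end SBM

end

/-! Near a fixed vertex the graph looks like a branching tree with Poisson(`d`) offspring. Since the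
rows of `ψ` average to one, the degrees in this tree do not depend on the labels, and only the
labels observed at the leaves carry information.

Limit `n → ∞`. Fix the shape of a finite tree and the label of its root. The expected number of its
copies rooted at a vertex `i`, divided by the number of reorderings of children, is at least `1 -
o(1)` times its probability in the branching process (`prob_isPattern_ge`, `score_ge`). In every
outcome these weighted copies number at most one in total (`tsum_match_le_one`), while the limiting
probabilities add up to one, so finitely many shapes carry almost all the mass. Hence lower bounds
suffice. On each tree a test that is constant there succeeds with at most the larger, and errs with
at least the smaller, of the two conditional likelihoods of the tree given the root label. Success
and error scores add up to 2, so the lower bound for errors is an upper bound for success. The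
result is that such a test has advantage at most the total variation distance `treeAdvantage`
between the laws of the tree given the two root labels. Belief propagation, being exact on trees,
attains it. The likelihood ratio test on the ball does at least as well as belief propagation fed
with the boundary labels, and the global test does at least as well as any local one
(`score_le_of_info`).

Limit `d → ∞`. Given root label 1, the log-likelihood ratio is a compound Poisson sum of small terms
of order `1 - b`, with an explicit characteristic function (`charFun_llrLaw`). In a second-order
expansion the linear term vanishes, because the posterior averages to the prior, and `d (1 - b)² =
λ` leaves the law `N(μ/2, μ)` with `μ = λ V / (p (1 - p))²`, where `V` is the variance of the
posterior of a child (`norm_tsum_childChar_sub_le`). By Bayes' rule the variance one level up is the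
mean of a bounded continuous function of the log-likelihood ratio, which turns the recursion for `V`
into `μ ↦ G(μ)` (`tendsto_postVar`). The advantage is the mean of `max 0 (1 - exp (-L))` and
converges to `S(μ)`.

Limit `r → ∞`. `G` is nondecreasing by Jensen's inequality (`gaussian_posterior_mono`) and bounded,
so `μ_k` is monotone and converges; `S` is continuous. -/

namespace SBM

/-! ### The limiting recursion -/

/-- The law `N(μ/2, μ)` of the limiting log-likelihood ratio. -/
noncomputable def llrGauss (μ : ℝ) : Measure ℝ := gaussianReal (μ / 2) μ.toNNReal

instance (μ : ℝ) : IsProbabilityMeasure (llrGauss μ) := by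
  unfold llrGauss; infer_instance

theorem sqrt_sq_toNNReal {μ : ℝ} (hμ : 0 ≤ μ) (h : 0 ≤ (√μ) ^ 2) :
    NNReal.mk ((√μ) ^ 2) h * 1 = μ.toNNReal := by
  ext; simp [Real.sq_sqrt hμ, hμ]

theorem map_standard_llrGauss {μ : ℝ} (hμ : 0 ≤ μ) :
    (gaussianReal 0 1).map (fun z => √μ * z + μ / 2) = llrGauss μ := by
  have h : (fun z : ℝ => √μ * z + μ / 2) = (fun x => x + μ / 2) ∘ (fun z => √μ * z) := rfl
  rw [h, ← Measure.map_map (by fun_prop) (by fun_prop), gaussianReal_map_const_mul,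
    gaussianReal_map_add_const, sqrt_sq_toNNReal hμ]
  simp [llrGauss]

/-- By symmetry of `Z`, the exponent `√μ Z - μ/2` in `G` is minus a log-likelihood ratio of law
`llrGauss μ`. -/
theorem map_neg_standard_llrGauss {μ : ℝ} (hμ : 0 ≤ μ) :
    (gaussianReal 0 1).map (fun z => -(√μ * z - μ / 2)) = llrGauss μ := by
  have h : (fun z : ℝ => -(√μ * z - μ / 2)) = (fun x => x + μ / 2) ∘ (fun z => (-√μ) * z) := by
    funext z; simp; ring
  have h2 : ∀ h, NNReal.mk ((-√μ) ^ 2) h * 1 = μ.toNNReal := by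
    intro h; ext; simp [Real.sq_sqrt hμ, hμ]
  rw [h, ← Measure.map_map (by fun_prop) (by fun_prop), gaussianReal_map_const_mul,
    gaussianReal_map_add_const, h2]
  simp [llrGauss]

theorem abs_posPart_one_sub_exp_le (x : ℝ) : |max 0 (1 - Real.exp (-x))| ≤ 1 := by
  rw [abs_of_nonneg (le_max_left _ _)]
  have := Real.exp_pos (-x)
  exact max_le zero_le_one (by linarith)

/-- Exponential tilting: `exp (-x)` is the likelihood ratio of the laws under the two labels, which
are mirror images of each other. -/
theorem gaussianPDFReal_mul_exp_neg {μ : ℝ} (hμ : 0 < μ) (x : ℝ) :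
    gaussianPDFReal (μ / 2) μ.toNNReal x * Real.exp (-x) =
      gaussianPDFReal (-(μ / 2)) μ.toNNReal x := by
  simp only [gaussianPDFReal, Real.coe_toNNReal _ hμ.le]
  rw [mul_assoc, ← Real.exp_add]
  congr 2
  field_simp
  ring

/-- By the tilting identity the integrand is the positive part of the difference of two mirror-image
Gaussian densities, and this difference is positive exactly on `x > 0`. The integral has the form of
the tree advantage, and it needs no separate convention at `μ = 0`. -/
theorem gaussSucc_eq_integral {μ : ℝ} (hμ : 0 ≤ μ) :
    gaussSucc μ = ∫ x, max 0 (1 - Real.exp (-x)) ∂(llrGauss μ) := by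
  rcases hμ.eq_or_lt with rfl | hμ
  · simp [gaussSucc, llrGauss, gaussianReal_zero_var]
  have hv : μ.toNNReal ≠ 0 := by simpa using hμ
  have h1 : ∀ m : ℝ, (gaussianReal m μ.toNNReal).real (Set.Ioi 0) =
      ∫ x in Set.Ioi 0, gaussianPDFReal m μ.toNNReal x := by
    intro m
    rw [Measure.real, gaussianReal_apply_eq_integral _ hv, ENNReal.toReal_ofReal]
    exact integral_nonneg fun x => gaussianPDFReal_nonneg _ _ _
  have h2 : (gaussianReal (-(μ / 2)) μ.toNNReal).real (Set.Ioi 0) =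
      1 - (gaussianReal (μ / 2) μ.toNNReal).real (Set.Ioi 0) := by
    rw [← gaussianReal_map_neg, map_measureReal_apply measurable_neg measurableSet_Ioi]
    have : (fun x : ℝ => -x) ⁻¹' Set.Ioi 0 = Set.Iio 0 := by ext; simp
    rw [this]
    have h3 := probReal_compl_eq_one_sub (μ := gaussianReal (μ / 2) μ.toNNReal)
      (measurableSet_Ioi (a := (0:ℝ)))
    rw [← h3, Set.compl_Ioi]
    have := nullSingletonClass_gaussianReal (μ := μ / 2) hv
    exact measureReal_congr Iio_ae_eq_Iic
  rw [gaussSucc, if_neg hμ.ne', llrGauss, integral_gaussianReal_eq_integral_smul hv]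
  have h4 : ∀ x, gaussianPDFReal (μ / 2) μ.toNNReal x • max 0 (1 - Real.exp (-x)) =
      (Set.Ioi 0).indicator (fun x => gaussianPDFReal (μ / 2) μ.toNNReal x -
        gaussianPDFReal (-(μ / 2)) μ.toNNReal x) x := by
    intro x
    by_cases hx : 0 < x
    · rw [Set.indicator_of_mem (Set.mem_Ioi.2 hx), ← gaussianPDFReal_mul_exp_neg hμ, max_eq_right]
      · simp only [smul_eq_mul]; ring
      · have : Real.exp (-x) ≤ 1 := Real.exp_le_one_iff.2 (by linarith)
        linarith
    · rw [Set.indicator_of_notMem (by simpa using hx), max_eq_left, smul_zero]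
      have : 1 ≤ Real.exp (-x) := Real.one_le_exp (by linarith)
      linarith
  simp_rw [h4]
  rw [integral_indicator measurableSet_Ioi, integral_sub
    (integrable_gaussianPDFReal _ _).integrableOn (integrable_gaussianPDFReal _ _).integrableOn,
    ← h1, ← h1, h2]
  ring

theorem continuousOn_gaussSucc : ContinuousOn gaussSucc (Set.Ici 0) := by
  have h : ContinuousOn (fun μ => ∫ z, max 0 (1 - Real.exp (-(√μ * z + μ / 2)))
      ∂(gaussianReal 0 1)) (Set.Ici 0) := by
    refine Continuous.continuousOn ?_
    refine continuous_of_dominated (bound := fun _ => 1) (fun x => by fun_prop) ?_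
      (integrable_const _) ?_
    · exact fun x => ae_of_all _ fun z => abs_posPart_one_sub_exp_le _
    · exact ae_of_all _ fun z => by fun_prop
  refine h.congr fun μ hμ => ?_
  rw [gaussSucc_eq_integral hμ, ← map_standard_llrGauss hμ,
    integral_map (by fun_prop) (by fun_prop)]

theorem gMap_eq_integral {p lam μ : ℝ} (hμ : 0 ≤ μ) :
    gMap p lam μ = lam / (1 - p) ^ 2 *
      ∫ x, (1 / (p + (1 - p) * Real.exp (-x)) - 1) ∂(llrGauss μ) := by
  rw [gMap, ← map_neg_standard_llrGauss hμ, integral_map (by fun_prop)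
    (Measurable.aestronglyMeasurable (by fun_prop))]
  simp

theorem posterior_den_pos {p : ℝ} (hp0 : 0 < p) (hp1 : p < 1) {y : ℝ} (hy : 0 ≤ y) :
    0 < p + (1 - p) * y := by
  have := mul_nonneg (sub_pos.2 hp1).le hy
  linarith

theorem inv_posterior_den_le {p : ℝ} (hp0 : 0 < p) (hp1 : p < 1) {y : ℝ} (hy : 0 ≤ y) :
    |1 / (p + (1 - p) * y)| ≤ 1 / p := by
  rw [abs_of_pos (one_div_pos.2 (posterior_den_pos hp0 hp1 hy))]
  have := mul_nonneg (sub_pos.2 hp1).le hy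
  exact one_div_le_one_div_of_le hp0 (by linarith)

theorem integrable_inv_posterior_den {p : ℝ} (hp0 : 0 < p) (hp1 : p < 1) (m : Measure ℝ)
    [IsFiniteMeasure m] (c : ℝ) :
    Integrable (fun x => 1 / (p + (1 - p) * Real.exp (c * x))) m := by
  refine Integrable.of_bound (C := 1 / p) (Measurable.aestronglyMeasurable (by fun_prop))
      (ae_of_all _ fun x => ?_)
  simpa using inv_posterior_den_le hp0 hp1 (Real.exp_pos (c * x)).le

/-- The tangent inequality for the convex function `y ↦ 1 / (p + (1 - p) y)`. -/
theorem inv_posterior_den_tangent {p : ℝ} (hp0 : 0 < p) (hp1 : p < 1) {y w : ℝ} (hy : 0 < y)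
    (hw : 0 < w) :
    1 / (p + (1 - p) * y) - (1 - p) * y / (p + (1 - p) * y) ^ 2 * (w - 1) ≤
      1 / (p + (1 - p) * (y * w)) := by
  have h1 := posterior_den_pos hp0 hp1 hy.le
  have h2 := posterior_den_pos hp0 hp1 (mul_pos hy hw).le
  have key : ∀ A B : ℝ, 0 < A → 0 < B → 1 / A - (B - A) / A ^ 2 ≤ 1 / B := by
    intro A B hA hB
    have h : 1 / B - (1 / A - (B - A) / A ^ 2) = (B - A) ^ 2 / (A ^ 2 * B) := by
      field_simp
      ring
    have : 0 ≤ (B - A) ^ 2 / (A ^ 2 * B) := by positivity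
    linarith
  refine le_of_eq_of_le ?_ (key _ _ h1 h2)
  ring

theorem integral_exp_gaussian (v : NNReal) :
    ∫ x, Real.exp x ∂(gaussianReal (-(v / 2 : ℝ)) v) = 1 := by
  have := congrFun (mgf_id_gaussianReal (μ := -(v / 2 : ℝ)) (v := v)) 1
  simp only [mgf, id, one_mul] at this
  rw [this]
  norm_num

theorem integrable_exp_gaussian (m : ℝ) (v : NNReal) :
    Integrable (fun x => Real.exp x) (gaussianReal m v) := by
  simpa using integrable_exp_mul_gaussianReal (μ := m) (v := v) 1

/-- The larger Gaussian is the convolution of the smaller one with an independent `y` for which `exp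
y` has mean one, so Jensen's inequality applies to the convex function `1 / (p + (1 - p) ·)`. -/
theorem gaussian_posterior_mono {p : ℝ} (hp0 : 0 < p) (hp1 : p < 1) (v w : NNReal) :
    ∫ x, 1 / (p + (1 - p) * Real.exp x) ∂(gaussianReal (-(v / 2 : ℝ)) v) ≤
      ∫ x, 1 / (p + (1 - p) * Real.exp x)
        ∂(gaussianReal (-((v + w : NNReal) / 2 : ℝ)) (v + w)) := by
  have hint : ∀ (m : Measure ℝ) [IsFiniteMeasure m] (s : ℝ),
      Integrable (fun x => 1 / (p + (1 - p) * Real.exp (s + x))) m := fun m _ s => by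
    refine Integrable.of_bound (C := 1 / p) (Measurable.aestronglyMeasurable (by fun_prop))
        (ae_of_all _ fun x => ?_)
    simpa using inv_posterior_den_le hp0 hp1 (Real.exp_pos (s + x)).le
  have e : (-((v + w : NNReal) / 2 : ℝ)) = -(v / 2 : ℝ) + -(w / 2 : ℝ) := by push_cast; ring
  rw [e, ← gaussianReal_conv_gaussianReal, integral_conv (by simpa using hint _ 0)]
  refine integral_mono (by simpa using hint _ 0) ?_ fun x => ?_
  · refine Integrable.of_bound (C := 1 / p) ?_ (ae_of_all _ fun x => ?_)
    · have hm : Measurable (Function.uncurry fun x y : ℝ =>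
          1 / (p + (1 - p) * Real.exp (x + y))) := by
        unfold Function.uncurry; fun_prop
      exact hm.stronglyMeasurable.integral_prod_right.aestronglyMeasurable
    · refine (norm_integral_le_of_norm_le_const (C := 1 / p) (ae_of_all _ fun y => ?_)).trans ?_
      · exact inv_posterior_den_le hp0 hp1 (Real.exp_pos _).le
      · simp
  -- The linear term of the tangent at `exp x` integrates to zero, since `exp y` has mean one.
  · have h1 : ∫ y, (1 / (p + (1 - p) * Real.exp x) - (1 - p) * Real.exp x /
        (p + (1 - p) * Real.exp x) ^ 2 * (Real.exp y - 1)) ∂(gaussianReal (-(w / 2 : ℝ)) w) =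
        1 / (p + (1 - p) * Real.exp x) := by
      rw [integral_sub (integrable_const _), integral_const_mul, integral_sub,
          integral_exp_gaussian]
      · simp
      · exact integrable_exp_gaussian _ _
      · exact integrable_const _
      · exact ((integrable_exp_gaussian _ _).sub (integrable_const _)).const_mul _
    rw [← h1]
    refine integral_mono ?_ (hint _ x) fun y => ?_
    · exact (integrable_const _).sub
        (((integrable_exp_gaussian _ _).sub (integrable_const _)).const_mul _)
    · simp only [Real.exp_add]
      exact inv_posterior_den_tangent hp0 hp1 (Real.exp_pos x) (Real.exp_pos y)

theorem gMap_eq_integral_exp {p lam : ℝ} (v : NNReal) (hp0 : 0 < p) (hp1 : p < 1) :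
    gMap p lam (v : ℝ) = lam / (1 - p) ^ 2 *
      ((∫ x, 1 / (p + (1 - p) * Real.exp x) ∂(gaussianReal (-(v / 2 : ℝ)) v)) - 1) := by
  rw [gMap_eq_integral (NNReal.coe_nonneg v), integral_sub _ (integrable_const _)]
  · congr 2
    · rw [← gaussianReal_map_neg, integral_map (by fun_prop)
        (Measurable.aestronglyMeasurable (by fun_prop)), llrGauss]
      simp
    · simp
  · simpa using integrable_inv_posterior_den hp0 hp1 (llrGauss v) (-1)

theorem gMap_mono {p lam : ℝ} (hp0 : 0 < p) (hp1 : p < 1) (hlam : 0 ≤ lam) :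
    MonotoneOn (gMap p lam) (Set.Ici 0) := by
  intro x hx y hy hxy
  lift x to NNReal using hx
  lift y to NNReal using hy
  obtain ⟨w, rfl⟩ := exists_add_of_le (NNReal.coe_le_coe.1 hxy)
  rw [gMap_eq_integral_exp _ hp0 hp1, gMap_eq_integral_exp _ hp0 hp1]
  exact mul_le_mul_of_nonneg_left (sub_le_sub_right (gaussian_posterior_mono hp0 hp1 x w) _)
    (by positivity)

theorem gMap_zero (p lam : ℝ) : gMap p lam 0 = 0 := by
  simp [gMap]

theorem gMap_nonneg {p lam : ℝ} (hp0 : 0 < p) (hp1 : p < 1) (hlam : 0 ≤ lam) {μ : ℝ}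
    (hμ : 0 ≤ μ) : 0 ≤ gMap p lam μ := by
  rw [← gMap_zero p lam]
  exact gMap_mono hp0 hp1 hlam (Set.mem_Ici.2 le_rfl) hμ hμ

theorem gMap_le {p lam : ℝ} (hp0 : 0 < p) (hp1 : p < 1) (hlam : 0 ≤ lam) {μ : ℝ}
    (hμ : 0 ≤ μ) : gMap p lam μ ≤ lam / (1 - p) ^ 2 * (1 / p - 1) := by
  lift μ to NNReal using hμ
  rw [gMap_eq_integral_exp _ hp0 hp1]
  refine mul_le_mul_of_nonneg_left (sub_le_sub_right ?_ _) (by positivity)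
  refine (Real.le_norm_self _).trans ((norm_integral_le_of_norm_le_const (C := 1 / p)
    (ae_of_all _ fun x => inv_posterior_den_le hp0 hp1 (Real.exp_pos x).le)).trans ?_)
  simp

theorem muSeq_nonneg {p q lam : ℝ} (hp0 : 0 < p) (hp1 : p < 1) (hq0 : 0 ≤ q) (hlam : 0 ≤ lam)
    (k : ℕ) : 0 ≤ muSeq p q lam k := by
  induction k with
  | zero => have := sub_pos.2 hp1; simp only [muSeq]; positivity
  | succ k ih => exact gMap_nonneg hp0 hp1 hlam ih

/-- As `G` is nondecreasing, the direction of the first step persists. Whichever it is, the sequence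
is monotone, and it stays between 0 and a constant. -/
theorem exists_tendsto_muSeq {p q lam : ℝ} (hp0 : 0 < p) (hp1 : p < 1) (hq0 : 0 ≤ q)
    (hlam : 0 ≤ lam) : ∃ μ, 0 ≤ μ ∧ Tendsto (muSeq p q lam) atTop (𝓝 μ) := by
  have hnn := muSeq_nonneg (q := q) hp0 hp1 hq0 hlam
  have hex : ∃ μ, Tendsto (muSeq p q lam) atTop (𝓝 μ) := by
    rcases le_total (muSeq p q lam 0) (muSeq p q lam 1) with h | h
    · have hm : Monotone (muSeq p q lam) := by
        refine monotone_nat_of_le_succ fun k => ?_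
        induction k with
        | zero => exact h
        | succ k ih => exact gMap_mono hp0 hp1 hlam (hnn k) (hnn (k + 1)) ih
      refine ⟨_, tendsto_atTop_ciSup hm ⟨lam / (1 - p) ^ 2 * (1 / p - 1), ?_⟩⟩
      rintro _ ⟨k, rfl⟩
      exact (hm (Nat.le_succ k)).trans (gMap_le hp0 hp1 hlam (hnn k))
    · have hm : Antitone (muSeq p q lam) := by
        refine antitone_nat_of_succ_le fun k => ?_
        induction k with
        | zero => exact h
        | succ k ih => exact gMap_mono hp0 hp1 hlam (hnn (k + 1)) (hnn k) ih
      exact ⟨_, tendsto_atTop_ciInf hm ⟨0, by rintro _ ⟨k, rfl⟩; exact hnn k⟩⟩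
  obtain ⟨μ, hμ⟩ := hex
  exact ⟨μ, ge_of_tendsto' hμ hnn, hμ⟩

theorem tendsto_gaussSucc_muSeq {p q lam μ : ℝ} (hp0 : 0 < p) (hp1 : p < 1) (hq0 : 0 ≤ q)
    (hlam : 0 ≤ lam) (h : Tendsto (muSeq p q lam) atTop (𝓝 μ)) (hμ : 0 ≤ μ) :
    Tendsto (fun k => gaussSucc (muSeq p q lam k)) atTop (𝓝 (gaussSucc μ)) :=
  ((continuousOn_gaussSucc μ hμ).tendsto.comp (tendsto_nhdsWithin_iff.2
    ⟨h, Eventually.of_forall fun k => muSeq_nonneg hp0 hp1 hq0 hlam k⟩))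

/-! ### Sums over lists of independent children -/

/-- Absolute summability is carried along in the induction because multiplying two series requires
it. -/
theorem hasSum_fin_pi {𝕜 ι : Type*} [NormedCommRing 𝕜] [NormOneClass 𝕜] [CompleteSpace 𝕜]
    {k : ℕ} {f : Fin k → ι → 𝕜} {s : Fin k → 𝕜}
    (hf : ∀ j, Summable fun i => ‖f j i‖) (h : ∀ j, HasSum (f j) (s j)) :
    (Summable fun c : Fin k → ι => ‖∏ j, f j (c j)‖) ∧
      HasSum (fun c : Fin k → ι => ∏ j, f j (c j)) (∏ j, s j) := by
  induction k with
  | zero =>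
    refine ⟨(hasSum_fintype _).summable, ?_⟩
    convert hasSum_fintype (fun c : Fin 0 → ι => ∏ j, f j (c j))
    simp
  | succ k ih =>
    have h1 : Summable fun c : Fin k → ι => ‖∏ j : Fin k, f j.succ (c j)‖ :=
      (ih (fun j => hf j.succ) (fun j => h j.succ)).1
    have h2 : HasSum (fun c : Fin k → ι => ∏ j : Fin k, f j.succ (c j)) (∏ j : Fin k, s j.succ) :=
      (ih (fun j => hf j.succ) (fun j => h j.succ)).2
    let E : ι × (Fin k → ι) ≃ (Fin (k + 1) → ι) := Fin.consEquiv (fun _ => ι)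
    let F : (Fin (k + 1) → ι) → 𝕜 := fun c => ∏ j, f j (c j)
    have e : ∀ x, F (E x) = f 0 x.1 * ∏ j : Fin k, f j.succ (x.2 j) :=
      fun x => Fin.prod_univ_succ _
    constructor
    · refine (E.summable_iff (f := fun c => ‖F c‖)).1 ?_
      have h3 := Summable.mul_norm (f := f 0)
        (g := fun c : Fin k → ι => ∏ j : Fin k, f j.succ (c j)) (hf 0) h1
      exact h3.congr fun x => by rw [Function.comp_apply, e]
    · refine (E.hasSum_iff (f := F)).1 ?_
      have h3 := (h 0).mul h2 (summable_mul_of_summable_norm (f := f 0)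
        (g := fun c : Fin k → ι => ∏ j : Fin k, f j.succ (c j)) (hf 0) h1)
      rw [← Fin.prod_univ_succ] at h3
      exact h3.congr_fun e

/-- The exponential formula for a Poisson number of independent children. The real version gives the
total mass of the branching process, the complex one the characteristic function of a compound
Poisson sum. -/
theorem hasSum_poisson_pi {ι : Type*} {g : ι → ℂ} {s : ℂ} (d : ℂ)
    (hg : Summable fun i => ‖g i‖) (h : HasSum g s) :
    HasSum (fun o : (k : ℕ) × (Fin k → ι) =>
      d ^ o.1 / (o.1.factorial : ℂ) * ∏ j, g (o.2 j)) (Complex.exp (d * s)) := by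
  rw [Complex.exp_eq_exp_ℂ]
  refine HasSum.sigma_of_hasSum (g := fun k => (d * s) ^ k / (k.factorial : ℂ))
    (NormedSpace.expSeries_div_hasSum_exp (d * s)) (fun k => ?_) ?_
  · have := (hasSum_fin_pi (k := k) (f := fun _ => g) (s := fun _ => s)
      (fun _ => hg) (fun _ => h)).2.mul_left (d ^ k / (k.factorial : ℂ))
    rw [Finset.prod_const, Finset.card_univ, Fintype.card_fin] at this
    rwa [mul_pow, mul_div_right_comm]
  · refine Summable.of_norm ?_
    rw [summable_sigma_of_nonneg fun _ => norm_nonneg _]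
    have h3 : ∀ k : ℕ, HasSum (fun c : Fin k → ι => ‖d ^ k / (k.factorial : ℂ) * ∏ j, g (c j)‖)
        ((‖d‖ * ∑' i, ‖g i‖) ^ k / (k.factorial : ℝ)) := fun k => by
      have := (hasSum_fin_pi (k := k) (f := fun _ i => ‖g i‖) (s := fun _ => ∑' i, ‖g i‖)
        (fun _ => by simpa using hg) (fun _ => hg.hasSum)).2.mul_left
        (‖d‖ ^ k / (k.factorial : ℝ))
      rw [Finset.prod_const, Finset.card_univ, Fintype.card_fin] at this
      rw [mul_pow, mul_div_right_comm]
      refine this.congr_fun fun c => ?_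
      rw [norm_mul, norm_prod, norm_div, norm_pow, Complex.norm_natCast]
    refine ⟨fun k => (h3 k).summable, ?_⟩
    simp_rw [fun k => (h3 k).tsum_eq]
    exact (NormedSpace.expSeries_div_hasSum_exp _).summable

theorem hasSum_poisson_pi_real {ι : Type*} {g : ι → ℝ} {s : ℝ} (d : ℝ) (hg : HasSum g s) :
    HasSum (fun o : (k : ℕ) × (Fin k → ι) =>
      d ^ o.1 / (o.1.factorial : ℝ) * ∏ j, g (o.2 j)) (Real.exp (d * s)) := by
  rw [← Complex.hasSum_ofReal]
  have := hasSum_poisson_pi (g := fun i => (g i : ℂ)) (s := (s : ℂ)) (d : ℂ)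
    (by simpa using hg.summable.abs) (Complex.hasSum_ofReal.2 hg)
  simpa using this

/-! ### Shapes of rooted trees with observed labels at the leaves -/

/-- The shapes of plane rooted trees of depth at most `t`, with the observed label at each vertex
of depth `t`. -/
def Shape : ℕ → Type
  | 0 => Option (Fin 2)
  | t + 1 => (k : ℕ) × (Fin k → Shape t)

/-- The initial belief propagation message at a vertex with observed label `y`. -/
noncomputable def leafMsg (p : ℝ) (y : Option (Fin 2)) (x : Fin 2) : ℝ :=
  if y = none ∨ y = some x then prior p x else 0

/-- The belief propagation message at the root of a tree. -/
noncomputable def msg (p : ℝ) (ψ : Matrix (Fin 2) (Fin 2) ℝ) : (t : ℕ) → Shape t → Fin 2 → ℝ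
  | 0, y, x => leafMsg p y x
  | t + 1, ⟨_, o⟩, x => prior p x * ∏ j, ∑ x', ψ x x' * msg p ψ t (o j) x'

/-- The factor of the probability of a tree that does not depend on the labels. -/
noncomputable def shapeFactor (q d : ℝ) : (t : ℕ) → Shape t → ℝ
  | 0, y => if (show Option (Fin 2) from y) = none then 1 - q else q
  | t + 1, ⟨k, o⟩ =>
    Real.exp (-d) * (d ^ k / (k.factorial : ℝ)) * ∏ j, shapeFactor q d t (o j)

/-- The probability that the root of the limiting branching process has label `x` and that its tree
has the given shape. -/
noncomputable def shapeProb (p q d : ℝ) (ψ : Matrix (Fin 2) (Fin 2) ℝ) (t : ℕ) (o : Shape t)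
    (x : Fin 2) : ℝ := shapeFactor q d t o * msg p ψ t o x

/-- The standing assumptions on the parameters. -/
structure Admissible (p q d : ℝ) (ψ : Matrix (Fin 2) (Fin 2) ℝ) : Prop where
  p_pos : 0 < p
  p_lt : p < 1
  q_nonneg : 0 ≤ q
  q_le : q ≤ 1
  d_pos : 0 < d
  pos : ∀ x x', 0 < ψ x x'
  row : ∀ x, ∑ x', prior p x' * ψ x x' = 1
  symm : ∀ x x', ψ x x' = ψ x' x

section

variable {p q d : ℝ} {ψ : Matrix (Fin 2) (Fin 2) ℝ}

theorem Admissible.prior_pos (h : Admissible p q d ψ) (x : Fin 2) : 0 < prior p x := by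
  have := h.p_pos; have := h.p_lt
  unfold prior; split_ifs <;> linarith

theorem sum_prior (p : ℝ) : ∑ x, prior p x = 1 := by
  simp [prior]

theorem leafMsg_nonneg (h : Admissible p q d ψ) (y : Option (Fin 2)) (x : Fin 2) :
    0 ≤ leafMsg p y x := by
  have := (h.prior_pos x).le
  unfold leafMsg; split_ifs <;> simp [this]

theorem msg_nonneg (h : Admissible p q d ψ) (t : ℕ) (o : Shape t) (x : Fin 2) :
    0 ≤ msg p ψ t o x := by
  induction t generalizing x with
  | zero => exact leafMsg_nonneg h _ _
  | succ t ih =>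
    obtain ⟨k, o⟩ := o
    exact mul_nonneg (h.prior_pos x).le (Finset.prod_nonneg fun j _ => Finset.sum_nonneg fun x' _ =>
      mul_nonneg (h.pos _ _).le (ih _ _))

theorem sum_psi_mul_pos (h : Admissible p q d ψ) {f : Fin 2 → ℝ} (hf : ∀ x, 0 ≤ f x)
    (hs : 0 < ∑ x, f x) (x : Fin 2) : 0 < ∑ x', ψ x x' * f x' := by
  refine Finset.sum_pos' (fun x' _ => mul_nonneg (h.pos _ _).le (hf x')) ?_
  obtain ⟨x', _, hx'⟩ := Finset.exists_lt_of_sum_lt (s := Finset.univ) (f := fun _ => (0:ℝ))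
    (g := f) (by simpa using hs)
  exact ⟨x', Finset.mem_univ _, mul_pos (h.pos _ _) hx'⟩

theorem sum_msg_pos (h : Admissible p q d ψ) (t : ℕ) (o : Shape t) :
    0 < ∑ x, msg p ψ t o x := by
  induction t with
  | zero =>
    obtain - | y := (show Option (Fin 2) from o)
    · have : ∀ x, msg p ψ 0 (none : Option (Fin 2)) x = prior p x := fun x => by
        simp [msg, leafMsg]
      exact (Finset.sum_congr rfl fun x _ => this x).trans (sum_prior p) ▸ one_pos
    · refine Finset.sum_pos' (fun x _ => leafMsg_nonneg h _ _) ⟨y, Finset.mem_univ _, ?_⟩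
      change 0 < leafMsg p (some y) y
      simp [leafMsg, h.prior_pos]
  | succ t ih =>
    obtain ⟨k, o⟩ := o
    refine Finset.sum_pos (fun x _ => mul_pos (h.prior_pos x) (Finset.prod_pos fun j _ => ?_))
      Finset.univ_nonempty
    exact sum_psi_mul_pos h (msg_nonneg h t _) (ih _) x

/-- An observed label may exclude a value at a leaf, but since `ψ > 0` both labels stay possible one
level higher. So log-likelihood ratios are finite from depth one on. -/
theorem msg_succ_pos (h : Admissible p q d ψ) (t : ℕ) (o : Shape (t + 1)) (x : Fin 2) :
    0 < msg p ψ (t + 1) o x := by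
  obtain ⟨k, o⟩ := o
  exact mul_pos (h.prior_pos x) (Finset.prod_pos fun j _ =>
    sum_psi_mul_pos h (msg_nonneg h t _) (sum_msg_pos h _ _) x)

theorem shapeFactor_nonneg (h : Admissible p q d ψ) (t : ℕ) (o : Shape t) :
    0 ≤ shapeFactor q d t o := by
  induction t with
  | zero =>
    have := h.q_nonneg; have := h.q_le
    unfold shapeFactor; split_ifs <;> linarith
  | succ t ih =>
    obtain ⟨k, o⟩ := o
    have := h.d_pos
    exact mul_nonneg (by positivity) (Finset.prod_nonneg fun j _ => ih _)

theorem shapeProb_nonneg (h : Admissible p q d ψ) (t : ℕ) (o : Shape t) (x : Fin 2) :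
    0 ≤ shapeProb p q d ψ t o x :=
  mul_nonneg (shapeFactor_nonneg h t o) (msg_nonneg h t o x)

/-- The branching property. The prior of a child's label is contained in its own message, so `ψ x
x'` times its `shapeProb` is the joint law of its label and its tree given the label `x` of the
parent. -/
theorem shapeProb_succ (t k : ℕ) (o : Fin k → Shape t) (x : Fin 2) :
    shapeProb p q d ψ (t + 1) ⟨k, o⟩ x = prior p x * (Real.exp (-d) *
      (d ^ k / (k.factorial : ℝ) * ∏ j, ∑ x', ψ x x' * shapeProb p q d ψ t (o j) x')) := by
  have : ∀ j, ∑ x', ψ x x' * shapeProb p q d ψ t (o j) x' =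
      shapeFactor q d t (o j) * ∑ x', ψ x x' * msg p ψ t (o j) x' := fun j => by
    rw [Finset.mul_sum]; exact Finset.sum_congr rfl fun _ _ => by unfold shapeProb; ring
  simp_rw [this, Finset.prod_mul_distrib]
  simp only [shapeProb, shapeFactor, msg]
  ring

/-- By the row condition the trees of a child have total mass one whatever the label of the parent,
and the Poisson series then cancels `exp (-d)`. -/
theorem hasSum_shapeProb (h : Admissible p q d ψ) (t : ℕ) (x : Fin 2) :
    HasSum (fun o => shapeProb p q d ψ t o x) (prior p x) := by
  induction t generalizing x with
  | zero =>
    have h1 : prior p x = ∑ y : Option (Fin 2), shapeProb p q d ψ 0 y x := by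
      rw [Fintype.sum_option, Fin.sum_univ_two]
      fin_cases x <;> simp [shapeProb, msg, shapeFactor, leafMsg] <;> ring
    rw [h1]
    exact hasSum_fintype (fun y : Option (Fin 2) => shapeProb p q d ψ 0 y x)
  | succ t ih =>
    have h1 : HasSum (fun o => ∑ x', ψ x x' * shapeProb p q d ψ t o x') 1 := by
      have := hasSum_sum (s := Finset.univ) fun x' (_ : x' ∈ Finset.univ) =>
        (ih x').mul_left (ψ x x')
      have e := h.row x
      simp_rw [mul_comm (prior p _)] at e
      rwa [e] at this
    have h2 := ((hasSum_poisson_pi_real d h1).mul_left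
      (Real.exp (-d))).mul_left (prior p x)
    rw [mul_one, ← Real.exp_add, neg_add_cancel, Real.exp_zero, mul_one] at h2
    refine h2.congr_fun ?_
    rintro ⟨k, o⟩
    exact shapeProb_succ t k o x

end

/-! ### The log-likelihood ratio at the root of the limiting tree -/

/-- The posterior probability of the label `1` at the root. -/
noncomputable def posterior (p : ℝ) (ψ : Matrix (Fin 2) (Fin 2) ℝ) (t : ℕ) (o : Shape t) : ℝ :=
  msg p ψ t o 0 / ∑ x, msg p ψ t o x

/-- The probability of a shape. -/
noncomputable def shapeMass (p q d : ℝ) (ψ : Matrix (Fin 2) (Fin 2) ℝ) (t : ℕ) (o : Shape t) : ℝ :=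
  ∑ x, shapeProb p q d ψ t o x

/-- The contribution to the log-likelihood ratio of a child with rescaled posterior `s`. -/
noncomputable def childLlr (p s : ℝ) : ℝ := Real.log (1 + s / p) - Real.log (1 - s / (1 - p))

/-- The log-likelihood ratio at the root. -/
noncomputable def llr (p : ℝ) (ψ : Matrix (Fin 2) (Fin 2) ℝ) (t : ℕ) :
    Shape (t + 1) → ℝ :=
  fun o => ∑ j : Fin o.1, childLlr p ((1 - ψ 0 1) * (posterior p ψ t (o.2 j) - p))

/-- The law of the log-likelihood ratio at the root, given that the label of the root is `1`. -/
noncomputable def llrLaw (p q d : ℝ) (ψ : Matrix (Fin 2) (Fin 2) ℝ) (t : ℕ) : Measure ℝ :=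
  Measure.sum fun o : Shape (t + 1) =>
    ENNReal.ofReal (shapeProb p q d ψ (t + 1) o 0 / p) • Measure.dirac (llr p ψ t o)

/-- The second moment of the deviation of the posterior from the prior. -/
noncomputable def postVar (p q d : ℝ) (ψ : Matrix (Fin 2) (Fin 2) ℝ) (t : ℕ) : ℝ :=
  ∑' o, shapeMass p q d ψ t o * (posterior p ψ t o - p) ^ 2

/-- The advantage of the likelihood ratio test in the limiting tree. -/
noncomputable def treeAdvantage (p q d : ℝ) (ψ : Matrix (Fin 2) (Fin 2) ℝ) (t : ℕ) : ℝ :=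
  ∑' o, max 0 (shapeProb p q d ψ t o 0 / p - shapeProb p q d ψ t o 1 / (1 - p))

section

variable {p q d : ℝ} {ψ : Matrix (Fin 2) (Fin 2) ℝ}

theorem posterior_nonneg (h : Admissible p q d ψ) (t : ℕ) (o : Shape t) :
    0 ≤ posterior p ψ t o :=
  div_nonneg (msg_nonneg h t o 0) (sum_msg_pos h t o).le

theorem posterior_le_one (h : Admissible p q d ψ) (t : ℕ) (o : Shape t) :
    posterior p ψ t o ≤ 1 := by
  refine div_le_one_of_le₀ ?_ (sum_msg_pos h t o).le
  rw [Fin.sum_univ_two]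
  linarith [msg_nonneg h t o 1]

theorem abs_posterior_sub_le (h : Admissible p q d ψ) (t : ℕ) (o : Shape t) :
    |posterior p ψ t o - p| ≤ 1 := by
  have := posterior_nonneg h t o; have := posterior_le_one h t o
  have := h.p_pos; have := h.p_lt
  rw [abs_le]; constructor <;> linarith

theorem msg_zero_eq (h : Admissible p q d ψ) (t : ℕ) (o : Shape t) :
    msg p ψ t o 0 = (∑ x, msg p ψ t o x) * posterior p ψ t o := by
  rw [posterior, mul_div_cancel₀ _ (sum_msg_pos h t o).ne']

theorem msg_one_eq (h : Admissible p q d ψ) (t : ℕ) (o : Shape t) :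
    msg p ψ t o 1 = (∑ x, msg p ψ t o x) * (1 - posterior p ψ t o) := by
  rw [mul_sub, ← msg_zero_eq h, Fin.sum_univ_two]; ring

theorem shapeMass_eq (t : ℕ) (o : Shape t) :
    shapeMass p q d ψ t o = shapeFactor q d t o * ∑ x, msg p ψ t o x := by
  simp only [shapeMass, shapeProb, Finset.mul_sum]

theorem shapeProb_zero_eq (h : Admissible p q d ψ) (t : ℕ) (o : Shape t) :
    shapeProb p q d ψ t o 0 = shapeMass p q d ψ t o * posterior p ψ t o := by
  rw [shapeMass_eq, mul_assoc, ← msg_zero_eq h]; rfl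

theorem shapeMass_nonneg (h : Admissible p q d ψ) (t : ℕ) (o : Shape t) :
    0 ≤ shapeMass p q d ψ t o :=
  Finset.sum_nonneg fun x _ => shapeProb_nonneg h t o x

theorem hasSum_shapeMass (h : Admissible p q d ψ) (t : ℕ) :
    HasSum (shapeMass p q d ψ t) 1 := by
  rw [← sum_prior p]
  exact hasSum_sum fun x _ => hasSum_shapeProb h t x

/-- The row conditions leave a single free parameter: all entries of `ψ - 1` are fixed multiples of
`1 - b`. -/
theorem Admissible.psi_zero_zero (h : Admissible p q d ψ) :
    ψ 0 0 = 1 + (1 - ψ 0 1) * (1 - p) / p := by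
  have h0 := h.row 0
  simp [prior] at h0
  have := h.p_pos.ne'
  field_simp
  linarith

theorem Admissible.psi_one_one (h : Admissible p q d ψ) :
    ψ 1 1 = 1 + (1 - ψ 0 1) * p / (1 - p) := by
  have h0 := h.row 1
  simp [prior, h.symm 1 0] at h0
  have : 1 - p ≠ 0 := (sub_pos.2 h.p_lt).ne'
  field_simp
  linarith

/-- Once its message is normalised, a child acts on its parent only through `(1 - b)` times the
deviation of its posterior from the prior. This is the small parameter of the expansion. -/
theorem sum_psi_zero_msg (h : Admissible p q d ψ) (t : ℕ) (o : Shape t) :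
    ∑ x', ψ 0 x' * msg p ψ t o x' = (∑ x, msg p ψ t o x) *
      (1 + (1 - ψ 0 1) * (posterior p ψ t o - p) / p) := by
  have := h.p_pos.ne'
  rw [Fin.sum_univ_two, msg_zero_eq h, msg_one_eq h, h.psi_zero_zero]
  field_simp
  ring

theorem sum_psi_one_msg (h : Admissible p q d ψ) (t : ℕ) (o : Shape t) :
    ∑ x', ψ 1 x' * msg p ψ t o x' = (∑ x, msg p ψ t o x) *
      (1 - (1 - ψ 0 1) * (posterior p ψ t o - p) / (1 - p)) := by
  have : 1 - p ≠ 0 := (sub_pos.2 h.p_lt).ne'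
  rw [Fin.sum_univ_two, msg_zero_eq h, msg_one_eq h, h.psi_one_one, h.symm 1 0]
  field_simp
  ring

theorem child_zero_pos (h : Admissible p q d ψ) (t : ℕ) (o : Shape t) :
    0 < 1 + (1 - ψ 0 1) * (posterior p ψ t o - p) / p := by
  have h1 := sum_psi_mul_pos h (msg_nonneg h t o) (sum_msg_pos h t o) 0
  rw [sum_psi_zero_msg h] at h1
  exact pos_of_mul_pos_right h1 (sum_msg_pos h t o).le

theorem child_one_pos (h : Admissible p q d ψ) (t : ℕ) (o : Shape t) :
    0 < 1 - (1 - ψ 0 1) * (posterior p ψ t o - p) / (1 - p) := by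
  have h1 := sum_psi_mul_pos h (msg_nonneg h t o) (sum_msg_pos h t o) 1
  rw [sum_psi_one_msg h] at h1
  exact pos_of_mul_pos_right h1 (sum_msg_pos h t o).le

theorem exp_neg_childLlr {s : ℝ} (h0 : 0 < 1 + s / p) (h1 : 0 < 1 - s / (1 - p)) :
    Real.exp (-childLlr p s) = (1 - s / (1 - p)) / (1 + s / p) := by
  rw [childLlr, neg_sub, Real.exp_sub, Real.exp_log h0, Real.exp_log h1]

/-- Likelihood ratios multiply over the conditionally independent children. -/
theorem exp_neg_llr (h : Admissible p q d ψ) (t : ℕ) (o : Shape (t + 1)) :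
    Real.exp (-llr p ψ t o) =
      (msg p ψ (t + 1) o 1 / (1 - p)) / (msg p ψ (t + 1) o 0 / p) := by
  obtain ⟨k, o⟩ := o
  have hp := h.p_pos.ne'
  have hp1 : 1 - p ≠ 0 := (sub_pos.2 h.p_lt).ne'
  simp only [msg, llr, ← Finset.sum_neg_distrib, Real.exp_sum]
  have h1 : ∀ j, Real.exp (-childLlr p ((1 - ψ 0 1) * (posterior p ψ t (o j) - p))) =
      (∑ x', ψ 1 x' * msg p ψ t (o j) x') / ∑ x', ψ 0 x' * msg p ψ t (o j) x' := fun j => by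
    rw [exp_neg_childLlr (child_zero_pos h t _) (child_one_pos h t _), sum_psi_zero_msg h,
      sum_psi_one_msg h, mul_div_mul_left _ _ (sum_msg_pos h t _).ne']
  rw [Finset.prod_congr rfl fun j _ => h1 j, Finset.prod_div_distrib]
  simp [prior, hp, hp1]

/-- The law of the tree given label 2 has density `exp (-llr)` with respect to its law given label
1, so all later expectations can be taken under label 1 alone. -/
theorem shapeProb_one_div_eq (h : Admissible p q d ψ) (t : ℕ) (o : Shape (t + 1)) :
    shapeProb p q d ψ (t + 1) o 1 / (1 - p) =
      shapeProb p q d ψ (t + 1) o 0 / p * Real.exp (-llr p ψ t o) := by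
  have hp := h.p_pos.ne'
  have hp1 : 1 - p ≠ 0 := (sub_pos.2 h.p_lt).ne'
  have := (msg_succ_pos h t o 0).ne'
  rw [exp_neg_llr h, shapeProb, shapeProb]
  field_simp

theorem posterior_succ (h : Admissible p q d ψ) (t : ℕ) (o : Shape (t + 1)) :
    posterior p ψ (t + 1) o = p * (1 / (p + (1 - p) * Real.exp (-llr p ψ t o))) := by
  have hp := h.p_pos
  have hp1 : 0 < 1 - p := sub_pos.2 h.p_lt
  have h0 := msg_succ_pos h t o 0
  have h1 := msg_succ_pos h t o 1
  rw [exp_neg_llr h, posterior, Fin.sum_univ_two]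
  field_simp

theorem hasSum_weight (h : Admissible p q d ψ) (t : ℕ) :
    HasSum (fun o => shapeProb p q d ψ t o 0 / p) 1 := by
  have := (hasSum_shapeProb h t 0).div_const p
  simpa [prior, h.p_pos.ne'] using this

theorem weight_nonneg (h : Admissible p q d ψ) (t : ℕ) (o : Shape t) :
    0 ≤ shapeProb p q d ψ t o 0 / p :=
  div_nonneg (shapeProb_nonneg h t o 0) h.p_pos.le

theorem isProbabilityMeasure_llrLaw (h : Admissible p q d ψ) (t : ℕ) :
    IsProbabilityMeasure (llrLaw p q d ψ t) := by
  constructor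
  simp only [llrLaw, Measure.sum_apply _ MeasurableSet.univ, Measure.smul_apply, measure_univ,
    smul_eq_mul, mul_one]
  rw [← ENNReal.ofReal_tsum_of_nonneg (weight_nonneg h (t + 1)) (hasSum_weight h (t + 1)).summable,
    (hasSum_weight h (t + 1)).tsum_eq, ENNReal.ofReal_one]

theorem integral_llrLaw (h : Admissible p q d ψ) (t : ℕ) {E : Type*} [NormedAddCommGroup E]
    [NormedSpace ℝ E] [CompleteSpace E] {F : ℝ → E} (hF : StronglyMeasurable F) {C : ℝ}
    (hC : ∀ x, ‖F x‖ ≤ C) :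
    ∫ x, F x ∂(llrLaw p q d ψ t) =
      ∑' o, (shapeProb p q d ψ (t + 1) o 0 / p) • F (llr p ψ t o) := by
  have := isProbabilityMeasure_llrLaw h t
  have hi : Integrable F (llrLaw p q d ψ t) :=
    Integrable.of_bound hF.aestronglyMeasurable C (ae_of_all _ hC)
  rw [llrLaw] at hi ⊢
  rw [integral_sum_measure hi]
  refine tsum_congr fun o => ?_
  rw [integral_smul_measure, integral_dirac, ENNReal.toReal_ofReal (weight_nonneg h _ o)]

theorem treeAdvantage_succ (h : Admissible p q d ψ) (t : ℕ) :
    treeAdvantage p q d ψ (t + 1) = ∫ x, max 0 (1 - Real.exp (-x)) ∂(llrLaw p q d ψ t) := by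
  rw [integral_llrLaw h t (Continuous.stronglyMeasurable (by fun_prop))
    abs_posPart_one_sub_exp_le, treeAdvantage]
  refine tsum_congr fun o => ?_
  rw [shapeProb_one_div_eq h, smul_eq_mul, mul_max_of_nonneg _ _ (weight_nonneg h _ o)]
  congr 1 <;> ring

/-- By Bayes' rule, mass times posterior is the probability of the shape together with label 1.
Hence the second moment of the posterior is `p` times its mean under label 1, and its mean is `p`.
-/
theorem postVar_eq (h : Admissible p q d ψ) (t : ℕ) :
    postVar p q d ψ t =
      p * ((∑' o, shapeProb p q d ψ t o 0 / p * posterior p ψ t o) - p) := by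
  have hp := h.p_pos.ne'
  have hs : Summable fun o => shapeProb p q d ψ t o 0 / p * posterior p ψ t o := by
    refine Summable.of_nonneg_of_le (fun o => mul_nonneg (weight_nonneg h t o)
      (posterior_nonneg h t o)) (fun o => ?_) (hasSum_weight h t).summable
    exact mul_le_of_le_one_right (weight_nonneg h t o) (posterior_le_one h t o)
  have h1 := ((hs.hasSum.mul_left p).sub ((hasSum_weight h t).mul_left (2 * p ^ 2))).add
    ((hasSum_shapeMass h t).mul_left (p ^ 2))
  have h2 : p * ((∑' o, shapeProb p q d ψ t o 0 / p * posterior p ψ t o) - p) =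
    p * (∑' o, shapeProb p q d ψ t o 0 / p * posterior p ψ t o) - 2 * p ^ 2 * 1 + p ^ 2 * 1 := by
    ring
  rw [h2, ← h1.tsum_eq]
  refine tsum_congr fun o => ?_
  rw [shapeProb_zero_eq h]
  field_simp
  ring

theorem postVar_succ (h : Admissible p q d ψ) (t : ℕ) :
    postVar p q d ψ (t + 1) = p ^ 2 *
      ((∫ x, 1 / (p + (1 - p) * Real.exp (-x)) ∂(llrLaw p q d ψ t)) - 1) := by
  rw [postVar_eq h, integral_llrLaw h t (Measurable.stronglyMeasurable (by fun_prop))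
    (fun x => inv_posterior_den_le h.p_pos h.p_lt (Real.exp_pos (-x)).le)]
  simp_rw [posterior_succ h, mul_left_comm _ p, tsum_mul_left, smul_eq_mul]
  ring

/-- A revealed leaf has posterior 0 or 1, an unrevealed one has posterior `p`. -/
theorem postVar_zero (h : Admissible p q d ψ) : postVar p q d ψ 0 = q * p * (1 - p) := by
  have h1 : ∀ y : Option (Fin 2), shapeProb p q d ψ 0 y 0 / p * posterior p ψ 0 y =
      if y = none then (1 - q) * p else if y = some 0 then q else 0 := by
    have hp := h.p_pos.ne'
    intro y
    rcases y with - | y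
    · simp [shapeProb, shapeFactor, msg, posterior, leafMsg, prior, hp]
    · fin_cases y <;> simp [shapeProb, shapeFactor, msg, posterior, leafMsg, prior, hp]
  rw [postVar_eq h]
  have h2 := tsum_fintype (L := .unconditional _) fun y : Option (Fin 2) =>
    if y = none then (1 - q) * p else if y = some 0 then q else 0
  have h3 : ∑' o : Shape 0, shapeProb p q d ψ 0 o 0 / p * posterior p ψ 0 o = _ :=
    (tsum_congr h1).trans h2
  rw [h3, Fintype.sum_option, Fin.sum_univ_two]
  simp
  ring

end

/-! ### The central limit theorem for the log-likelihood ratio -/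

/-- The derivative of the remainder is `o(|u|)` since `g'` is differentiable at 0; the mean value
inequality on the ball of radius `|s|` then gives `o(s²)`. -/
theorem taylor_two_isLittleO {g g' : ℝ → ℂ} {γ : ℂ}
    (hg : ∀ᶠ s in 𝓝 0, HasDerivAt g (g' s) s) (hg' : HasDerivAt g' γ 0) :
    (fun s : ℝ => g s - g 0 - s * g' 0 - s ^ 2 * (γ / 2)) =o[𝓝 0] fun s => s ^ 2 := by
  rw [Asymptotics.isLittleO_iff]
  intro η hη
  have h1 := (hasDerivAt_iff_isLittleO_nhds_zero.1 hg')
  rw [Asymptotics.isLittleO_iff] at h1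
  obtain ⟨δ, hδ, h2⟩ := Metric.eventually_nhds_iff_ball.1 (hg.and (h1 hη))
  filter_upwards [Metric.ball_mem_nhds (0 : ℝ) hδ] with s hs
  have hderiv : ∀ u ∈ Metric.closedBall (0 : ℝ) |s|,
      HasDerivWithinAt (fun u : ℝ => g u - g 0 - u * g' 0 - u ^ 2 * (γ / 2))
        (g' u - g' 0 - u * γ) (Metric.closedBall 0 |s|) u := by
    intro u hu
    have hu' : u ∈ Metric.ball (0 : ℝ) δ := by
      simp only [Metric.mem_ball, Metric.mem_closedBall, dist_zero_right, Real.norm_eq_abs] at *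
      exact hu.trans_lt hs
    have h3 := (h2 u hu').1
    have h4 : HasDerivAt (fun u : ℝ => (u : ℂ)) 1 u := Complex.ofRealCLM.hasDerivAt
    have h5 := ((h3.sub_const (g 0)).sub (h4.mul_const (g' 0))).sub ((h4.pow 2).mul_const (γ / 2))
    refine (h5.congr_deriv ?_).hasDerivWithinAt
    push_cast
    ring
  have hbound : ∀ u ∈ Metric.closedBall (0 : ℝ) |s|, ‖g' u - g' 0 - u * γ‖ ≤ η * |s| := by
    intro u hu
    have hu' : u ∈ Metric.ball (0 : ℝ) δ := by
      simp only [Metric.mem_ball, Metric.mem_closedBall, dist_zero_right, Real.norm_eq_abs] at *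
      exact hu.trans_lt hs
    have h3 := (h2 u hu').2
    simp only [zero_add, Complex.real_smul, Real.norm_eq_abs] at h3
    refine h3.trans (mul_le_mul_of_nonneg_left ?_ hη.le)
    simpa using hu
  have := (convex_closedBall (0 : ℝ) |s|).norm_image_sub_le_of_norm_hasDerivWithin_le
    hderiv hbound (Metric.mem_closedBall_self (abs_nonneg s)) (y := s) (by simp)
  simpa [sq, mul_assoc] using this

/-- The contribution to the characteristic function of a child with rescaled posterior `s`. -/
noncomputable def childChar (p ξ s : ℝ) : ℂ :=
  (1 + s / p : ℝ) * (Complex.exp ((ξ * childLlr p s : ℝ) * Complex.I) - 1)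

theorem childLlr_zero (p : ℝ) : childLlr p 0 = 0 := by simp [childLlr]

theorem childChar_zero (p ξ : ℝ) : childChar p ξ 0 = 0 := by simp [childChar, childLlr_zero]

theorem hasDerivAt_childLlr {p s : ℝ} (h0 : 1 + s / p ≠ 0)
    (h1 : 1 - s / (1 - p) ≠ 0) :
    HasDerivAt (childLlr p) (1 / p / (1 + s / p) + 1 / (1 - p) / (1 - s / (1 - p))) s := by
  have a0 : HasDerivAt (fun s => 1 + s / p) (1 / p) s := ((hasDerivAt_id s).div_const p).const_add 1
  have a1 : HasDerivAt (fun s => 1 - s / (1 - p)) (-(1 / (1 - p))) s :=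
    ((hasDerivAt_id s).div_const (1 - p)).const_sub 1
  refine ((a0.log h0).sub (a1.log h1)).congr_deriv ?_
  ring

theorem childChar_isLittleO {p : ℝ} (hp0 : 0 < p) (hp1 : p < 1) (ξ : ℝ) :
    (fun s : ℝ => childChar p ξ s - s * (ξ * Complex.I / (p * (1 - p)) : ℂ) -
      s ^ 2 * ((ξ * Complex.I - ξ ^ 2) / 2 / (p * (1 - p)) ^ 2 : ℂ)) =o[𝓝 0] fun s => s ^ 2 := by
  have hp := hp0.ne'
  have hq : 1 - p ≠ 0 := (sub_pos.2 hp1).ne'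
  have hpc : (p : ℂ) ≠ 0 := by exact_mod_cast hp
  have hqc : (1 - p : ℂ) ≠ 0 := by exact_mod_cast hq
  let k : ℝ → ℝ := fun s => 1 / p / (1 + s / p) + 1 / (1 - p) / (1 - s / (1 - p))
  let E : ℝ → ℂ := fun s => Complex.exp ((ξ * childLlr p s : ℝ) * Complex.I)
  let G : ℝ → ℂ := fun s =>
    (1 / p : ℝ) * (E s - 1) + (1 + s / p : ℝ) * (E s * ((ξ * k s : ℝ) * Complex.I))
  have hE : ∀ s, 1 + s / p ≠ 0 → 1 - s / (1 - p) ≠ 0 →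
      HasDerivAt E (E s * ((ξ * k s : ℝ) * Complex.I)) s := fun s h0 h1 =>
    ((((hasDerivAt_childLlr h0 h1).const_mul ξ).ofReal_comp).mul_const Complex.I).cexp
  have ha : ∀ s, HasDerivAt (fun s : ℝ => ((1 + s / p : ℝ) : ℂ)) (1 / p : ℝ) s := fun s =>
    (((hasDerivAt_id s).div_const p).const_add 1).ofReal_comp
  have h0 : ∀ᶠ s : ℝ in 𝓝 0, 1 + s / p ≠ 0 := by
    have : Tendsto (fun s : ℝ => 1 + s / p) (𝓝 0) (𝓝 (1 + 0 / p)) :=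
      Continuous.tendsto (by fun_prop) _
    exact this.eventually_ne (by simp)
  have h1 : ∀ᶠ s : ℝ in 𝓝 0, 1 - s / (1 - p) ≠ 0 := by
    have : Tendsto (fun s : ℝ => 1 - s / (1 - p)) (𝓝 0) (𝓝 (1 - 0 / (1 - p))) :=
      Continuous.tendsto (by fun_prop) _
    exact this.eventually_ne (by simp)
  have hG : ∀ᶠ s in 𝓝 0, HasDerivAt (childChar p ξ) (G s) s := by
    filter_upwards [h0, h1] with s h0 h1
    exact (ha s).mul ((hE s h0 h1).sub_const 1)
  have hk : HasDerivAt k (1 / (1 - p) ^ 2 - 1 / p ^ 2) 0 := by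
    have a0 : HasDerivAt (fun s => 1 + s / p) (1 / p) 0 :=
      ((hasDerivAt_id (0 : ℝ)).div_const p).const_add 1
    have a1 : HasDerivAt (fun s => 1 - s / (1 - p)) (-(1 / (1 - p))) 0 :=
      ((hasDerivAt_id (0 : ℝ)).div_const (1 - p)).const_sub 1
    refine (((hasDerivAt_const (0 : ℝ) (1 / p)).div a0 (by simp)).add
      ((hasDerivAt_const (0 : ℝ) (1 / (1 - p))).div a1 (by simp))).congr_deriv ?_
    simp
    field_simp
    ring
  -- Besides `-ξ²`, the second derivative contains `ξ i`, which combines the curvature of `childLlr`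
  -- with the tilt `1 + s / p`. This term produces the mean `μ/2` of the limit.
  have hG' : HasDerivAt G ((ξ * Complex.I - ξ ^ 2) / (p * (1 - p)) ^ 2 : ℂ) 0 := by
    have e := hE 0 (by simp) (by simp)
    refine (((e.sub_const 1).const_mul ((1 / p : ℝ) : ℂ)).add ((ha 0).mul (e.mul
      (((hk.const_mul ξ).ofReal_comp).mul_const Complex.I)))).congr_deriv ?_
    have hE0 : E 0 = 1 := by simp [E, childLlr_zero]
    simp only [Pi.mul_apply, hE0, k, zero_div, add_zero, sub_zero, div_one]
    push_cast
    field_simp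
    ring_nf
    simp only [Complex.I_sq]
    ring
  refine (taylor_two_isLittleO hG hG').congr_left fun s => ?_
  have hG0 : G 0 = ξ * Complex.I / (p * (1 - p)) := by
    have hE0 : E 0 = 1 := by simp [E, childLlr_zero]
    simp only [G, hE0, k, zero_div, add_zero, sub_zero, div_one]
    push_cast
    field_simp
    ring
  rw [childChar_zero, hG0]
  ring

/-! ### The characteristic function of the log-likelihood ratio -/

section

variable {p q d : ℝ} {ψ : Matrix (Fin 2) (Fin 2) ℝ}

theorem sum_psi_shapeProb (h : Admissible p q d ψ) (t : ℕ) (o : Shape t) :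
    ∑ x', ψ 0 x' * shapeProb p q d ψ t o x' = shapeMass p q d ψ t o *
      (1 + (1 - ψ 0 1) * (posterior p ψ t o - p) / p) := by
  rw [shapeMass_eq, mul_assoc, ← sum_psi_zero_msg h, Finset.mul_sum]
  exact Finset.sum_congr rfl fun x _ => by rw [shapeProb]; ring

theorem hasSum_child (h : Admissible p q d ψ) (t : ℕ) :
    HasSum (fun o => shapeMass p q d ψ t o *
      (1 + (1 - ψ 0 1) * (posterior p ψ t o - p) / p)) 1 := by
  have := hasSum_sum (s := Finset.univ) fun x' (_ : x' ∈ Finset.univ) =>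
    (hasSum_shapeProb h t x').mul_left (ψ 0 x')
  have e := h.row 0
  simp_rw [mul_comm (prior p _)] at e
  rw [e] at this
  simpa only [sum_psi_shapeProb h] using this

/-- A compound Poisson law has characteristic function `exp (d (E exp (i ξ X) - 1))`. Here the child
is drawn given that its parent has label 1; its law is `shapeMass` tilted by `1 + s / p`, and
`childChar` absorbs this tilt so that the sum is over the unconditional law. -/
theorem charFun_llrLaw (h : Admissible p q d ψ) (t : ℕ) (ξ : ℝ) :
    charFun (llrLaw p q d ψ t) ξ = Complex.exp (∑' o, shapeMass p q d ψ t o *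
      (d * childChar p ξ ((1 - ψ 0 1) * (posterior p ψ t o - p)))) := by
  set D : Shape t → ℝ := fun o => (1 - ψ 0 1) * (posterior p ψ t o - p) with hD
  have hF : ∀ x : ℝ, ‖Complex.exp ((ξ * x : ℝ) * Complex.I)‖ ≤ 1 := fun x =>
    (Complex.norm_exp_ofReal_mul_I _).le
  have e1 : charFun (llrLaw p q d ψ t) ξ =
      ∫ x : ℝ, Complex.exp ((ξ * x : ℝ) * Complex.I) ∂(llrLaw p q d ψ t) := by
    rw [charFun_apply_real]; simp
  let κ : Shape t → ℝ := fun o => shapeMass p q d ψ t o * (1 + D o / p)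
  have hκ : HasSum κ 1 := hasSum_child h t
  have hκ0 : ∀ o, 0 ≤ κ o := fun o => mul_nonneg (shapeMass_nonneg h t o) (child_zero_pos h t o).le
  let g : Shape t → ℂ := fun o => κ o * Complex.exp ((ξ * childLlr p (D o) : ℝ) * Complex.I)
  have hgn : ∀ o, ‖g o‖ = κ o := fun o => by
    simp only [g, norm_mul, Complex.norm_exp_ofReal_mul_I, mul_one, Complex.norm_real,
      Real.norm_of_nonneg (hκ0 o)]
  have hg : Summable fun o => ‖g o‖ := by simpa only [hgn] using hκ.summable
  have h2 := (hasSum_poisson_pi (d : ℂ) hg hg.of_norm.hasSum).mul_left (Complex.exp (-d))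
  have e2 : ∀ o : Shape (t + 1), (shapeProb p q d ψ (t + 1) o 0 / p) •
      Complex.exp ((ξ * llr p ψ t o : ℝ) * Complex.I) = Complex.exp (-d) *
      ((d : ℂ) ^ o.1 / (o.1.factorial : ℂ) * ∏ j, g (o.2 j)) := by
    rintro ⟨k, o⟩
    have hp := h.p_pos.ne'
    rw [shapeProb_succ, Complex.real_smul]
    simp only [llr, g, κ, hD, sum_psi_shapeProb h, prior, if_true, mul_div_cancel_left₀ _ hp]
    push_cast
    simp only [Finset.prod_mul_distrib, Finset.mul_sum, Finset.sum_mul, ← Complex.exp_sum]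
    simp only [mul_assoc]
  rw [e1, integral_llrLaw h t (Continuous.stronglyMeasurable (by fun_prop)) hF]
  have e3 := (h2.congr_fun e2).tsum_eq
  have e4 : ∑' o, (shapeMass p q d ψ t o : ℂ) * (d * childChar p ξ (D o)) =
      d * ∑' o, g o - d := by
    have h3 : HasSum (fun o => (κ o : ℂ)) 1 := by
      have := Complex.hasSum_ofReal.2 hκ
      rwa [Complex.ofReal_one] at this
    have h4 := ((hg.of_norm.hasSum.sub h3).mul_left (d : ℂ)).tsum_eq
    rw [show (d : ℂ) * ∑' o, g o - d = d * (∑' o, g o - 1) by ring, ← h4]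
    refine tsum_congr fun o => ?_
    simp only [g, κ, childChar]
    push_cast
    ring
  rw [e4, sub_eq_neg_add, Complex.exp_add]
  exact e3

/-- The linear term carries the diverging factor `d (1 - b)`, but it sums to zero because the
posterior averages to the prior. The quadratic term carries `d (1 - b)² = λ`, and the error is
controlled by the same quantity. -/
theorem norm_tsum_childChar_sub_le (h : Admissible p q d ψ) (t : ℕ) {lam ξ η δ : ℝ}
    (hlam : d * (1 - ψ 0 1) ^ 2 = lam)
    (hη : ∀ s : ℝ, |s| ≤ δ → ‖childChar p ξ s - s * (ξ * Complex.I / (p * (1 - p)) : ℂ) -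
      s ^ 2 * ((ξ * Complex.I - ξ ^ 2) / 2 / (p * (1 - p)) ^ 2 : ℂ)‖ ≤ η * s ^ 2)
    (hη0 : 0 ≤ η) (hε : |1 - ψ 0 1| ≤ δ) :
    ‖(∑' o, shapeMass p q d ψ t o *
      (d * childChar p ξ ((1 - ψ 0 1) * (posterior p ψ t o - p)))) -
      lam * postVar p q d ψ t * ((ξ * Complex.I - ξ ^ 2) / 2 / (p * (1 - p)) ^ 2 : ℂ)‖
      ≤ η * lam := by
  set ε := 1 - ψ 0 1
  set α : ℂ := ξ * Complex.I / (p * (1 - p))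
  set β : ℂ := (ξ * Complex.I - ξ ^ 2) / 2 / (p * (1 - p)) ^ 2
  set m := shapeMass p q d ψ t
  set D : Shape t → ℝ := fun o => posterior p ψ t o - p with hD
  have hm0 : ∀ o, 0 ≤ m o := shapeMass_nonneg h t
  have hm : HasSum m 1 := hasSum_shapeMass h t
  have hD1 : ∀ o, |D o| ≤ 1 := abs_posterior_sub_le h t
  have hmD : HasSum (fun o => m o * D o) 0 := by
    have h1 := (hasSum_shapeProb h t 0).sub (hm.mul_right p)
    simp only [prior, if_true, one_mul, sub_self] at h1
    refine h1.congr_fun fun o => ?_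
    rw [shapeProb_zero_eq h]
    simp only [m, D]
    ring
  have hD2 : ∀ o, D o ^ 2 ≤ 1 := fun o => by
    rw [← sq_abs]; exact pow_le_one₀ (abs_nonneg _) (hD1 o)
  have hmD2s : Summable fun o => m o * D o ^ 2 :=
    Summable.of_nonneg_of_le (fun o => mul_nonneg (hm0 o) (sq_nonneg _))
      (fun o => mul_le_of_le_one_right (hm0 o) (hD2 o)) hm.summable
  have hmD2 : HasSum (fun o => m o * D o ^ 2) (postVar p q d ψ t) := hmD2s.hasSum
  have hmDc : HasSum (fun o => ((m o * D o : ℝ) : ℂ)) 0 := by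
    have := Complex.hasSum_ofReal.2 hmD
    rwa [Complex.ofReal_zero] at this
  have hmD2c : HasSum (fun o => ((m o * D o ^ 2 : ℝ) : ℂ)) (postVar p q d ψ t : ℂ) :=
    Complex.hasSum_ofReal.2 hmD2
  have hd := h.d_pos
  let R : Shape t → ℂ := fun o =>
    childChar p ξ (ε * D o) - (ε * D o : ℝ) * α - (ε * D o : ℝ) ^ 2 * β
  have hR : ∀ o, ‖(m o : ℂ) * (d * R o)‖ ≤ m o * (η * lam) := fun o => by
    have h1 : |ε * D o| ≤ δ := by
      rw [abs_mul]
      exact (mul_le_of_le_one_right (abs_nonneg _) (hD1 o)).trans hε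
    rw [norm_mul, norm_mul, Complex.norm_real, Complex.norm_real, Real.norm_of_nonneg (hm0 o),
      Real.norm_of_nonneg hd.le]
    refine mul_le_mul_of_nonneg_left ?_ (hm0 o)
    calc d * ‖R o‖ ≤ d * (η * (ε * D o) ^ 2) := mul_le_mul_of_nonneg_left (hη _ h1) hd.le
      _ = η * (lam * D o ^ 2) := by rw [← hlam]; ring
      _ ≤ η * lam := by
        refine mul_le_mul_of_nonneg_left (mul_le_of_le_one_right ?_ (hD2 o)) hη0
        rw [← hlam]; positivity
  have hRs : Summable fun o => (m o : ℂ) * (d * R o) :=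
    Summable.of_norm_bounded (hm.summable.mul_right _) hR
  have h1 := ((hmDc.mul_right (d * ε * α : ℂ)).add (hmD2c.mul_right (lam * β : ℂ))).add hRs.hasSum
  have h2 : ∀ o, (m o : ℂ) * (d * childChar p ξ (ε * D o)) =
      ((m o * D o : ℝ) : ℂ) * (d * ε * α) + ((m o * D o ^ 2 : ℝ) : ℂ) * (lam * β) +
        (m o : ℂ) * (d * R o) := fun o => by
    simp only [R, ← hlam]
    push_cast
    ring
  have h3 := (h1.congr_fun h2).tsum_eq
  rw [h3]
  have h4 : (0 : ℂ) * (d * ε * α) + postVar p q d ψ t * (lam * β) +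
      ∑' o, (m o : ℂ) * (d * R o) - lam * postVar p q d ψ t * β = ∑' o, (m o : ℂ) * (d * R o) := by
    ring
  rw [h4]
  have h5 := tsum_of_norm_bounded (hm.mul_right (η * lam)) hR
  simpa using h5

end

/-! ### Weak limits as `d → ∞` and the recursion for the variances -/

section

variable {p q lam : ℝ} {ψ : ℝ → Matrix (Fin 2) (Fin 2) ℝ}

theorem charFun_llrGauss {μ : ℝ} (hμ : 0 ≤ μ) (ξ : ℝ) :
    charFun (llrGauss μ) ξ = Complex.exp (μ * ((ξ * Complex.I - ξ ^ 2) / 2)) := by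
  have h : ((μ.toNNReal : ℝ) : ℂ) = (μ : ℂ) := by rw [Real.coe_toNNReal _ hμ]
  rw [llrGauss, charFun_gaussianReal, h]
  congr 1
  push_cast
  ring

theorem tendsto_one_sub_affinity (hlam : ∀ᶠ d in atTop, d * (1 - ψ d 0 1) ^ 2 = lam) :
    Tendsto (fun d => 1 - ψ d 0 1) atTop (𝓝 0) := by
  have h1 : Tendsto (fun d : ℝ => lam / d) atTop (𝓝 0) := tendsto_const_nhds.div_atTop tendsto_id
  have h2 : Tendsto (fun d : ℝ => √(lam / d)) atTop (𝓝 0) := by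
    simpa [Function.comp_def] using (Real.continuous_sqrt.tendsto 0).comp h1
  refine squeeze_zero_norm' ?_ h2
  filter_upwards [hlam, eventually_gt_atTop 0] with d h hd
  rw [← h, mul_div_cancel_left₀ _ hd.ne', Real.sqrt_sq_eq_abs, Real.norm_eq_abs]

theorem tendsto_charFun_llrLaw (hadm : ∀ᶠ d in atTop, Admissible p q d (ψ d))
    (hlam : ∀ᶠ d in atTop, d * (1 - ψ d 0 1) ^ 2 = lam) (t : ℕ) {V : ℝ}
    (hV : Tendsto (fun d => postVar p q d (ψ d) t) atTop (𝓝 V)) (hV0 : 0 ≤ V)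
    (hlam0 : 0 ≤ lam) (ξ : ℝ) :
    Tendsto (fun d => charFun (llrLaw p q d (ψ d) t) ξ) atTop
      (𝓝 (charFun (llrGauss (lam * V / (p * (1 - p)) ^ 2)) ξ)) := by
  obtain ⟨d₀, h₀⟩ := hadm.exists
  set β : ℂ := (ξ * Complex.I - ξ ^ 2) / 2 / (p * (1 - p)) ^ 2
  have hμ : 0 ≤ lam * V / (p * (1 - p)) ^ 2 := by positivity
  have e : charFun (llrGauss (lam * V / (p * (1 - p)) ^ 2)) ξ = Complex.exp (lam * V * β) := by
    rw [charFun_llrGauss hμ]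
    congr 1
    simp only [β]
    push_cast
    ring
  rw [e]
  have h1 : Tendsto (fun d => ∑' o, (shapeMass p q d (ψ d) t o : ℂ) *
      (d * childChar p ξ ((1 - ψ d 0 1) * (posterior p (ψ d) t o - p)))) atTop
      (𝓝 (lam * V * β)) := by
    have h2 : Tendsto (fun d => (lam * postVar p q d (ψ d) t * β : ℂ)) atTop
        (𝓝 (lam * V * β)) :=
      (((Complex.continuous_ofReal.tendsto V).comp hV).const_mul (lam : ℂ)).mul_const β
    have h3 : Tendsto (fun d => (∑' o, (shapeMass p q d (ψ d) t o : ℂ) *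
      (d * childChar p ξ ((1 - ψ d 0 1) * (posterior p (ψ d) t o - p)))) -
        (lam * postVar p q d (ψ d) t * β : ℂ)) atTop (𝓝 0) := by
      rw [Metric.tendsto_nhds]
      intro η hη
      -- Chosen so that `η' * lam < η`; the added 1 allows `lam = 0`.
      set η' := η / (2 * (lam + 1)) with hη'
      have hη'0 : 0 < η' := by positivity
      have h4 := Asymptotics.isLittleO_iff.1 (childChar_isLittleO h₀.p_pos h₀.p_lt ξ) hη'0
      obtain ⟨δ, hδ, h5⟩ := Metric.eventually_nhds_iff_ball.1 h4
      filter_upwards [hadm, hlam, (tendsto_one_sub_affinity hlam).eventually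
        (Metric.ball_mem_nhds 0 (half_pos hδ))] with d had hl hε
      rw [dist_zero_right]
      refine (norm_tsum_childChar_sub_le had t (δ := δ / 2) hl (fun s hs => ?_) hη'0.le
        ?_).trans_lt ?_
      · have := h5 s (by simpa using hs.trans_lt (half_lt_self hδ))
        simpa using this
      · simpa using (Metric.mem_ball.1 hε).le
      · rw [hη', div_mul_eq_mul_div, div_lt_iff₀ (by positivity)]
        nlinarith
    simpa using h3.add h2
  refine ((Complex.continuous_exp.tendsto _).comp h1).congr' ?_
  filter_upwards [hadm] with d had
  exact (charFun_llrLaw had t ξ).symm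

theorem tendsto_integral_llrLaw (hadm : ∀ᶠ d in atTop, Admissible p q d (ψ d))
    (hlam : ∀ᶠ d in atTop, d * (1 - ψ d 0 1) ^ 2 = lam) (t : ℕ) {V : ℝ}
    (hV : Tendsto (fun d => postVar p q d (ψ d) t) atTop (𝓝 V)) (hV0 : 0 ≤ V)
    (hlam0 : 0 ≤ lam) {F : ℝ → ℝ} (hF : Continuous F) {C : ℝ} (hC : ∀ x, ‖F x‖ ≤ C) :
    Tendsto (fun d => ∫ x, F x ∂(llrLaw p q d (ψ d) t)) atTop
      (𝓝 (∫ x, F x ∂(llrGauss (lam * V / (p * (1 - p)) ^ 2)))) := by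
  classical
  -- Convergence of characteristic functions is turned into weak convergence along sequences `u →
  -- ∞`. Terms for which `llrLaw` is not a probability measure are replaced by the limit law; there
  -- are finitely many of them.
  refine Filter.tendsto_of_seq_tendsto fun u hu => ?_
  let μ₀ : ProbabilityMeasure ℝ := ⟨llrGauss (lam * V / (p * (1 - p)) ^ 2), inferInstance⟩
  let P : ℕ → ProbabilityMeasure ℝ := fun n =>
    if h : IsProbabilityMeasure (llrLaw p q (u n) (ψ (u n)) t) then
      ⟨llrLaw p q (u n) (ψ (u n)) t, h⟩ else μ₀
  have hP : ∀ᶠ n in atTop, ((P n : ProbabilityMeasure ℝ) : Measure ℝ) =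
      llrLaw p q (u n) (ψ (u n)) t := by
    filter_upwards [hu.eventually hadm] with n hn
    have h := isProbabilityMeasure_llrLaw hn t
    have h' : P n = ⟨llrLaw p q (u n) (ψ (u n)) t, h⟩ := dif_pos h
    rw [h']
    rfl
  have h1 : Tendsto P atTop (𝓝 μ₀) := by
    rw [ProbabilityMeasure.tendsto_iff_tendsto_charFun]
    intro ξ
    refine ((tendsto_charFun_llrLaw hadm hlam t hV hV0 hlam0 ξ).comp hu).congr' ?_
    filter_upwards [hP] with n hn
    rw [hn]; rfl
  rw [ProbabilityMeasure.tendsto_iff_forall_integral_tendsto] at h1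
  refine (h1 (BoundedContinuousFunction.ofNormedAddCommGroup F hF C hC)).congr' ?_
  filter_upwards [hP] with n hn
  rw [hn]; rfl

theorem continuous_inv_posterior_den (hp0 : 0 < p) (hp1 : p < 1) :
    Continuous fun x => 1 / (p + (1 - p) * Real.exp (-x)) :=
  Continuous.div (by fun_prop) (by fun_prop) fun x =>
    (posterior_den_pos hp0 hp1 (Real.exp_pos (-x)).le).ne'

/-- The variance at depth `t` determines the Gaussian limit of the log-likelihood ratio at depth `t
+ 1`, and the variance there is the integral of a bounded continuous function of that ratio. So the
limits propagate upwards. -/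
theorem tendsto_postVar (hadm : ∀ᶠ d in atTop, Admissible p q d (ψ d))
    (hlam : ∀ᶠ d in atTop, d * (1 - ψ d 0 1) ^ 2 = lam) (hlam0 : 0 ≤ lam) (t : ℕ) :
    ∃ V, 0 ≤ V ∧ lam * V / (p * (1 - p)) ^ 2 = muSeq p q lam t ∧
      Tendsto (fun d => postVar p q d (ψ d) t) atTop (𝓝 V) := by
  obtain ⟨d₀, h₀⟩ := hadm.exists
  have hp0 := h₀.p_pos
  have hp1 : 0 < 1 - p := sub_pos.2 h₀.p_lt
  have hq0 := h₀.q_nonneg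
  induction t with
  | zero =>
    refine ⟨q * p * (1 - p), by positivity, ?_, ?_⟩
    · simp only [muSeq]; field_simp
    · refine tendsto_const_nhds.congr' ?_
      filter_upwards [hadm] with d hd
      exact (postVar_zero hd).symm
  | succ t ih =>
    obtain ⟨V, hV0, hV, hVt⟩ := ih
    have h1 := ((tendsto_integral_llrLaw hadm hlam t hVt hV0 hlam0
      (continuous_inv_posterior_den hp0 h₀.p_lt)
      (fun x => inv_posterior_den_le hp0 h₀.p_lt (Real.exp_pos (-x)).le)).sub_const 1).const_mul
      (p ^ 2)
    have h2 : Tendsto (fun d => postVar p q d (ψ d) (t + 1)) atTop _ := h1.congr' (by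
      filter_upwards [hadm] with d hd
      exact (postVar_succ hd t).symm)
    refine ⟨_, ?_, ?_, h2⟩
    · refine ge_of_tendsto h2 ?_
      filter_upwards [hadm] with d hd
      exact tsum_nonneg fun o => mul_nonneg (shapeMass_nonneg hd _ o) (sq_nonneg _)
    -- The factor `p ^ 2` of `postVar_succ` turns `λ / (p (1 - p))²` into the constant `λ / (1 -
    -- p)²` of `G`.
    · have hμ := muSeq_nonneg hp0 h₀.p_lt hq0 hlam0 t
      rw [muSeq, gMap_eq_integral hμ, ← hV, integral_sub _ (integrable_const _)]
      · simp only [integral_const, probReal_univ, smul_eq_mul, mul_one]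
        field_simp
      · simpa using integrable_inv_posterior_den hp0 h₀.p_lt (llrGauss _) (-1)

theorem tendsto_treeAdvantage_succ (hadm : ∀ᶠ d in atTop, Admissible p q d (ψ d))
    (hlam : ∀ᶠ d in atTop, d * (1 - ψ d 0 1) ^ 2 = lam) (hlam0 : 0 ≤ lam) (t : ℕ) :
    Tendsto (fun d => treeAdvantage p q d (ψ d) (t + 1)) atTop
      (𝓝 (gaussSucc (muSeq p q lam t))) := by
  obtain ⟨d₀, h₀⟩ := hadm.exists
  obtain ⟨V, hV0, hV, hVt⟩ := tendsto_postVar hadm hlam hlam0 t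
  rw [gaussSucc_eq_integral (muSeq_nonneg h₀.p_pos h₀.p_lt h₀.q_nonneg hlam0 t), ← hV]
  refine (tendsto_integral_llrLaw hadm hlam t hVt hV0 hlam0 (by fun_prop)
    abs_posPart_one_sub_exp_le).congr' ?_
  filter_upwards [hadm] with d hd
  exact (treeAdvantage_succ hd t).symm

/-- The limits of the advantage in the trees of all depths. -/
theorem exists_tendsto_treeAdvantage (hadm : ∀ᶠ d in atTop, Admissible p q d (ψ d))
    (hlam : ∀ᶠ d in atTop, d * (1 - ψ d 0 1) ^ 2 = lam) (hlam0 : 0 ≤ lam) {μ : ℝ}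
    (hμ : 0 ≤ μ) (h : Tendsto (muSeq p q lam) atTop (𝓝 μ)) :
    ∃ v : ℕ → ℝ, (∀ r, Tendsto (fun d => treeAdvantage p q d (ψ d) r) atTop (𝓝 (v r))) ∧
      Tendsto v atTop (𝓝 (gaussSucc μ)) := by
  obtain ⟨d₀, h₀⟩ := hadm.exists
  -- At depth 0 the advantage involves neither `d` nor `ψ`, so any values such as 0 may be inserted.
  -- At depth `t + 1` the parameter is `muSeq t`, which accounts for the index shift below.
  refine ⟨fun r => Nat.casesOn r (treeAdvantage p q 0 0 0)
    (fun t => gaussSucc (muSeq p q lam t)), fun r => ?_, ?_⟩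
  · cases r with
    | zero => exact tendsto_const_nhds
    | succ t => exact tendsto_treeAdvantage_succ hadm hlam hlam0 t
  · rw [← tendsto_add_atTop_iff_nat 1]
    exact tendsto_gaussSucc_muSeq h₀.p_pos h₀.p_lt h₀.q_nonneg hlam0 h hμ

end

/-! ### Product formulas for the finite model -/

/-- Simple graphs on `Fin n` as families of bits indexed by increasing pairs. -/
noncomputable def graphEquiv (n : ℕ) :
    SimpleGraph (Fin n) ≃ ({e : Fin n × Fin n // e.1 < e.2} → Prop) where
  toFun g e := g.Adj e.1.1 e.1.2
  invFun b := SimpleGraph.fromRel fun a c => ∃ h : a < c, b ⟨(a, c), h⟩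
  left_inv g := by
    ext a c
    simp only [SimpleGraph.fromRel_adj]
    constructor
    · rintro ⟨-, ⟨-, h⟩ | ⟨-, h⟩⟩
      exacts [h, h.symm]
    · intro h
      rcases lt_or_gt_of_ne h.ne with h1 | h1
      exacts [⟨h.ne, Or.inl ⟨h1, h⟩⟩, ⟨h.ne, Or.inr ⟨h1, h.symm⟩⟩]
  right_inv b := by
    funext ⟨⟨a, c⟩, h⟩
    simp only [SimpleGraph.fromRel_adj, eq_iff_iff]
    constructor
    · rintro ⟨_, ⟨_, h1⟩ | ⟨h2, _⟩⟩
      exacts [h1, absurd h (lt_asymm h2)]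
    · exact fun h1 => ⟨h.ne, Or.inl ⟨h, h1⟩⟩

open scoped Classical in
theorem sum_simpleGraph_prod {n : ℕ} (f : Fin n × Fin n → Prop → ℝ) :
    ∑ g : SimpleGraph (Fin n), ∏ e : Fin n × Fin n with e.1 < e.2, f e (g.Adj e.1 e.2) =
      ∏ e : Fin n × Fin n with e.1 < e.2, (f e True + f e False) := by
  have h1 : ∀ F : Fin n × Fin n → ℝ, ∏ e : Fin n × Fin n with e.1 < e.2, F e =
      ∏ e : {e : Fin n × Fin n // e.1 < e.2}, F e.1 := fun F =>
    Finset.prod_subtype _ (by simp) F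
  simp_rw [h1]
  refine (Fintype.sum_equiv (graphEquiv n) _ (fun b => ∏ e, f e.1 (b e)) (fun g => rfl)).trans ?_
  have h2 : ∀ e : {e : Fin n × Fin n // e.1 < e.2},
      f e.1 True + f e.1 False = ∑ P : Prop, f e.1 P := fun e => by
    have : (Finset.univ : Finset Prop) = {True, False} := by
      ext P; by_cases hP : P <;> simp [hP]
    rw [this, Finset.sum_pair (by simp)]
  simp_rw [h2]
  rw [Fintype.prod_sum]

open scoped Classical in
theorem sum_finset_prod {n : ℕ} (f : Fin n → Prop → ℝ) :
    ∑ S : Finset (Fin n), ∏ i, f i (i ∈ S) = ∏ i, (f i True + f i False) := by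
  rw [Finset.prod_add, Finset.powerset_univ]
  refine Finset.sum_congr rfl fun S _ => ?_
  rw [← Finset.prod_mul_prod_compl S, Finset.compl_eq_univ_sdiff]
  congr 1
  · exact Finset.prod_congr rfl fun i hi => by simp [hi]
  · refine Finset.prod_congr rfl fun i hi => ?_
    simp only [Finset.mem_sdiff, Finset.mem_univ, true_and] at hi
    simp [hi]

section

variable {p q d : ℝ} {ψ : Matrix (Fin 2) (Fin 2) ℝ} {n : ℕ}

theorem edgeProb_nonneg (ψ : Matrix (Fin 2) (Fin 2) ℝ) (d : ℝ) (n : ℕ) (x x' : Fin 2) :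
    0 ≤ edgeProb ψ d n x x' := le_max_left _ _

theorem edgeProb_le_one (ψ : Matrix (Fin 2) (Fin 2) ℝ) (d : ℝ) (n : ℕ) (x x' : Fin 2) :
    edgeProb ψ d n x x' ≤ 1 := max_le zero_le_one (min_le_left _ _)

theorem prior_nonneg (hp0 : 0 ≤ p) (hp1 : p ≤ 1) (x : Fin 2) : 0 ≤ prior p x := by
  unfold prior; split_ifs <;> linarith

theorem weight_nonneg_of (hp0 : 0 ≤ p) (hp1 : p ≤ 1) (hq0 : 0 ≤ q) (hq1 : q ≤ 1)
    (ω : Outcome n) : 0 ≤ weight p q ψ d ω := by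
  unfold weight
  refine mul_nonneg (mul_nonneg (Finset.prod_nonneg fun i _ => prior_nonneg hp0 hp1 _)
    (Finset.prod_nonneg fun e _ => ?_)) (Finset.prod_nonneg fun i _ => ?_)
  · split_ifs
    · exact edgeProb_nonneg _ _ _ _ _
    · exact sub_nonneg.2 (edgeProb_le_one _ _ _ _ _)
  · split_ifs <;> linarith

open scoped Classical in
theorem prob_eq_sum_ite (p q : ℝ) (ψ : Matrix (Fin 2) (Fin 2) ℝ) (d : ℝ) (A : Outcome n → Prop) :
    prob p q ψ d A = ∑ ω : Outcome n, if A ω then weight p q ψ d ω else 0 := by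
  rw [prob, Finset.sum_filter]

theorem prob_mono (hp0 : 0 ≤ p) (hp1 : p ≤ 1) (hq0 : 0 ≤ q) (hq1 : q ≤ 1)
    {A B : Outcome n → Prop} (h : ∀ ω, A ω → B ω) : prob p q ψ d A ≤ prob p q ψ d B := by
  classical
  rw [prob_eq_sum_ite, prob_eq_sum_ite]
  refine Finset.sum_le_sum fun ω _ => ?_
  by_cases hA : A ω
  · rw [if_pos hA, if_pos (h ω hA)]
  · rw [if_neg hA]
    split_ifs
    exacts [weight_nonneg_of hp0 hp1 hq0 hq1 ω, le_rfl]

theorem prob_nonneg (hp0 : 0 ≤ p) (hp1 : p ≤ 1) (hq0 : 0 ≤ q) (hq1 : q ≤ 1)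
    (A : Outcome n → Prop) : 0 ≤ prob p q ψ d A :=
  Finset.sum_nonneg fun ω _ => weight_nonneg_of hp0 hp1 hq0 hq1 ω

open scoped Classical in
/-- The probability of an event that constrains the labels, the pairs of vertices, and the revealed
vertices separately. -/
theorem prob_prod (A : (Fin n → Fin 2) → Prop) (B : Fin n × Fin n → Prop → Prop)
    (C : Fin n → Prop → Prop) :
    prob p q ψ d (fun ω : Outcome n => A ω.1 ∧ (∀ e : Fin n × Fin n, e.1 < e.2 →
      B e (ω.2.1.Adj e.1 e.2)) ∧ ∀ i, C i (i ∈ ω.2.2)) =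
    ∑ x : Fin n → Fin 2, (if A x then ∏ i, prior p (x i) else 0) *
      (∏ e : Fin n × Fin n with e.1 < e.2, ((if B e True then edgeProb ψ d n (x e.1) (x e.2) else 0)
        + if B e False then 1 - edgeProb ψ d n (x e.1) (x e.2) else 0)) *
      ∏ i, ((if C i True then q else 0) + if C i False then 1 - q else 0) := by
  rw [prob_eq_sum_ite, Fintype.sum_prod_type]
  refine Finset.sum_congr rfl fun x _ => ?_
  rw [Fintype.sum_prod_type]
  have h1 := sum_simpleGraph_prod (n := n) fun e P =>
    if B e P then (if P then edgeProb ψ d n (x e.1) (x e.2)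
      else 1 - edgeProb ψ d n (x e.1) (x e.2)) else 0
  have h2 := sum_finset_prod (n := n) fun i P => if C i P then (if P then q else 1 - q) else 0
  simp only [if_true, if_false] at h1 h2
  rw [← h1, ← h2, mul_assoc, Finset.sum_mul_sum, Finset.mul_sum]
  refine Finset.sum_congr rfl fun g _ => ?_
  rw [Finset.mul_sum]
  refine Finset.sum_congr rfl fun S _ => ?_
  have h3 : ∀ {ι : Type} (s : Finset ι) (P : ι → Prop) (f : ι → ℝ),
      ∏ i ∈ s, (if P i then f i else 0) = if ∀ i ∈ s, P i then ∏ i ∈ s, f i else 0 := by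
    intro ι s P f
    split_ifs with h
    · exact Finset.prod_congr rfl fun i hi => if_pos (h i hi)
    · push Not at h
      obtain ⟨i, hi, hP⟩ := h
      exact Finset.prod_eq_zero hi (if_neg hP)
  rw [h3, h3]
  simp only [Finset.mem_filter, Finset.mem_univ, true_and, forall_const, weight]
  by_cases hA : A x <;>
  by_cases hB : ∀ e : Fin n × Fin n, e.1 < e.2 → B e (g.Adj e.1 e.2) <;>
  by_cases hC : ∀ i, C i (i ∈ S) <;> simp only [hA, hB, hC, mul_assoc, true_and, and_true,
    and_false, false_and, if_true, if_false, zero_mul, mul_zero, implies_true]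
  rw [if_pos hB, if_pos hB]
  congr!

theorem prob_label (i : Fin n) (x : Fin 2) :
    prob p q ψ d (fun ω : Outcome n => ω.1 i = x) = prior p x := by
  classical
  have h1 := prob_prod (p := p) (q := q) (ψ := ψ) (d := d) (n := n) (fun z => z i = x)
    (fun _ _ => True) (fun _ _ => True)
  simp only [imp_true_iff, and_true, if_true, add_sub_cancel, Finset.prod_const_one,
    mul_one] at h1
  rw [h1]
  have h2 : ∀ (z : Fin n → Fin 2) [Decidable (z i = x)],
      (if z i = x then ∏ j, prior p (z j) else 0) =
      ∏ j, if j = i → z j = x then prior p (z j) else 0 := by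
    intro z _
    split_ifs with hz
    · refine Finset.prod_congr rfl fun j _ => (if_pos ?_).symm
      rintro rfl; exact hz
    · exact (Finset.prod_eq_zero (Finset.mem_univ i) (if_neg fun h => hz (h rfl))).symm
  simp_rw [h2]
  rw [← Fintype.prod_sum (fun j z => if j = i → z = x then prior p z else 0),
    Fintype.prod_eq_single i]
  · simp
  · intro j hj
    rw [← sum_prior p]
    exact Finset.sum_congr rfl fun z _ => if_pos fun h => absurd h hj

end

/-! ### Probability of a given tree around a vertex -/

/-- The map `φ` identifies the tree given by the parent map `par` with a part of the graph `g` that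
can be left only through the leaves, and the labels observed at the leaves are as prescribed. -/
structure IsPattern {V : Type} (par : V → Option V) (leaf : V → Option (Option (Fin 2))) {n : ℕ}
    (g : SimpleGraph (Fin n)) (y : Labels n) (φ : V → Fin n) : Prop where
  inj : Function.Injective φ
  adj : ∀ u v, g.Adj (φ u) (φ v) ↔ par v = some u ∨ par u = some v
  closed : ∀ u, leaf u = none → ∀ w, g.Adj (φ u) w → w ∈ Set.range φ
  leaf_eq : ∀ u z, leaf u = some z → y (φ u) = z

/-- The conditional probability of the observation prescribed at a vertex, given its label. -/
noncomputable def leafWeight (q : ℝ) : Option (Option (Fin 2)) → Fin 2 → ℝ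
  | none, _ => 1
  | some none, _ => 1 - q
  | some (some w), x => if w = x then q else 0

/-- A union bound; it is applied to the event that an outside vertex is joined to no inner vertex of
the tree. -/
theorem one_sub_sum_le_prod {ι : Type*} (s : Finset ι) (f : ι → ℝ) (h0 : ∀ i ∈ s, 0 ≤ f i)
    (h1 : ∀ i ∈ s, f i ≤ 1) : 1 - ∑ i ∈ s, f i ≤ ∏ i ∈ s, (1 - f i) := by
  classical
  induction s using Finset.induction_on with
  | empty => simp
  | insert i s hi ih =>
    rw [Finset.sum_insert hi, Finset.prod_insert hi]
    have ih' := ih (fun j hj => h0 j (Finset.mem_insert_of_mem hj))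
      (fun j hj => h1 j (Finset.mem_insert_of_mem hj))
    have a0 := h0 i (Finset.mem_insert_self i s)
    have a1 := h1 i (Finset.mem_insert_self i s)
    have a2 : 0 ≤ ∑ j ∈ s, f j := Finset.sum_nonneg fun j hj => h0 j (Finset.mem_insert_of_mem hj)
    nlinarith [mul_le_mul_of_nonneg_left ih' (sub_nonneg.2 a1), mul_nonneg a0 a2]

section

variable {V : Type} {par : V → Option V}
  {leaf : V → Option (Option (Fin 2))} {n : ℕ} {φ : V → Fin n}

/-- The pairs of vertices of the graph that correspond to the edges of the tree. -/
def TreePair (par : V → Option V) (φ : V → Fin n) (e : Fin n × Fin n) : Prop :=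
  ∃ u v, φ u = e.1 ∧ φ v = e.2 ∧ (par v = some u ∨ par u = some v)

/-- The pairs of vertices of the graph that are constrained by a pattern. -/
def RelevantPair (leaf : V → Option (Option (Fin 2))) (φ : V → Fin n) (e : Fin n × Fin n) : Prop :=
  (e.1 ∈ Set.range φ ∧ e.2 ∈ Set.range φ) ∨
    ∃ v, leaf v = none ∧ (φ v = e.1 ∧ e.2 ∉ Set.range φ ∨ φ v = e.2 ∧ e.1 ∉ Set.range φ)

theorem TreePair.relevant {e : Fin n × Fin n} (h : TreePair par φ e) : RelevantPair leaf φ e := by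
  obtain ⟨u, v, h1, h2, -⟩ := h
  exact Or.inl ⟨⟨u, h1⟩, ⟨v, h2⟩⟩

/-- A pair of vertices in increasing order. -/
def sortPair (a b : Fin n) : Fin n × Fin n := (min a b, max a b)

theorem sortPair_eq (a b : Fin n) : sortPair a b = (a, b) ∨ sortPair a b = (b, a) := by
  rcases le_total a b with h | h <;> simp [sortPair, h]

theorem sortPair_lt {a b : Fin n} (h : a ≠ b) : (sortPair a b).1 < (sortPair a b).2 := by
  simpa [sortPair] using h.symm

theorem sortPair_inj {a b a' b' : Fin n} (h : sortPair a b = sortPair a' b') :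
    (a = a' ∧ b = b') ∨ (a = b' ∧ b = a') := by
  rcases sortPair_eq a b with h1 | h1 <;> rcases sortPair_eq a' b' with h2 | h2 <;>
  · rw [h1, h2, Prod.mk.injEq] at h
    tauto

theorem sortPair_of_lt {a b : Fin n} (h : a < b) :
    sortPair a b = (a, b) ∧ sortPair b a = (a, b) := by
  simp [sortPair, h.le]

variable [Fintype V]

open scoped Classical in
-- Each edge of the tree is indexed by its lower end.
theorem prod_treePair {P : Fin 2 → Fin 2 → ℝ} (hsymm : ∀ a b, P a b = P b a) {x : Fin n → Fin 2}
    {l : V → Fin 2} (hx : ∀ v, x (φ v) = l v) (hφ : Function.Injective φ) {dep : V → ℕ}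
    (hdep : ∀ u v, par v = some u → dep v = dep u + 1) :
    ∏ e : Fin n × Fin n with e.1 < e.2, (if TreePair par φ e then P (x e.1) (x e.2) else 1) =
      ∏ v, (par v).elim 1 (fun u => P (l u) (l v)) := by
  have h1 : ∏ v, (par v).elim 1 (fun u => P (l u) (l v)) =
      ∏ v with (par v).isSome, (par v).elim 1 (fun u => P (l u) (l v)) := by
    rw [Finset.prod_filter]
    refine Finset.prod_congr rfl fun v _ => ?_
    cases h : par v <;> simp
  rw [h1, ← Finset.prod_filter]
  symm
  refine Finset.prod_nbij (fun v => sortPair ((par v).elim (φ v) φ) (φ v)) ?_ ?_ ?_ ?_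
  · intro v hv
    obtain ⟨u, hu⟩ := Option.isSome_iff_exists.1 (Finset.mem_filter.1 hv).2
    have hne : φ u ≠ φ v := fun h => by
      have := hdep u v hu
      rw [hφ h] at this
      omega
    simp only [hu, Option.elim_some, Finset.mem_filter, Finset.mem_univ, true_and]
    refine ⟨sortPair_lt hne, ?_⟩
    rcases sortPair_eq (φ u) (φ v) with h | h <;> rw [h]
    exacts [⟨u, v, rfl, rfl, Or.inl hu⟩, ⟨v, u, rfl, rfl, Or.inr hu⟩]
  · intro v hv w hw h
    obtain ⟨u, hu⟩ := Option.isSome_iff_exists.1 (Finset.mem_filter.1 hv).2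
    obtain ⟨u', hu'⟩ := Option.isSome_iff_exists.1 (Finset.mem_filter.1 hw).2
    simp only [hu, hu', Option.elim_some] at h
    rcases sortPair_inj h with ⟨-, h2⟩ | ⟨h2, h3⟩
    · exact hφ h2
    -- Two vertices cannot be the parents of each other, since the depth increases along parent
    -- links.
    · have e1 := hdep u v hu
      have e2 := hdep u' w hu'
      rw [hφ h2] at e1
      rw [← hφ h3] at e2
      omega
  · intro e he
    simp only [Finset.coe_filter, Finset.mem_univ, true_and, Finset.mem_filter,
      Set.mem_ofPred_eq] at he
    obtain ⟨he1, u, v, h1, h2, h3⟩ := he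
    obtain ⟨a, b⟩ := e
    simp only at h1 h2 he1
    subst h1 h2
    rcases h3 with h3 | h3
    · exact ⟨v, by simp [h3], by simp [h3, (sortPair_of_lt he1).1]⟩
    · exact ⟨u, by simp [h3], by simp [h3, (sortPair_of_lt he1).2]⟩
  · intro v hv
    obtain ⟨u, hu⟩ := Option.isSome_iff_exists.1 (Finset.mem_filter.1 hv).2
    simp only [hu, Option.elim_some]
    rcases sortPair_eq (φ u) (φ v) with h | h <;> rw [h, hx, hx]
    exact hsymm _ _

open scoped Classical in
/-- The pairs of an inner vertex of the tree and a vertex outside of the tree. -/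
theorem prod_outside {P : Fin 2 → Fin 2 → ℝ} (hsymm : ∀ a b, P a b = P b a) {x : Fin n → Fin 2}
    {l : V → Fin 2} (hx : ∀ v, x (φ v) = l v) (hφ : Function.Injective φ) :
    ∏ e : Fin n × Fin n with e.1 < e.2, (if (∃ v, leaf v = none ∧
        (φ v = e.1 ∧ e.2 ∉ Set.range φ ∨ φ v = e.2 ∧ e.1 ∉ Set.range φ)) then
        1 - P (x e.1) (x e.2) else 1) =
      ∏ b : Fin n, if b ∈ Set.range φ then 1 else
        ∏ v with leaf v = none, (1 - P (l v) (x b)) := by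
  have h1 : ∏ b : Fin n, (if b ∈ Set.range φ then 1 else
      ∏ v with leaf v = none, (1 - P (l v) (x b))) =
      ∏ bv ∈ (Finset.univ.filter fun b : Fin n => b ∉ Set.range φ) ×ˢ
        (Finset.univ.filter fun v => leaf v = none), (1 - P (l bv.2) (x bv.1)) := by
    rw [Finset.prod_product, Finset.prod_filter]
    exact Finset.prod_congr rfl fun b _ => by rw [ite_not]
  rw [h1, ← Finset.prod_filter]
  symm
  refine Finset.prod_nbij (fun bv => sortPair (φ bv.2) bv.1) ?_ ?_ ?_ ?_
  · rintro ⟨b, v⟩ h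
    simp only [Finset.mem_product, Finset.mem_filter, Finset.mem_univ, true_and] at h ⊢
    refine ⟨sortPair_lt fun h2 => h.1 ⟨v, h2⟩, v, h.2, ?_⟩
    rcases sortPair_eq (φ v) b with h2 | h2 <;> rw [h2]
    exacts [Or.inl ⟨rfl, h.1⟩, Or.inr ⟨rfl, h.1⟩]
  · rintro ⟨b, v⟩ h ⟨b', v'⟩ h' e
    simp only [Finset.coe_product, Set.mem_prod, Finset.coe_filter, Set.mem_ofPred_eq,
      Finset.mem_univ, true_and] at h h'
    rcases sortPair_inj e with ⟨h2, h3⟩ | ⟨h2, h3⟩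
    · simp only at h2 h3
      rw [hφ h2, h3]
    · exact absurd ⟨v, h2⟩ h'.1
  · rintro ⟨a, b⟩ he
    simp only [Finset.coe_filter, Finset.mem_univ, true_and, Finset.mem_filter,
      Set.mem_ofPred_eq] at he
    obtain ⟨he1, v, hv, ⟨h2, h3⟩ | ⟨h2, h3⟩⟩ := he
    · refine ⟨(b, v), by simpa using ⟨by simpa using h3, hv⟩, ?_⟩
      rw [← h2] at he1 ⊢
      exact (sortPair_of_lt he1).1
    · refine ⟨(a, v), by simpa using ⟨by simpa using h3, hv⟩, ?_⟩
      rw [← h2] at he1 ⊢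
      exact (sortPair_of_lt he1).2
  · rintro ⟨b, v⟩ h
    rcases sortPair_eq (φ v) b with h2 | h2 <;> simp only [h2, hx]
    rw [hsymm]

open scoped Classical in
/-- Lower bound for the probability of the constraints of a pattern on the edges, given the
labels. -/
theorem prod_relevant_ge {P : Fin 2 → Fin 2 → ℝ} (hsymm : ∀ a b, P a b = P b a)
    (hP0 : ∀ a b, 0 ≤ P a b) {M : ℝ} (hPM : ∀ a b, P a b ≤ M) (hM : M ≤ 1) {x : Fin n → Fin 2}
    {l : V → Fin 2} (hx : ∀ v, x (φ v) = l v) (hφ : Function.Injective φ) {dep : V → ℕ}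
    (hdep : ∀ u v, par v = some u → dep v = dep u + 1) :
    (∏ v, (par v).elim 1 (fun u => P (l u) (l v))) * (1 - M) ^ (Fintype.card V ^ 2) *
      (∏ b : Fin n, if b ∈ Set.range φ then 1 else
        ∏ v with leaf v = none, (1 - P (l v) (x b))) ≤
    ∏ e : Fin n × Fin n with e.1 < e.2,
      ((if RelevantPair leaf φ e → (True ↔ TreePair par φ e) then P (x e.1) (x e.2) else 0) +
        if RelevantPair leaf φ e → (False ↔ TreePair par φ e) then 1 - P (x e.1) (x e.2)
          else 0) := by
  have hM0 : 0 ≤ M := (hP0 0 0).trans (hPM 0 0)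
  -- A crude bound: every pair inside the tree pays `1 - M`. With `M` of order `1 / n` and an
  -- exponent independent of `n`, the loss vanishes in the limit.
  have hB : (1 - M) ^ (Fintype.card V ^ 2) ≤ ∏ e : Fin n × Fin n with e.1 < e.2,
      (if e.1 ∈ Set.range φ ∧ e.2 ∈ Set.range φ then 1 - M else 1) := by
    rw [← Finset.prod_filter, Finset.prod_const]
    refine pow_le_pow_of_le_one (sub_nonneg.2 hM) (by linarith) ?_
    refine (Finset.card_le_card (t := Finset.univ.image φ ×ˢ Finset.univ.image φ) ?_).trans ?_
    · intro e he
      simp only [Finset.mem_filter, Finset.mem_univ, true_and] at he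
      obtain ⟨-, ⟨u, hu⟩, ⟨v, hv⟩⟩ := he
      simp only [Finset.mem_product, Finset.mem_image, Finset.mem_univ, true_and]
      exact ⟨⟨u, hu⟩, ⟨v, hv⟩⟩
    · rw [Finset.card_product, ← sq]
      exact Nat.pow_le_pow_left Finset.card_image_le 2
  have hA0 : 0 ≤ ∏ v, (par v).elim 1 (fun u => P (l u) (l v)) :=
    Finset.prod_nonneg fun v _ => by cases par v <;> simp [hP0]
  have hC0 : 0 ≤ ∏ b : Fin n, (if b ∈ Set.range φ then 1 else
        ∏ v with leaf v = none, (1 - P (l v) (x b))) :=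
    Finset.prod_nonneg fun b _ => by
      split_ifs
      exacts [zero_le_one, Finset.prod_nonneg fun v _ => sub_nonneg.2 ((hPM _ _).trans hM)]
  refine (mul_le_mul_of_nonneg_right (mul_le_mul_of_nonneg_left hB hA0) hC0).trans ?_
  rw [← prod_treePair hsymm hx hφ hdep, ← prod_outside hsymm hx hφ, ← Finset.prod_mul_distrib,
    ← Finset.prod_mul_distrib]
  refine Finset.prod_le_prod (fun e _ => ?_) fun e _ => ?_
  · have h1 := hP0 (x e.1) (x e.2)
    have h2 := (hPM (x e.1) (x e.2)).trans hM
    refine mul_nonneg (mul_nonneg ?_ ?_) ?_ <;> split_ifs <;> linarith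
  · have h1 := hP0 (x e.1) (x e.2)
    have h2 := hPM (x e.1) (x e.2)
    by_cases hT : TreePair par φ e
    · have hin : e.1 ∈ Set.range φ ∧ e.2 ∈ Set.range φ := by
        obtain ⟨u, v, h3, h4, -⟩ := hT
        exact ⟨⟨u, h3⟩, ⟨v, h4⟩⟩
      have hout : ¬ ∃ v, leaf v = none ∧
          (φ v = e.1 ∧ e.2 ∉ Set.range φ ∨ φ v = e.2 ∧ e.1 ∉ Set.range φ) := by
        rintro ⟨v, -, ⟨-, h⟩ | ⟨-, h⟩⟩
        exacts [h hin.2, h hin.1]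
      have hR : RelevantPair leaf φ e := hT.relevant
      rw [if_neg hout, if_pos hin, if_pos hT, if_pos fun _ => (iff_true_intro hT).symm,
        if_neg fun h => (h hR).2 hT]
      nlinarith
    · by_cases hR : RelevantPair leaf φ e
      · simp only [hT, hR, true_imp_iff, if_false, one_mul, iff_false, not_true_eq_false, iff_self,
          if_true, zero_add]
        by_cases hin : e.1 ∈ Set.range φ ∧ e.2 ∈ Set.range φ
        · rw [if_pos hin]
          split_ifs <;> nlinarith
        · rw [if_neg hin, if_pos (hR.resolve_left hin), one_mul]
      · simp only [hT, hR, if_false, one_mul, false_imp_iff, if_true]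
        rw [if_neg fun h => hR (Or.inl h), if_neg fun h => hR (Or.inr h)]
        linarith

end

section

variable {p q d : ℝ} {ψ : Matrix (Fin 2) (Fin 2) ℝ} {V : Type} [Fintype V] {par : V → Option V}
  {leaf : V → Option (Option (Fin 2))} {n : ℕ} {φ : V → Fin n}

theorem edgeProb_eq (h : Admissible p q d ψ) {M : ℝ} (hM : ∀ x x', d * ψ x x' ≤ M) (hMn : M ≤ n)
    (x x' : Fin 2) : edgeProb ψ d n x x' = d / n * ψ x x' := by
  have h0 := mul_pos h.d_pos (h.pos x x')
  have hn : (0 : ℝ) < n := h0.trans_le ((hM x x').trans hMn)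
  have h1 : d / n * ψ x x' ≤ 1 := by
    rw [div_mul_eq_mul_div, div_le_one hn]
    exact (hM x x').trans hMn
  have h2 : 0 ≤ d / n * ψ x x' := by
    rw [div_mul_eq_mul_div]; positivity
  rw [edgeProb, min_eq_right h1, max_eq_right h2]

open scoped Classical in
theorem prod_leaf (q : ℝ) (l : V → Fin 2) (hφ : Function.Injective φ) :
    ∏ i : Fin n, ((if (∀ v z, leaf v = some z → φ v = i → (some (l v) = z)) then q else 0) +
      if (∀ v z, leaf v = some z → φ v = i → (none = z)) then 1 - q else 0) =
      ∏ v, leafWeight q (leaf v) (l v) := by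
  symm
  refine Fintype.prod_of_injective φ hφ _ _ ?_ ?_
  · intro i hi
    rw [if_pos fun v z _ h => absurd ⟨v, h⟩ hi, if_pos fun v z _ h => absurd ⟨v, h⟩ hi]
    ring
  · intro v
    rcases hv : leaf v with - | - | w
    · rw [if_pos, if_pos]
      · simp [leafWeight]
      · intro u z hu h
        rw [hφ h, hv] at hu
        exact absurd hu (by simp)
      · intro u z hu h
        rw [hφ h, hv] at hu
        exact absurd hu (by simp)
    · rw [if_neg, if_pos]
      · simp [leafWeight]
      · intro u z hu h
        rw [hφ h, hv] at hu
        simpa using hu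
      · intro h
        simpa using h v none hv rfl
    · have h2 : ¬ ∀ u z, leaf u = some z → φ u = φ v → (none = z) := fun h => by
        simpa using h v (some w) hv rfl
      rw [if_neg h2, add_zero, leafWeight]
      refine if_congr ⟨fun h => ?_, fun h => ?_⟩ rfl rfl
      · subst h
        intro u z hu h
        rw [hφ h, hv] at hu
        rw [hφ h]
        simpa using hu
      · simpa [eq_comm] using h v (some w) hv rfl

open scoped Classical in
-- The labels of the vertices outside the tree are summed out independently. By the union bound each
-- such vertex avoids the inner vertices with probability at least `1 - d |I| / n`, the same for all
-- labels of the tree because the rows of `ψ` average to one. The vertices of the tree are charged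
-- this factor too, which makes the exponent `n`.
theorem sum_labels_ge (h : Admissible p q d ψ) {M : ℝ} (hM : ∀ x x', d * ψ x x' ≤ M) (hMn : M ≤ n)
    (hdn : d * Fintype.card V ≤ n) (l : V → Fin 2) (hφ : Function.Injective φ) :
    (∏ v, prior p (l v)) *
      (1 - d * (Finset.univ.filter fun v => leaf v = none).card / n) ^ n ≤
    ∑ x : Fin n → Fin 2, (if ∀ v, x (φ v) = l v then ∏ i, prior p (x i) else 0) *
      ∏ b : Fin n, if b ∈ Set.range φ then 1 else
        ∏ v with leaf v = none, (1 - edgeProb ψ d n (l v) (x b)) := by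
  set I := Finset.univ.filter fun v => leaf v = none with hI
  have hn : (0 : ℝ) < n := (mul_pos h.d_pos (h.pos 0 0)).trans_le ((hM 0 0).trans hMn)
  have hp0 : ∀ z, 0 ≤ prior p z := fun z => (h.prior_pos z).le
  let k : Fin n → Fin 2 → ℝ := fun i z => (if ∀ v, φ v = i → z = l v then prior p z else 0) *
    if i ∈ Set.range φ then 1 else ∏ v ∈ I, (1 - edgeProb ψ d n (l v) z)
  have h1 : ∀ x : Fin n → Fin 2, (if ∀ v, x (φ v) = l v then ∏ i, prior p (x i) else 0) *
      (∏ b : Fin n, if b ∈ Set.range φ then 1 else ∏ v ∈ I, (1 - edgeProb ψ d n (l v) (x b))) =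
      ∏ i, k i (x i) := by
    intro x
    simp only [k]
    rw [Finset.prod_mul_distrib]
    congr 1
    split_ifs with hx
    · refine Finset.prod_congr rfl fun i _ => (if_pos ?_).symm
      rintro v rfl
      exact hx v
    · push Not at hx
      obtain ⟨v, hv⟩ := hx
      exact (Finset.prod_eq_zero (Finset.mem_univ (φ v)) (if_neg fun h => hv (h v rfl))).symm
  simp_rw [h1]
  rw [← Fintype.prod_sum k]
  set a := 1 - d * I.card / n
  have ha1 : a ≤ 1 := sub_le_self _ (by have := h.d_pos; positivity)
  have ha0 : 0 ≤ a := by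
    refine sub_nonneg.2 ((div_le_one hn).2 (le_trans ?_ hdn))
    exact mul_le_mul_of_nonneg_left (by exact_mod_cast Finset.card_le_univ I) h.d_pos.le
  have h2 : ∏ v, prior p (l v) = ∏ i, ∑ z, (if ∀ v, φ v = i → z = l v then (if i ∈ Set.range φ then
      prior p z else prior p z) else 0) := by
    refine Fintype.prod_of_injective φ hφ _ _ ?_ ?_
    · intro i hi
      rw [← sum_prior p]
      refine Finset.sum_congr rfl fun z _ => ?_
      rw [if_pos fun v h => absurd ⟨v, h⟩ hi, if_neg hi]
    · intro v
      rw [Finset.sum_eq_single (l v)]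
      · rw [if_pos, ite_self]
        intro u hu
        rw [hφ hu]
      · intro z _ hz
        exact if_neg fun h => hz (h v rfl)
      · simp
  have h3 : a ^ n = ∏ _i : Fin n, a := by simp
  rw [h2, h3, ← Finset.prod_mul_distrib]
  refine Finset.prod_le_prod (fun i _ => mul_nonneg (Finset.sum_nonneg fun z _ => ?_) ha0)
      fun i _ => ?_
  · split_ifs <;> first | exact hp0 z | exact le_rfl
  · by_cases hi : i ∈ Set.range φ
    · rw [← mul_one (∑ z, k i z)]
      refine mul_le_mul (le_of_eq ?_) ha1 ha0 (Finset.sum_nonneg fun z _ => ?_)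
      · exact Finset.sum_congr rfl fun z _ => by simp only [k, if_pos hi, mul_one]
      · simp only [k, if_pos hi, mul_one]
        split_ifs <;> first | exact hp0 z | exact le_rfl
    · have h4 : ∀ z, k i z = prior p z * ∏ v ∈ I, (1 - edgeProb ψ d n (l v) z) := fun z => by
        simp only [k, if_neg hi]
        rw [if_pos fun v h => absurd ⟨v, h⟩ hi]
      have h5 : ∑ z, (if ∀ v, φ v = i → z = l v then (if i ∈ Set.range φ then
          prior p z else prior p z) else 0) = 1 := by
        rw [← sum_prior p]
        refine Finset.sum_congr rfl fun z _ => ?_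
        rw [if_pos fun v h => absurd ⟨v, h⟩ hi, if_neg hi]
      rw [h5, one_mul]
      have h6 : ∀ z, 1 - ∑ v ∈ I, d / n * ψ (l v) z ≤ ∏ v ∈ I, (1 - edgeProb ψ d n (l v) z) := by
        intro z
        refine le_trans (le_of_eq ?_) (one_sub_sum_le_prod I _
            (fun v _ => edgeProb_nonneg _ _ _ _ _)
          (fun v _ => edgeProb_le_one _ _ _ _ _))
        simp_rw [edgeProb_eq h hM hMn]
      refine le_trans (le_of_eq ?_) (Finset.sum_le_sum fun z _ => (h4 z).symm ▸
        mul_le_mul_of_nonneg_left (h6 z) (hp0 z))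
      simp_rw [mul_sub, mul_one, Finset.mul_sum]
      rw [Finset.sum_sub_distrib, sum_prior, Finset.sum_comm]
      have h7 : ∀ v ∈ I, ∑ z, prior p z * (d / n * ψ (l v) z) = d / n := fun v _ => by
        simp_rw [mul_left_comm _ (d / (n : ℝ))]
        rw [← Finset.mul_sum, h.row, mul_one]
      rw [Finset.sum_congr rfl h7, Finset.sum_const, nsmul_eq_mul]
      simp only [a]
      ring

open scoped Classical in
/-- Lower bound for the probability that the labelled tree `par`, `leaf`, `l` is found around a
vertex at the places given by `φ`. -/
theorem prob_isPattern_ge (h : Admissible p q d ψ) {M : ℝ} (hM : ∀ x x', d * ψ x x' ≤ M)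
    (hMn : M ≤ n) (hdn : d * Fintype.card V ≤ n) (l : V → Fin 2) (hφ : Function.Injective φ)
    {dep : V → ℕ} (hdep : ∀ u v, par v = some u → dep v = dep u + 1) :
    ((∏ v, prior p (l v)) * (∏ v, (par v).elim 1 (fun u => d / n * ψ (l u) (l v))) *
      ∏ v, leafWeight q (leaf v) (l v)) * ((1 - M / n) ^ (Fintype.card V ^ 2) *
      (1 - d * (Finset.univ.filter fun v => leaf v = none).card / n) ^ n) ≤
    prob p q ψ d (fun ω : Outcome n => (∀ v, ω.1 (φ v) = l v) ∧
      IsPattern par leaf ω.2.1 (observed ω) φ) := by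
  have hn : (0 : ℝ) < n := (mul_pos h.d_pos (h.pos 0 0)).trans_le ((hM 0 0).trans hMn)
  have hP : ∀ a b, edgeProb ψ d n a b ≤ M / n := fun a b => by
    rw [edgeProb_eq h hM hMn, div_mul_eq_mul_div]
    exact div_le_div_of_nonneg_right (hM a b) hn.le
  -- A sufficient event that constrains labels, pairs and revealed vertices separately, as
  -- `prob_prod` requires.
  have hsub : ∀ ω : Outcome n, ((∀ v, ω.1 (φ v) = l v) ∧
      (∀ e : Fin n × Fin n, e.1 < e.2 →
        (RelevantPair leaf φ e → (ω.2.1.Adj e.1 e.2 ↔ TreePair par φ e))) ∧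
      ∀ i, ∀ v z, leaf v = some z → φ v = i →
        (i ∈ ω.2.2 → some (l v) = z) ∧ (i ∉ ω.2.2 → none = z)) →
      (∀ v, ω.1 (φ v) = l v) ∧ IsPattern par leaf ω.2.1 (observed ω) φ := by
    rintro ⟨x, g, S⟩ ⟨h1, h2, h3⟩
    have hadj : ∀ a b, RelevantPair leaf φ (a, b) → RelevantPair leaf φ (b, a) → a ≠ b →
        (g.Adj a b ↔ TreePair par φ (a, b)) := by
      intro a b hr hr' hab
      rcases lt_or_gt_of_ne hab with hlt | hlt
      · exact h2 (a, b) hlt hr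
      · rw [g.adj_comm, h2 (b, a) hlt hr']
        constructor <;>
        · rintro ⟨u, v, h4, h5, h6⟩
          exact ⟨v, u, h5, h4, h6.symm⟩
    refine ⟨h1, hφ, ?_, ?_, ?_⟩
    · intro u v
      by_cases huv : u = v
      · subst huv
        have hne : par u ≠ some u := fun h => by have := hdep u u h; omega
        simp [hne]
      · rw [hadj _ _ (Or.inl ⟨⟨u, rfl⟩, ⟨v, rfl⟩⟩) (Or.inl ⟨⟨v, rfl⟩, ⟨u, rfl⟩⟩)
          fun h => huv (hφ h)]
        constructor
        · rintro ⟨u', v', h4, h5, h6⟩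
          rw [← hφ h4, ← hφ h5]
          exact h6
        · exact fun h => ⟨u, v, rfl, rfl, h⟩
    · intro u hu w hw
      by_contra hwr
      have := (hadj _ _ (Or.inr ⟨u, hu, Or.inl ⟨rfl, hwr⟩⟩) (Or.inr ⟨u, hu, Or.inr ⟨rfl, hwr⟩⟩)
        hw.ne).1 hw
      obtain ⟨u', v', h4, h5, h6⟩ := this
      exact hwr ⟨v', h5⟩
    · intro u z hu
      have := h3 (φ u) u z hu rfl
      have h4 : x (φ u) = l u := h1 u
      simp only [observed]
      split_ifs with hS
      exacts [h4 ▸ this.1 hS, this.2 hS]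
  refine le_trans ?_ (prob_mono h.p_pos.le h.p_lt.le h.q_nonneg h.q_le hsub)
  have key := prob_prod (p := p) (q := q) (ψ := ψ) (d := d) (n := n)
    (fun x => ∀ v, x (φ v) = l v)
    (fun e Q => RelevantPair leaf φ e → (Q ↔ TreePair par φ e))
    (fun i Q => ∀ v z, leaf v = some z → φ v = i →
      (Q → some (l v) = z) ∧ (¬ Q → none = z))
  rw [key]
  simp only [true_implies, not_true_eq_false, false_implies, and_true, not_false_eq_true,
    true_and]
  rw [← Finset.sum_mul]
  have e3 := prod_leaf (leaf := leaf) q l hφ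
  have hw0 : 0 ≤ ∏ v, leafWeight q (leaf v) (l v) := Finset.prod_nonneg fun v _ => by
    have := h.q_nonneg; have := h.q_le
    rcases leaf v with - | - | w <;> simp only [leafWeight] <;> try split_ifs
    all_goals linarith
  have e1 := sum_labels_ge (leaf := leaf) h hM hMn hdn l hφ
  have hMn1 : M / n ≤ 1 := (div_le_one hn).2 hMn
  set E := ∏ v, (par v).elim 1 (fun u => d / n * ψ (l u) (l v)) with hE
  have hE' : E = ∏ v, (par v).elim 1 (fun u => edgeProb ψ d n (l u) (l v)) := by
    simp_rw [edgeProb_eq h hM hMn]; rfl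
  have hE0 : 0 ≤ E := by
    rw [hE']
    exact Finset.prod_nonneg fun v _ => by cases par v <;> simp [edgeProb_nonneg]
  have hB0 : 0 ≤ (1 - M / n) ^ (Fintype.card V ^ 2) := pow_nonneg (sub_nonneg.2 hMn1) _
  have e2 : E * (1 - M / n) ^ (Fintype.card V ^ 2) *
      (∑ x : Fin n → Fin 2, (if ∀ v, x (φ v) = l v then ∏ i, prior p (x i) else 0) *
      ∏ b : Fin n, if b ∈ Set.range φ then 1 else
        ∏ v with leaf v = none, (1 - edgeProb ψ d n (l v) (x b))) ≤
      ∑ x : Fin n → Fin 2, (if ∀ v, x (φ v) = l v then ∏ i, prior p (x i) else 0) *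
      ∏ e : Fin n × Fin n with e.1 < e.2,
      ((if RelevantPair leaf φ e → (True ↔ TreePair par φ e) then edgeProb ψ d n (x e.1) (x e.2)
        else 0) + if RelevantPair leaf φ e → (False ↔ TreePair par φ e) then
          1 - edgeProb ψ d n (x e.1) (x e.2) else 0) := by
    rw [Finset.mul_sum]
    refine Finset.sum_le_sum fun x _ => ?_
    rw [mul_left_comm]
    split_ifs with hx
    · refine mul_le_mul_of_nonneg_left ?_ (Finset.prod_nonneg fun i _ => (h.prior_pos _).le)
      rw [hE']
      exact prod_relevant_ge (P := edgeProb ψ d n) (leaf := leaf) (x := x) (l := l)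
        (fun a b => by simp only [edgeProb, h.symm a b])
        (edgeProb_nonneg ψ d n) hP hMn1 hx hφ hdep
    · simp
  have e4 := (mul_le_mul_of_nonneg_left e1 (mul_nonneg hE0 hB0)).trans e2
  have e5 := mul_le_mul_of_nonneg_right e4 hw0
  refine le_trans (le_of_eq ?_) (e5.trans (le_of_eq ?_))
  · ring_nf
  · rw [← e3]
    congr!

end

/-! ### The vertices of a tree -/

/-- The vertices of the tree of a given shape. -/
def Node : (t : ℕ) → Shape t → Type
  | 0, _ => Unit
  | t + 1, o => Option ((j : Fin o.1) × Node t (o.2 j))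

instance nodeFintype : ∀ (t : ℕ) (o : Shape t), Fintype (Node t o)
  | 0, _ => inferInstanceAs (Fintype Unit)
  | t + 1, o =>
    have := fun j => nodeFintype t (o.2 j)
    inferInstanceAs (Fintype (Option ((j : Fin o.1) × Node t (o.2 j))))

instance nodeDecidableEq : ∀ (t : ℕ) (o : Shape t), DecidableEq (Node t o)
  | 0, _ => inferInstanceAs (DecidableEq Unit)
  | t + 1, o =>
    have := fun j => nodeDecidableEq t (o.2 j)
    inferInstanceAs (DecidableEq (Option ((j : Fin o.1) × Node t (o.2 j))))

/-- The root of a tree. -/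
def root : (t : ℕ) → (o : Shape t) → Node t o
  | 0, _ => ()
  | _ + 1, _ => none

/-- The vertex `v` of the subtree of the child `j` of the root. -/
def childNode {t : ℕ} {o : Shape (t + 1)} (j : Fin o.1) (v : Node t (o.2 j)) : Node (t + 1) o :=
  some ⟨j, v⟩

/-- The parent of a vertex. -/
def parent : (t : ℕ) → (o : Shape t) → Node t o → Option (Node t o)
  | 0, _, _ => none
  | _ + 1, _, none => none
  | t + 1, o, some ⟨j, v⟩ => some ((parent t (o.2 j) v).map fun u => ⟨j, u⟩)

/-- The depth of a vertex. -/
def depth : (t : ℕ) → (o : Shape t) → Node t o → ℕ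
  | 0, _, _ => 0
  | _ + 1, _, none => 0
  | t + 1, o, some ⟨j, v⟩ => depth t (o.2 j) v + 1

/-- The observed label of a vertex of maximal depth, and `none` at the other vertices. -/
def leafLabel : (t : ℕ) → (o : Shape t) → Node t o → Option (Option (Fin 2))
  | 0, y, _ => some y
  | _ + 1, _, none => none
  | t + 1, o, some ⟨j, v⟩ => leafLabel t (o.2 j) v

theorem node_cases {t : ℕ} {o : Shape (t + 1)} (v : Node (t + 1) o) :
    v = root (t + 1) o ∨ ∃ j w, v = childNode j w := by
  rcases v with - | ⟨j, w⟩
  exacts [Or.inl rfl, Or.inr ⟨j, w, rfl⟩]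

theorem childNode_inj {t : ℕ} {o : Shape (t + 1)} {j : Fin o.1} {v w : Node t (o.2 j)}
    (h : childNode j v = childNode j w) : v = w := by
  exact eq_of_heq (Sigma.mk.inj (Option.some.inj h)).2

theorem childNode_ne_root {t : ℕ} {o : Shape (t + 1)} (j : Fin o.1) (v : Node t (o.2 j)) :
    childNode j v ≠ root (t + 1) o := fun h => Option.some_ne_none _ h

theorem parent_root (t : ℕ) (o : Shape t) : parent t o (root t o) = none := by
  cases t <;> rfl

theorem depth_root (t : ℕ) (o : Shape t) : depth t o (root t o) = 0 := by
  cases t <;> rfl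

theorem parent_childNode {t : ℕ} {o : Shape (t + 1)} (j : Fin o.1) (v : Node t (o.2 j)) :
    parent (t + 1) o (childNode j v) =
      some ((parent t (o.2 j) v).elim (root (t + 1) o) (childNode j)) := by
  change some ((parent t (o.2 j) v).map _) = _
  cases parent t (o.2 j) v <;> rfl

theorem depth_childNode {t : ℕ} {o : Shape (t + 1)} (j : Fin o.1) (v : Node t (o.2 j)) :
    depth (t + 1) o (childNode j v) = depth t (o.2 j) v + 1 := rfl

theorem leafLabel_childNode {t : ℕ} {o : Shape (t + 1)} (j : Fin o.1) (v : Node t (o.2 j)) :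
    leafLabel (t + 1) o (childNode j v) = leafLabel t (o.2 j) v := rfl

theorem leafLabel_root {t : ℕ} {o : Shape (t + 1)} :
    leafLabel (t + 1) o (root (t + 1) o) = none := rfl

theorem parent_eq_none_iff {t : ℕ} {o : Shape t} {v : Node t o} :
    parent t o v = none ↔ v = root t o := by
  cases t with
  | zero => exact ⟨fun _ => rfl, fun _ => rfl⟩
  | succ t =>
    rcases node_cases v with rfl | ⟨j, w, rfl⟩
    · simp [parent_root]
    · simp [parent_childNode, childNode_ne_root]

theorem depth_parent {t : ℕ} {o : Shape t} (u v : Node t o) (h : parent t o v = some u) :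
    depth t o v = depth t o u + 1 := by
  induction t with
  | zero => exact absurd h (by simp [parent])
  | succ t ih =>
    rcases node_cases v with rfl | ⟨j, w, rfl⟩
    · simp [parent_root] at h
    · rw [parent_childNode, Option.some_inj] at h
      rw [← h, depth_childNode]
      cases hp : parent t (o.2 j) w with
      | none => rw [parent_eq_none_iff.1 hp, depth_root, Option.elim_none, depth_root]
      | some u' => rw [Option.elim_some, depth_childNode, ih _ _ hp]

theorem leafLabel_eq_none_iff {t : ℕ} {o : Shape t} {v : Node t o} :
    leafLabel t o v = none ↔ depth t o v < t := by
  induction t with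
  | zero => simp [leafLabel]
  | succ t ih =>
    rcases node_cases v with rfl | ⟨j, w, rfl⟩
    · simp [leafLabel_root, depth_root]
    · rw [leafLabel_childNode, depth_childNode, ih]
      omega

theorem depth_le {t : ℕ} {o : Shape t} (v : Node t o) : depth t o v ≤ t := by
  induction t with
  | zero => simp [depth]
  | succ t ih =>
    rcases node_cases v with rfl | ⟨j, w, rfl⟩
    · simp [depth_root]
    · rw [depth_childNode]
      exact Nat.succ_le_succ (ih w)

theorem prod_node {M : Type*} [CommMonoid M] {t : ℕ} {o : Shape (t + 1)}
    (f : Node (t + 1) o → M) :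
    ∏ v, f v = f (root (t + 1) o) * ∏ j, ∏ v, f (childNode j v) := by
  have h := Fintype.prod_option (α := (j : Fin o.1) × Node t (o.2 j)) f
  rw [Fintype.prod_sigma] at h
  exact h

/-- Functions on the vertices of a tree are given by the value at the root and functions on the
subtrees of the children. -/
def nodeFunEquiv (t : ℕ) (o : Shape (t + 1)) (β : Type) :
    (Node (t + 1) o → β) ≃ β × ((j : Fin o.1) → Node t (o.2 j) → β) :=
  (Equiv.piOptionEquivProd (α := (j : Fin o.1) × Node t (o.2 j)) (β := fun _ => β)).trans
    (Equiv.prodCongr (Equiv.refl β) (Equiv.piCurry fun _ _ => β))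

theorem sum_node_fun {M β : Type} [AddCommMonoid M] [Fintype β] {t : ℕ} {o : Shape (t + 1)}
    (F : β × ((j : Fin o.1) → Node t (o.2 j) → β) → M) :
    ∑ l : Node (t + 1) o → β, F (l (root (t + 1) o), fun j v => l (childNode j v)) =
      ∑ z, ∑ L, F (z, L) := by
  rw [← Fintype.sum_prod_type]
  exact Fintype.sum_equiv (nodeFunEquiv t o β) _ F fun l => rfl

/-! ### Trees in a graph -/

section

variable {n : ℕ} (g : SimpleGraph (Fin n)) (y : Labels n)

/-- The tree of shape `o` is found at the vertex `v` in the direction away from `u`. -/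
def Match : (t : ℕ) → (o : Shape t) → Fin n → Option (Fin n) → (Node t o → Fin n) → Prop
  | 0, o, v, _, φ => φ () = v ∧ y v = o
  | t + 1, o, v, u, φ => φ (root (t + 1) o) = v ∧
      Function.Injective (fun j => φ (childNode j (root t (o.2 j)))) ∧
      (∀ w, (g.Adj v w ∧ some w ≠ u) ↔ ∃ j, φ (childNode j (root t (o.2 j))) = w) ∧
      ∀ j, Match t (o.2 j) (φ (childNode j (root t (o.2 j)))) (some v)
        (fun a => φ (childNode j a))

variable {g y}

/-- A match identifies, at every level, the neighbours other than the parent with the children in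
the tree, so the two recursions agree term by term. -/
theorem bpMessage_eq_msg {p : ℝ} {ψ : Matrix (Fin 2) (Fin 2) ℝ} {t : ℕ} {o : Shape t} {v : Fin n}
    {u : Option (Fin n)} {φ : Node t o → Fin n} (h : Match g y t o v u φ) (x : Fin 2) :
    bpMessage p ψ g y t v u x = msg p ψ t o x := by
  classical
  induction t generalizing v u x with
  | zero =>
    obtain ⟨-, h2⟩ := h
    subst h2
    rfl
  | succ t ih =>
    obtain ⟨-, h2, h3, h4⟩ := h
    rw [bpMessage]
    change _ = prior p x * ∏ j, ∑ x', ψ x x' * msg p ψ t (o.2 j) x'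
    congr 1
    symm
    refine Finset.prod_nbij (fun j => φ (childNode j (root t (o.2 j)))) ?_ ?_ ?_ ?_
    · intro j _
      simpa using (h3 _).2 ⟨j, rfl⟩
    · exact h2.injOn
    · intro w hw
      obtain ⟨j, hj⟩ := (h3 w).1 (by simpa using hw)
      exact ⟨j, by simp, hj⟩
    · intro j _
      exact Finset.sum_congr rfl fun x' _ => by rw [ih (h4 j)]

/-- In the subtree of a child, the root has one neighbour outside, its parent. The induction
therefore needs `closed` in a form that lets the root be left towards `u`, and `hu`, which keeps `u`
outside the subtree. -/
theorem match_of_pattern {t : ℕ} {o : Shape t} {u : Option (Fin n)} {φ : Node t o → Fin n}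
    (inj : Function.Injective φ)
    (adj : ∀ a b, g.Adj (φ a) (φ b) ↔ parent t o b = some a ∨ parent t o a = some b)
    (closed : ∀ a, leafLabel t o a = none → ∀ w, g.Adj (φ a) w →
      w ∈ Set.range φ ∨ (a = root t o ∧ u = some w))
    (hu : ∀ a, u ≠ some (φ a))
    (leaf : ∀ a z, leafLabel t o a = some z → y (φ a) = z) :
    Match g y t o (φ (root t o)) u φ := by
  induction t generalizing u with
  | zero => exact ⟨rfl, leaf () o rfl⟩
  | succ t ih =>
    have hpar : ∀ (j : Fin o.1) (a b : Node t (o.2 j)),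
        parent (t + 1) o (childNode j b) = some (childNode j a) ↔
          parent t (o.2 j) b = some a := by
      intro j a b
      rw [parent_childNode, Option.some_inj]
      cases hb : parent t (o.2 j) b with
      | none => simp [(childNode_ne_root j a).symm]
      | some c =>
        rw [Option.elim_some, Option.some_inj]
        exact ⟨childNode_inj, fun h => by rw [h]⟩
    have hpar0 : ∀ (j : Fin o.1) (a : Node t (o.2 j)),
        parent (t + 1) o (childNode j a) = some (root (t + 1) o) ↔ a = root t (o.2 j) := by
      intro j a
      rw [parent_childNode, Option.some_inj, ← parent_eq_none_iff (v := a)]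
      cases parent t (o.2 j) a <;> simp [childNode_ne_root]
    refine ⟨rfl, ?_, ?_, ?_⟩
    · intro j j' h
      have h1 := inj h
      simp only [childNode] at h1
      exact (Sigma.mk.inj (Option.some.inj h1)).1
    · intro w
      constructor
      · rintro ⟨h1, h2⟩
        rcases closed _ leafLabel_root w h1 with ⟨b, rfl⟩ | ⟨-, h3⟩
        · rw [adj, parent_root] at h1
          rcases node_cases b with rfl | ⟨j, a, rfl⟩
          · simp [parent_root] at h1
          · have h3 := h1.resolve_right (by simp)
            rw [hpar0] at h3
            exact ⟨j, by rw [h3]⟩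
        · exact absurd h3.symm h2
      · rintro ⟨j, rfl⟩
        exact ⟨(adj _ _).2 (Or.inl ((hpar0 j _).2 rfl)), fun h => hu _ h.symm⟩
    · intro j
      refine ih (fun a b h => childNode_inj (inj h)) (fun a b => ?_) (fun a ha w hw => ?_)
        (fun a h => ?_) (fun a z ha => leaf _ z ha)
      · rw [adj, hpar, hpar]
      · have ha' : leafLabel (t + 1) o (childNode j a) = none := ha
        rcases closed _ ha' w hw with ⟨b, rfl⟩ | ⟨h1, -⟩
        · rw [adj] at hw
          rcases node_cases b with rfl | ⟨j', b, rfl⟩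
          · rw [parent_root, hpar0] at hw
            exact Or.inr ⟨hw.resolve_left (by simp), rfl⟩
          · left
            have hjj : ∀ (j j' : Fin o.1) (a : Node t (o.2 j)) (b : Node t (o.2 j')),
                parent (t + 1) o (childNode j a) = some (childNode j' b) → j = j' := by
              intro j j' a b h
              rw [parent_childNode, Option.some_inj] at h
              cases hp : parent t (o.2 j) a with
              | none => rw [hp] at h; exact absurd h.symm (childNode_ne_root _ _)
              | some c =>
                rw [hp] at h
                exact (Sigma.mk.inj (Option.some.inj h)).1
            have : j' = j := by
              rcases hw with hw | hw
              exacts [hjj _ _ _ _ hw, (hjj _ _ _ _ hw).symm]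
            subst this
            exact ⟨b, rfl⟩
        · exact absurd h1 (childNode_ne_root _ _)
      · have := inj (Option.some_inj.1 h)
        exact childNode_ne_root _ _ this.symm

theorem IsPattern.match {t : ℕ} {o : Shape t} {φ : Node t o → Fin n}
    (h : IsPattern (parent t o) (leafLabel t o) g y φ) :
    Match g y t o (φ (root t o)) none φ :=
  match_of_pattern h.inj h.adj (fun a ha w hw => Or.inl (h.closed a ha w hw)) (by simp) h.leaf_eq

/-- The number of automorphisms of the plane tree structure: the number of orderings of the children
of the vertices. -/
def orderings : (t : ℕ) → Shape t → ℕ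
  | 0, _ => 1
  | t + 1, o => o.1.factorial * ∏ j, orderings t (o.2 j)

theorem orderings_pos (t : ℕ) (o : Shape t) : 0 < orderings t o := by
  induction t with
  | zero => exact one_pos
  | succ t ih => exact mul_pos (Nat.factorial_pos _) (Finset.prod_pos fun j _ => ih _)

/-! ### Counting the trees rooted at a vertex -/

open scoped ENNReal

theorem tsum_fin_pi {ι : Type} {k : ℕ} (f : Fin k → ι → ℝ≥0∞) :
    ∑' c : Fin k → ι, ∏ j, f j (c j) = ∏ j, ∑' i, f j i := by
  induction k with
  | zero => rw [tsum_fintype]; simp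
  | succ k ih =>
    let E : ι × (Fin k → ι) ≃ (Fin (k + 1) → ι) := Fin.consEquiv (fun _ => ι)
    have e : ∀ x : ι × (Fin k → ι), ∏ j, f j (E x j) = f 0 x.1 * ∏ j : Fin k, f j.succ (x.2 j) :=
      fun x => Fin.prod_univ_succ _
    rw [← E.tsum_eq (fun c => ∏ j, f j (c j)), tsum_congr e,
      ENNReal.tsum_prod (f := fun i (c : Fin k → ι) => f 0 i * ∏ j : Fin k, f j.succ (c j)),
      Fin.prod_univ_succ, ← ih (fun j => f j.succ), ← ENNReal.tsum_mul_right]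
    exact tsum_congr fun i => ENNReal.tsum_mul_left

open scoped Classical in
theorem card_enumerations_le (N : Set (Fin n)) (k : ℕ) :
    (Finset.univ.filter fun c : Fin k → Fin n => Function.Injective c ∧ Set.range c = N).card ≤
      if k = N.ncard then k.factorial else 0 := by
  split_ifs with hk
  · have : (Fintype.card (Fin k ↪ N)) = k.factorial := by
      rw [Fintype.card_embedding_eq, Fintype.card_fin, ← Nat.card_eq_fintype_card,
        Nat.card_coe_set_eq, ← hk, Nat.descFactorial_self]
    rw [← this, ← Fintype.card_coe]
    refine Fintype.card_le_of_injective (fun c => ⟨fun j => ⟨c.1 j, ?_⟩, ?_⟩) ?_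
    · have := (Finset.mem_filter.1 c.2).2.2
      exact this.subset ⟨j, rfl⟩
    · intro a b h
      exact (Finset.mem_filter.1 c.2).2.1 (Subtype.mk.inj h)
    · intro c c' h
      ext j
      have := congrArg (fun e : Fin k ↪ N => ((e j : N) : Fin n)) h
      exact congrArg Fin.val this
  · rw [Nat.le_zero, Finset.card_eq_zero, Finset.filter_eq_empty_iff]
    rintro c - ⟨h1, h2⟩
    apply hk
    rw [← h2, ← Set.image_univ, Set.ncard_image_of_injective _ h1, Set.ncard_univ, Nat.card_fin]

open scoped Classical in
/-- A vertex of a graph is the root of at most one tree, up to the order of the children. -/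
theorem tsum_match_le_one (g : SimpleGraph (Fin n)) (y : Labels n) (t : ℕ) (v : Fin n)
    (u : Option (Fin n)) :
    ∑' o : Shape t, ∑ φ : Node t o → Fin n,
      (if Match g y t o v u φ then ((orderings t o : ℝ≥0∞))⁻¹ else 0) ≤ 1 := by
  induction t generalizing v u with
  | zero =>
    have h1 : ∀ o : Option (Fin 2), ∑ φ : Unit → Fin n,
        (if Match g y 0 o v u φ then ((orderings 0 o : ℝ≥0∞))⁻¹ else 0) ≤
        if o = y v then 1 else 0 := by
      intro o
      rw [Fintype.sum_eq_single (fun _ => v)]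
      · split_ifs with h1 h2 h2
        · simp [orderings]
        · exact absurd h1.2.symm h2
        · exact zero_le_one
        · exact le_rfl
      · intro φ hφ
        refine if_neg fun h => hφ (funext fun a => ?_)
        exact h.1
    have h2 : ∑' o : Option (Fin 2), (if o = y v then (1 : ℝ≥0∞) else 0) = 1 := by
      rw [tsum_ite_eq]
    exact (ENNReal.tsum_le_tsum h1).trans h2.le
  | succ t ih =>
    let N : Set (Fin n) := {w | g.Adj v w ∧ some w ≠ u}
    let S : Fin n → Shape t → ℝ≥0∞ := fun w o => ∑ φ : Node t o → Fin n,
      (if Match g y t o w (some v) φ then ((orderings t o : ℝ≥0∞))⁻¹ else 0)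
    let ok : (k : ℕ) → (Fin k → Fin n) → Prop := fun k c =>
      Function.Injective c ∧ Set.range c = N
    have h1 : ∀ o : Shape (t + 1), ∑ φ : Node (t + 1) o → Fin n,
        (if Match g y (t + 1) o v u φ then ((orderings (t + 1) o : ℝ≥0∞))⁻¹ else 0) ≤
        ∑ c : Fin o.1 → Fin n, (if ok o.1 c then ((o.1.factorial : ℝ≥0∞))⁻¹ else 0) *
          ∏ j, S (c j) (o.2 j) := by
      intro o
      let F : Fin n × ((j : Fin o.1) → Node t (o.2 j) → Fin n) → ℝ≥0∞ := fun zL =>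
        if zL.1 = v ∧ ok o.1 (fun j => zL.2 j (root t (o.2 j))) ∧
          ∀ j, Match g y t (o.2 j) (zL.2 j (root t (o.2 j))) (some v) (zL.2 j)
        then ((orderings (t + 1) o : ℝ≥0∞))⁻¹ else 0
      have e1 : ∀ φ : Node (t + 1) o → Fin n,
          (if Match g y (t + 1) o v u φ then ((orderings (t + 1) o : ℝ≥0∞))⁻¹ else 0) ≤
          F (φ (root (t + 1) o), fun j a => φ (childNode j a)) := by
        intro φ
        split_ifs with h
        · refine le_of_eq (if_pos ⟨h.1, ⟨h.2.1, ?_⟩, h.2.2.2⟩).symm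
          ext w
          exact (h.2.2.1 w).symm
        · exact zero_le
      refine (Finset.sum_le_sum fun φ _ => e1 φ).trans ?_
      rw [sum_node_fun F, Fintype.sum_eq_single v]
      · have e2 : ∀ c : Fin o.1 → Fin n, ∏ j, S (c j) (o.2 j) =
            ∑ L : (j : Fin o.1) → Node t (o.2 j) → Fin n, ∏ j,
              (if Match g y t (o.2 j) (c j) (some v) (L j) then
                ((orderings t (o.2 j) : ℝ≥0∞))⁻¹ else 0) := fun c => by
          rw [← Fintype.prod_sum (fun j (φ : Node t (o.2 j) → Fin n) =>
            if Match g y t (o.2 j) (c j) (some v) φ then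
                ((orderings t (o.2 j) : ℝ≥0∞))⁻¹ else 0)]
        simp_rw [e2, Finset.mul_sum]
        rw [Finset.sum_comm]
        refine Finset.sum_le_sum fun L _ => ?_
        simp only [F]
        split_ifs with h
        · refine le_trans (le_of_eq ?_) (Finset.single_le_sum (fun c _ => zero_le)
            (Finset.mem_univ (fun j => L j (root t (o.2 j)))))
          rw [if_pos h.2.1, Finset.prod_congr rfl fun j _ => if_pos (h.2.2 j)]
          change ((o.1.factorial * ∏ j, orderings t (o.2 j) : ℕ) : ℝ≥0∞)⁻¹ = _
          rw [Nat.cast_mul, ENNReal.mul_inv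
            (Or.inl (by exact_mod_cast (Nat.factorial_pos _).ne'))
            (Or.inl (ENNReal.natCast_ne_top _)), Nat.cast_prod, ENNReal.prod_inv_distrib]
          intro a _ b _ _
          exact Or.inr (ENNReal.natCast_ne_top _)
        · exact zero_le
      · intro z hz
        exact Finset.sum_eq_zero fun L _ => if_neg fun h => hz h.1
    refine (ENNReal.tsum_le_tsum h1).trans ?_
    have h2 : ∑' o : Shape (t + 1), ∑ c : Fin o.1 → Fin n,
        (if ok o.1 c then ((o.1.factorial : ℝ≥0∞))⁻¹ else 0) * ∏ j, S (c j) (o.2 j) =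
        ∑' k : ℕ, ∑' o : Fin k → Shape t, ∑ c : Fin k → Fin n,
        (if ok k c then ((k.factorial : ℝ≥0∞))⁻¹ else 0) * ∏ j, S (c j) (o j) :=
      ENNReal.tsum_sigma' (β := fun k => Fin k → Shape t) fun o => ∑ c : Fin o.1 → Fin n,
        (if ok o.1 c then ((o.1.factorial : ℝ≥0∞))⁻¹ else 0) * ∏ j, S (c j) (o.2 j)
    rw [h2]
    have h3 : ∀ k : ℕ, ∑' o : Fin k → Shape t, ∑ c : Fin k → Fin n,
        (if ok k c then ((k.factorial : ℝ≥0∞))⁻¹ else 0) * ∏ j, S (c j) (o j) ≤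
        if k = N.ncard then 1 else 0 := by
      intro k
      rw [Summable.tsum_finsetSum fun _ _ => ENNReal.summable]
      -- By induction each child contributes a factor at most one.
      have h4 : ∀ c : Fin k → Fin n, ∑' o : Fin k → Shape t,
          (if ok k c then ((k.factorial : ℝ≥0∞))⁻¹ else 0) * ∏ j, S (c j) (o j) ≤
          if ok k c then ((k.factorial : ℝ≥0∞))⁻¹ else 0 := fun c => by
        rw [ENNReal.tsum_mul_left, tsum_fin_pi (fun j => S (c j))]
        refine mul_le_of_le_one_right' (Finset.prod_le_one' fun j _ => ih _ _)
      refine (Finset.sum_le_sum fun c _ => h4 c).trans ?_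
      rw [← Finset.sum_filter, Finset.sum_const, nsmul_eq_mul]
      have h5 := card_enumerations_le N k
      split_ifs at h5 ⊢ with hk
      -- The at most `k!` enumerations of the neighbourhood are cancelled by the weight `1 / k!` of
      -- each.
      · refine (mul_le_mul_left (Nat.cast_le.2 h5) _).trans ?_
        rw [ENNReal.mul_inv_cancel]
        · exact_mod_cast (Nat.factorial_pos _).ne'
        · exact ENNReal.natCast_ne_top _
      · rw [Nat.le_zero.1 h5]
        simp
    refine (ENNReal.tsum_le_tsum h3).trans ?_
    rw [tsum_ite_eq]

end

/-! ### Sums over the labels of a tree -/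

/-- The number of vertices of a tree other than the root. -/
def size : (t : ℕ) → Shape t → ℕ
  | 0, _ => 0
  | t + 1, o => ∑ j : Fin o.1, (size t (o.2 j) + 1)

/-- The number of vertices of a tree that are not of maximal depth. -/
def internal : (t : ℕ) → Shape t → ℕ
  | 0, _ => 0
  | t + 1, o => 1 + ∑ j : Fin o.1, internal t (o.2 j)

/-- The probability of the observations at the vertices of maximal depth, up to the factor contained
in the messages. -/
noncomputable def leafFactor (q : ℝ) : (t : ℕ) → Shape t → ℝ
  | 0, y => if (show Option (Fin 2) from y) = none then 1 - q else q
  | t + 1, o => ∏ j : Fin o.1, leafFactor q t (o.2 j)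

theorem card_node (t : ℕ) (o : Shape t) : Fintype.card (Node t o) = size t o + 1 := by
  induction t with
  | zero => exact Fintype.card_unit
  | succ t ih =>
    have h := Fintype.card_option (α := (j : Fin o.1) × Node t (o.2 j))
    rw [Fintype.card_sigma] at h
    simp_rw [ih] at h
    exact h

theorem sum_node {M : Type*} [AddCommMonoid M] {t : ℕ} {o : Shape (t + 1)}
    (f : Node (t + 1) o → M) :
    ∑ v, f v = f (root (t + 1) o) + ∑ j, ∑ v, f (childNode j v) := by
  have h := Fintype.sum_option (α := (j : Fin o.1) × Node t (o.2 j)) f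
  rw [Fintype.sum_sigma] at h
  exact h

theorem card_internal (t : ℕ) (o : Shape t) :
    (Finset.univ.filter fun v => leafLabel t o v = none).card = internal t o := by
  induction t with
  | zero =>
    change _ = 0
    rw [Finset.card_eq_zero, Finset.filter_eq_empty_iff]
    intro v _
    simp [leafLabel]
  | succ t ih =>
    rw [Finset.card_filter, sum_node, if_pos leafLabel_root]
    refine congrArg (1 + ·) (Finset.sum_congr rfl fun j _ => ?_)
    rw [← ih, Finset.card_filter]
    rfl

theorem prod_node_zero {M : Type*} [CommMonoid M] {o : Shape 0} (f : Node 0 o → M) :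
    ∏ v, f v = f (root 0 o) := Fintype.prod_unique (ι := Unit) f

/-- The weight of a labelling of the vertices of a tree. -/
noncomputable def labelWeight (p q s : ℝ) (ψ : Matrix (Fin 2) (Fin 2) ℝ) (t : ℕ) (o : Shape t)
    (l : Node t o → Fin 2) : ℝ :=
  (∏ v, prior p (l v)) * (∏ v, (parent t o v).elim 1 (fun u => s * ψ (l u) (l v))) *
    ∏ v, leafWeight q (leafLabel t o v) (l v)

theorem labelWeight_succ (p q s : ℝ) (ψ : Matrix (Fin 2) (Fin 2) ℝ) (t : ℕ) (o : Shape (t + 1))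
    (l : Node (t + 1) o → Fin 2) :
    labelWeight p q s ψ (t + 1) o l = prior p (l (root (t + 1) o)) * ∏ j : Fin o.1,
      (s * ψ (l (root (t + 1) o)) (l (childNode j (root t (o.2 j)))) *
        labelWeight p q s ψ t (o.2 j) (fun v => l (childNode j v))) := by
  have h1 : ∀ j : Fin o.1, ∏ v, ((parent (t + 1) o (childNode j v)).elim 1
      (fun u => s * ψ (l u) (l (childNode j v)))) =
      s * ψ (l (root (t + 1) o)) (l (childNode j (root t (o.2 j)))) *
      ∏ v, (parent t (o.2 j) v).elim 1 (fun u => s * ψ (l (childNode j u)) (l (childNode j v))) := by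
    intro j
    have h2 : ∀ v, ((parent (t + 1) o (childNode j v)).elim 1
      (fun u => s * ψ (l u) (l (childNode j v)))) = (if v = root t (o.2 j) then
        s * ψ (l (root (t + 1) o)) (l (childNode j (root t (o.2 j)))) else 1) *
        (parent t (o.2 j) v).elim 1
          (fun u => s * ψ (l (childNode j u)) (l (childNode j v))) := by
      intro v
      rw [parent_childNode, Option.elim_some]
      cases hv : parent t (o.2 j) v with
      | none => rw [if_pos (parent_eq_none_iff.1 hv), parent_eq_none_iff.1 hv]; simp
      | some u =>
        rw [if_neg fun h => by rw [h, parent_root] at hv; cases hv]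
        simp
    rw [Finset.prod_congr rfl fun v _ => h2 v, Finset.prod_mul_distrib, Finset.prod_ite_eq']
    simp
  simp only [labelWeight, prod_node, parent_root, leafLabel_root, Option.elim_none, leafWeight,
    one_mul, leafLabel_childNode, h1, Finset.prod_mul_distrib]
  ring

/-- Belief propagation is exact on trees: summing the joint weight over labels from the leaves
upwards is the message recursion. The test function `f` has to be arbitrary, since a subtree is met
with the factor `s * ψ z ·` of the edge to its parent. -/
theorem sum_labelWeight_mul (p q s : ℝ) (ψ : Matrix (Fin 2) (Fin 2) ℝ) (t : ℕ) (o : Shape t)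
    (f : Fin 2 → ℝ) :
    ∑ l : Node t o → Fin 2, f (l (root t o)) * labelWeight p q s ψ t o l =
      s ^ size t o * leafFactor q t o * ∑ x, f x * msg p ψ t o x := by
  induction t generalizing f with
  | zero =>
    have h1 : ∀ l : Node 0 o → Fin 2, labelWeight p q s ψ 0 o l =
        prior p (l (root 0 o)) * leafWeight q (some o) (l (root 0 o)) := fun l => by
      rw [labelWeight, prod_node_zero, prod_node_zero, prod_node_zero, parent_root,
        Option.elim_none, mul_one]
      rfl
    simp_rw [h1]
    have h2 : ∑ l : Unit → Fin 2, f (l ()) * (prior p (l ()) * leafWeight q (some o) (l ())) =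
        ∑ x, f x * (prior p x * leafWeight q (some o) x) :=
      Fintype.sum_equiv (Equiv.funUnique Unit (Fin 2)) _ _ fun l => rfl
    refine h2.trans ?_
    rw [size, pow_zero, one_mul, Finset.mul_sum]
    refine Finset.sum_congr rfl fun x _ => ?_
    obtain - | y := (show Option (Fin 2) from o)
    · simp [leafWeight, leafFactor, msg, leafMsg]
      ring
    · simp only [leafWeight, leafFactor, msg, leafMsg, reduceCtorEq, if_false, Option.some_inj,
        false_or]
      split_ifs <;> ring
  | succ t ih =>
    simp_rw [labelWeight_succ]
    rw [sum_node_fun (fun zL : Fin 2 × ((j : Fin o.1) → Node t (o.2 j) → Fin 2) =>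
      f zL.1 * (prior p zL.1 * ∏ j : Fin o.1,
      (s * ψ zL.1 (zL.2 j (root t (o.2 j))) * labelWeight p q s ψ t (o.2 j) (zL.2 j))))]
    rw [Finset.mul_sum]
    refine Finset.sum_congr rfl fun z _ => ?_
    simp_rw [← Finset.mul_sum]
    rw [← Fintype.prod_sum (fun j (L : Node t (o.2 j) → Fin 2) =>
      s * ψ z (L (root t (o.2 j))) * labelWeight p q s ψ t (o.2 j) L)]
    simp_rw [fun j => ih (o.2 j) (fun x => s * ψ z x)]
    have h1 : ∀ j : Fin o.1, s ^ size t (o.2 j) * leafFactor q t (o.2 j) *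
        ∑ x, s * ψ z x * msg p ψ t (o.2 j) x = s ^ (size t (o.2 j) + 1) *
        leafFactor q t (o.2 j) * ∑ x, ψ z x * msg p ψ t (o.2 j) x := fun j => by
      simp_rw [mul_assoc s, ← Finset.mul_sum]
      ring
    simp_rw [h1, Finset.prod_mul_distrib, Finset.prod_pow_eq_pow_sum]
    obtain ⟨k, o⟩ := o
    simp only [size, leafFactor, msg]
    ring

/-- The factorials of the orderings cancel those of the Poisson weights. What remains is what the
finite graph produces: `d` per edge, `exp (-d)` per inner vertex, and the observations. -/
theorem orderings_mul_shapeFactor (q d : ℝ) (t : ℕ) (o : Shape t) :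
    orderings t o * shapeFactor q d t o =
      Real.exp (-d) ^ internal t o * d ^ size t o * leafFactor q t o := by
  induction t with
  | zero => simp [orderings, internal, size, leafFactor, shapeFactor]
  | succ t ih =>
    obtain ⟨k, o⟩ := o
    have h1 : (∏ j, (orderings t (o j) : ℝ)) * ∏ j, shapeFactor q d t (o j) =
        Real.exp (-d) ^ (∑ j, internal t (o j)) * d ^ (∑ j, size t (o j)) *
          ∏ j, leafFactor q t (o j) := by
      rw [← Finset.prod_mul_distrib, ← Finset.prod_pow_eq_pow_sum, ← Finset.prod_pow_eq_pow_sum,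
        ← Finset.prod_mul_distrib, ← Finset.prod_mul_distrib]
      exact Finset.prod_congr rfl fun j _ => ih (o j)
    have h2 : (k.factorial : ℝ) ≠ 0 := by exact_mod_cast (Nat.factorial_pos k).ne'
    simp only [orderings, internal, size, leafFactor, shapeFactor, Nat.cast_mul, Nat.cast_prod,
      Finset.sum_add_distrib, Finset.sum_const, Finset.card_univ, Fintype.card_fin, smul_eq_mul,
      mul_one, pow_add, pow_one]
    calc _ = (k.factorial / k.factorial : ℝ) * (Real.exp (-d) * d ^ k) *
        ((∏ j, (orderings t (o j) : ℝ)) * ∏ j, shapeFactor q d t (o j)) := by ring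
      _ = _ := by rw [h1, div_self h2]; ring

theorem leafFactor_nonneg {q : ℝ} (hq0 : 0 ≤ q) (hq1 : q ≤ 1) (t : ℕ) (o : Shape t) :
    0 ≤ leafFactor q t o := by
  induction t with
  | zero => unfold leafFactor; split_ifs <;> linarith
  | succ t ih => exact Finset.prod_nonneg fun j _ => ih _

/-! ### Lower bounds for sums over the trees around a vertex -/

section

variable {p q d M : ℝ} {ψ : Matrix (Fin 2) (Fin 2) ℝ} {n : ℕ}

/-- The tree of shape `o` is found in the graph at the vertices `φ`. -/
abbrev TreeAt (t : ℕ) (o : Shape t) (g : SimpleGraph (Fin n)) (y : Labels n)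
    (φ : Node t o → Fin n) : Prop :=
  IsPattern (parent t o) (leafLabel t o) g y φ

theorem prob_label_treeAt_ge (h : Admissible p q d ψ) (hM : ∀ x x', d * ψ x x' ≤ M) (hMn : M ≤ n)
    {t : ℕ} {o : Shape t} (hdn : d * (size t o + 1) ≤ n) {φ : Node t o → Fin n}
    (hφ : Function.Injective φ) (x : Fin 2) :
    leafFactor q t o * (d / n) ^ size t o * ((1 - M / n) ^ ((size t o + 1) ^ 2) *
      (1 - d * internal t o / n) ^ n) * msg p ψ t o x ≤
    prob p q ψ d (fun ω => ω.1 (φ (root t o)) = x ∧ TreeAt t o ω.2.1 (observed ω) φ) := by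
  classical
  have h1 : prob p q ψ d (fun ω => ω.1 (φ (root t o)) = x ∧ TreeAt t o ω.2.1 (observed ω) φ) =
      ∑ l : Node t o → Fin 2, if l (root t o) = x then
        prob p q ψ d (fun ω => (∀ v, ω.1 (φ v) = l v) ∧
            TreeAt t o ω.2.1 (observed ω) φ) else 0 := by
    simp_rw [prob_eq_sum_ite]
    refine Eq.symm ((Finset.sum_congr rfl fun l _ => (?_ : _ = ∑ ω : Outcome n,
      if (fun v => ω.1 (φ v)) = l then (if ω.1 (φ (root t o)) = x ∧
        TreeAt t o ω.2.1 (observed ω) φ then weight p q ψ d ω else 0) else 0)).trans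
      (Finset.sum_comm.trans (Finset.sum_congr rfl fun ω _ => ?_)))
    · split_ifs with hl
      · refine Finset.sum_congr rfl fun ω _ => ?_
        by_cases hω : (fun v => ω.1 (φ v)) = l
        · have h3 : ∀ v, ω.1 (φ v) = l v := congrFun hω
          simp only [h3, hl, implies_true, true_and, if_true]
        · rw [if_neg hω, if_neg fun h => hω (funext h.1)]
      · refine (Finset.sum_eq_zero fun ω _ => ?_).symm
        split_ifs with h3 h4
        · exact absurd ((congrFun h3 _).symm.trans h4.1) hl
        · rfl
        · rfl
    · rw [Finset.sum_ite_eq, if_pos (Finset.mem_univ _)]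
      congr!
  rw [h1]
  have h2 := sum_labelWeight_mul p q (d / n) ψ t o (fun z => if z = x then 1 else 0)
  simp only [ite_mul, one_mul, zero_mul, Finset.sum_ite_eq', Finset.mem_univ, if_true] at h2
  have h3 : leafFactor q t o * (d / n) ^ size t o * ((1 - M / n) ^ ((size t o + 1) ^ 2) *
      (1 - d * internal t o / n) ^ n) * msg p ψ t o x =
      ((d / n) ^ size t o * leafFactor q t o * msg p ψ t o x) *
      ((1 - M / n) ^ ((size t o + 1) ^ 2) * (1 - d * internal t o / n) ^ n) := by ring
  rw [h3, ← h2, Finset.sum_mul]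
  refine Finset.sum_le_sum fun l _ => ?_
  split_ifs with hl
  · have h4 := prob_isPattern_ge h hM hMn (par := parent t o) (leaf := leafLabel t o)
      (by rw [card_node]; exact_mod_cast hdn) l hφ (dep := depth t o) depth_parent
    rw [card_node] at h4
    refine le_of_eq_of_le ?_ h4
    rw [← card_internal]
    unfold labelWeight
    congr!
  · simp

open scoped Classical in
-- The root is fixed at `i` and the other vertices are embedded into the remaining `n - 1` places; a
-- falling factorial is bounded below by a power.
theorem card_placements_ge {t : ℕ} (o : Shape t) (i : Fin n) :
    (n - size t o) ^ size t o ≤ (Finset.univ.filter fun φ : Node t o → Fin n =>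
      Function.Injective φ ∧ φ (root t o) = i).card := by
  have hn : 0 < n := i.pos
  have h1 : Fintype.card ({v : Node t o // v ≠ root t o} ↪ {j : Fin n // j ≠ i}) =
      (n - 1).descFactorial (size t o) := by
    rw [Fintype.card_embedding_eq]
    simp [Fintype.card_subtype_compl, card_node]
  have h2 := Nat.pow_sub_le_descFactorial (n - 1) (size t o)
  rw [Nat.sub_add_cancel hn] at h2
  refine h2.trans ?_
  rw [← h1, ← Fintype.card_coe]
  refine Fintype.card_le_of_injective (fun e => ⟨fun v => if hv : v = root t o then i else
    (e ⟨v, hv⟩ : Fin n), ?_⟩) ?_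
  · refine Finset.mem_filter.2 ⟨Finset.mem_univ _, ?_, by simp⟩
    intro v w hvw
    by_cases hv : v = root t o <;> by_cases hw : w = root t o
    · rw [hv, hw]
    · simp only [hv, hw, dif_pos, dif_neg, not_false_eq_true] at hvw
      exact absurd hvw.symm (e ⟨w, hw⟩).2
    · simp only [hv, hw, dif_pos, dif_neg, not_false_eq_true] at hvw
      exact absurd hvw (e ⟨v, hv⟩).2
    · simp only [hv, hw, dif_neg, not_false_eq_true] at hvw
      exact Subtype.mk.inj (e.injective (Subtype.ext hvw))
  · intro e e' he
    ext ⟨v, hv⟩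
    have := congrFun (Subtype.mk.inj he) v
    simp only [hv, dif_neg, not_false_eq_true] at this
    exact congrArg Fin.val this

open scoped Classical in
theorem sum_treeAt_le_one {t : ℕ} (F : Finset (Shape t)) (g : SimpleGraph (Fin n)) (y : Labels n)
    (i : Fin n) :
    ∑ o ∈ F, ∑ φ : Node t o → Fin n, (if TreeAt t o g y φ ∧ φ (root t o) = i then
      ((orderings t o : ℝ))⁻¹ else 0) ≤ 1 := by
  have h1 := (ENNReal.sum_le_tsum F).trans (tsum_match_le_one g y t i none)
  have h2 : ENNReal.ofReal (∑ o ∈ F, ∑ φ : Node t o → Fin n,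
      (if TreeAt t o g y φ ∧ φ (root t o) = i then ((orderings t o : ℝ))⁻¹ else 0)) ≤ 1 := by
    have h0 : ∀ (o : Shape t) (φ : Node t o → Fin n),
        0 ≤ (if TreeAt t o g y φ ∧ φ (root t o) = i then ((orderings t o : ℝ))⁻¹ else 0) := by
      intro o φ
      split_ifs
      exacts [by positivity, le_rfl]
    rw [ENNReal.ofReal_sum_of_nonneg fun o _ => Finset.sum_nonneg fun φ _ => h0 o φ]
    refine (Finset.sum_le_sum fun o _ => ?_).trans h1
    rw [ENNReal.ofReal_sum_of_nonneg fun φ _ => h0 o φ]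
    refine Finset.sum_le_sum fun φ _ => ?_
    split_ifs with ha hb
    · rw [ENNReal.ofReal_inv_of_pos (by exact_mod_cast orderings_pos t o), ENNReal.ofReal_natCast]
    · exact absurd (ha.2 ▸ ha.1.match) hb
    · simp
    · simp
  rwa [ENNReal.ofReal_le_one] at h2

/-- The ratio of the probability of a tree in the graph on `n` vertices and in the limiting
branching process is at least this number. -/
noncomputable def treeRatio (d M : ℝ) (t : ℕ) (o : Shape t) (n : ℕ) : ℝ :=
  (1 - size t o / n) ^ size t o * (1 - M / n) ^ ((size t o + 1) ^ 2) *
    ((1 - d * internal t o / n) ^ n * Real.exp d ^ internal t o)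

/-- Only the exponent of the last factor grows with `n`; that factor tends to `exp (-d)` per inner
vertex and cancels `Real.exp d ^ internal t o`. -/
theorem tendsto_treeRatio (d M : ℝ) (t : ℕ) (o : Shape t) :
    Tendsto (treeRatio d M t o) atTop (𝓝 1) := by
  have h1 : ∀ (c : ℝ) (k : ℕ), Tendsto (fun n : ℕ => (1 - c / n) ^ k) atTop (𝓝 1) := by
    intro c k
    have := ((tendsto_const_nhds (x := (1 : ℝ))).sub
      (tendsto_const_div_atTop_nhds_zero_nat c)).pow k
    simpa using this
  have h2 := Real.tendsto_one_add_div_pow_exp (-(d * internal t o))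
  have h3 := ((h1 (size t o) (size t o)).mul (h1 M ((size t o + 1) ^ 2))).mul
    (h2.mul_const (Real.exp d ^ internal t o))
  rw [← Real.exp_nat_mul, ← Real.exp_add, mul_comm d, neg_add_cancel, Real.exp_zero, one_mul,
    one_mul] at h3
  refine h3.congr fun n => ?_
  rw [treeRatio, ← Real.exp_nat_mul, mul_comm d, neg_div, ← sub_eq_add_neg]

/-- The sum over the labels `x` of the probabilities that `T_i = σ x` given `X_i = x`. -/
noncomputable def score (p q : ℝ) (ψ : Matrix (Fin 2) (Fin 2) ℝ) (d : ℝ) {n : ℕ} (T : Estimator n)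
    (σ : Fin 2 → Fin 2) (i : Fin n) : ℝ :=
  ∑ x, prob p q ψ d (fun ω => T ω.2.1 (observed ω) i = σ x ∧ ω.1 i = x) / prior p x

open scoped Classical in
-- In each outcome the copies of trees at `i`, weighted by the inverse number of orderings, add up
-- to at most one, so splitting the score over them can only lose.
theorem score_ge_sum_treeAt (h : Admissible p q d ψ) {t : ℕ} (F : Finset (Shape t))
    (T : Estimator n) (σ : Fin 2 → Fin 2) (i : Fin n) :
    ∑ o ∈ F, ∑ φ : Node t o → Fin n, (if φ (root t o) = i then (orderings t o : ℝ)⁻¹ *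
      ∑ x, prob p q ψ d (fun ω => (T ω.2.1 (observed ω) i = σ x ∧ ω.1 i = x) ∧
        TreeAt t o ω.2.1 (observed ω) φ) / prior p x else 0) ≤ score p q ψ d T σ i := by
  let f : Outcome n → ℝ := fun ω => ∑ x, if T ω.2.1 (observed ω) i = σ x ∧ ω.1 i = x then
    weight p q ψ d ω / prior p x else 0
  have hf : ∀ ω, 0 ≤ f ω := fun ω => Finset.sum_nonneg fun x _ => by
    split_ifs
    exacts [div_nonneg (weight_nonneg_of h.p_pos.le h.p_lt.le h.q_nonneg h.q_le ω)
      (h.prior_pos x).le, le_rfl]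
  have h1 : score p q ψ d T σ i = ∑ ω, f ω := by
    simp only [score, f, prob_eq_sum_ite, Finset.sum_div]
    rw [Finset.sum_comm]
    refine Finset.sum_congr rfl fun ω _ => Finset.sum_congr rfl fun x _ => ?_
    split_ifs <;> simp
  have h2 : ∀ (o : Shape t) (φ : Node t o → Fin n), (if φ (root t o) = i then
      (orderings t o : ℝ)⁻¹ * ∑ x, prob p q ψ d (fun ω => (T ω.2.1 (observed ω) i = σ x ∧
        ω.1 i = x) ∧ TreeAt t o ω.2.1 (observed ω) φ) / prior p x else 0) =
      ∑ ω, (if TreeAt t o ω.2.1 (observed ω) φ ∧ φ (root t o) = i then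
        (orderings t o : ℝ)⁻¹ else 0) * f ω := by
    intro o φ
    simp only [f, prob_eq_sum_ite, Finset.sum_div]
    rw [Finset.sum_comm]
    by_cases hr : φ (root t o) = i
    · rw [if_pos hr, Finset.mul_sum]
      refine Finset.sum_congr rfl fun ω _ => ?_
      by_cases hp : TreeAt t o ω.2.1 (observed ω) φ
      · rw [if_pos ⟨hp, hr⟩]
        congr 1
        refine Finset.sum_congr rfl fun x _ => ?_
        simp only [hp, and_true]
        split_ifs <;> simp
      · rw [if_neg fun h => hp h.1]
        simp [hp]
    · simp [hr]
  simp_rw [h2]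
  rw [h1]
  have h3 : ∑ o ∈ F, ∑ φ : Node t o → Fin n, ∑ ω : Outcome n,
      (if TreeAt t o ω.2.1 (observed ω) φ ∧ φ (root t o) = i then
        (orderings t o : ℝ)⁻¹ else 0) * f ω = ∑ ω : Outcome n, (∑ o ∈ F, ∑ φ : Node t o → Fin n,
      (if TreeAt t o ω.2.1 (observed ω) φ ∧ φ (root t o) = i then
        (orderings t o : ℝ)⁻¹ else 0)) * f ω := by
    simp_rw [Finset.sum_mul]
    rw [Finset.sum_comm]
    refine Finset.sum_congr rfl fun o _ => Finset.sum_comm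
  rw [h3]
  exact Finset.sum_le_sum fun ω _ => mul_le_of_le_one_left (hf ω) (sum_treeAt_le_one F _ _ i)

/-- On a tree the test gives a fixed answer `τ`, so its contribution is a sum of likelihoods,
bounded below by `c o`. Taking `σ` the identity measures success, and exchanging the labels measures
errors. -/
theorem score_ge (h : Admissible p q d ψ) (hM : ∀ x x', d * ψ x x' ≤ M) (hMn : M ≤ n) {t : ℕ}
    {F : Finset (Shape t)} (hdn : ∀ o ∈ F, d * (size t o + 1) ≤ n) (hn : ∀ o ∈ F, size t o ≤ n)
    (T : Estimator n) (σ : Fin 2 → Fin 2) (i : Fin n) {c : Shape t → ℝ} (hc : ∀ o, 0 ≤ c o)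
    (hT : ∀ o ∈ F, ∀ φ : Node t o → Fin n, φ (root t o) = i →
      ∃ τ, (∀ g y, TreeAt t o g y φ → T g y i = τ) ∧
        c o ≤ ∑ x, if τ = σ x then msg p ψ t o x / prior p x else 0) :
    ∑ o ∈ F, treeRatio d M t o n * (shapeFactor q d t o * c o) ≤ score p q ψ d T σ i := by
  classical
  have hn0 : (0 : ℝ) < n := by exact_mod_cast i.pos
  have hd := h.d_pos
  refine le_trans (Finset.sum_le_sum fun o ho => ?_) (score_ge_sum_treeAt h F T σ i)
  set K := leafFactor q t o * (d / n) ^ size t o * ((1 - M / n) ^ ((size t o + 1) ^ 2) *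
      (1 - d * internal t o / n) ^ n) with hK
  have hI : d * internal t o ≤ n := by
    refine le_trans (mul_le_mul_of_nonneg_left ?_ hd.le) (hdn o ho)
    have := Finset.card_le_univ (Finset.univ.filter fun v => leafLabel t o v = none)
    rw [card_internal, card_node] at this
    exact_mod_cast this
  have hK0 : 0 ≤ K := by
    have h1 := leafFactor_nonneg h.q_nonneg h.q_le t o
    have h2 : 0 ≤ 1 - M / n := sub_nonneg.2 ((div_le_one hn0).2 hMn)
    have h3 : 0 ≤ 1 - d * internal t o / n := sub_nonneg.2 ((div_le_one hn0).2 hI)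
    positivity
  have hterm : ∀ φ : Node t o → Fin n, Function.Injective φ → φ (root t o) = i →
      (orderings t o : ℝ)⁻¹ * (K * c o) ≤ (orderings t o : ℝ)⁻¹ *
      ∑ x, prob p q ψ d (fun ω => (T ω.2.1 (observed ω) i = σ x ∧ ω.1 i = x) ∧
        TreeAt t o ω.2.1 (observed ω) φ) / prior p x := by
    intro φ hφ hr
    obtain ⟨τ, hτ, hcτ⟩ := hT o ho φ hr
    refine mul_le_mul_of_nonneg_left ((mul_le_mul_of_nonneg_left hcτ hK0).trans ?_) (by positivity)
    rw [Finset.mul_sum]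
    refine Finset.sum_le_sum fun x _ => ?_
    have hx := h.prior_pos x
    split_ifs with hx'
    · rw [← mul_div_assoc]
      refine div_le_div_of_nonneg_right ?_ hx.le
      refine (prob_label_treeAt_ge h hM hMn (hdn o ho) hφ x).trans
        (prob_mono h.p_pos.le h.p_lt.le h.q_nonneg h.q_le ?_)
      rintro ω ⟨h1, h2⟩
      exact ⟨⟨(hτ _ _ h2).trans hx', hr ▸ h1⟩, h2⟩
    · rw [mul_zero]
      exact div_nonneg (prob_nonneg h.p_pos.le h.p_lt.le h.q_nonneg h.q_le _) hx.le
  have hsum : ((Finset.univ.filter fun φ : Node t o → Fin n =>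
      Function.Injective φ ∧ φ (root t o) = i).card : ℝ) * ((orderings t o : ℝ)⁻¹ * (K * c o)) ≤
      ∑ φ : Node t o → Fin n, (if φ (root t o) = i then (orderings t o : ℝ)⁻¹ *
      ∑ x, prob p q ψ d (fun ω => (T ω.2.1 (observed ω) i = σ x ∧ ω.1 i = x) ∧
        TreeAt t o ω.2.1 (observed ω) φ) / prior p x else 0) := by
    rw [← nsmul_eq_mul, ← Finset.sum_const, Finset.sum_filter]
    refine Finset.sum_le_sum fun φ _ => ?_
    split_ifs with h1 h2 h2
    · exact hterm φ h1.1 h2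
    · exact absurd h1.2 h2
    · exact mul_nonneg (by positivity) (Finset.sum_nonneg fun x _ => div_nonneg
        (prob_nonneg h.p_pos.le h.p_lt.le h.q_nonneg h.q_le _) (h.prior_pos x).le)
    · exact le_rfl
  refine le_trans ?_ hsum
  have ho0 : (0 : ℝ) < orderings t o := by exact_mod_cast orderings_pos t o
  have hcard : ((n : ℝ) - size t o) ^ size t o ≤ ((Finset.univ.filter fun φ : Node t o → Fin n =>
      Function.Injective φ ∧ φ (root t o) = i).card : ℝ) := by
    have := card_placements_ge o i
    rw [← Nat.cast_sub (hn o ho)]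
    exact_mod_cast this
  refine le_trans (le_of_eq ?_) (mul_le_mul_of_nonneg_right hcard
    (mul_nonneg (by positivity) (mul_nonneg hK0 (hc o))))
  have e1 : shapeFactor q d t o = (orderings t o : ℝ)⁻¹ *
      (Real.exp (-d) ^ internal t o * d ^ size t o * leafFactor q t o) := by
    rw [← orderings_mul_shapeFactor, inv_mul_cancel_left₀ ho0.ne']
  have e2 : Real.exp d ^ internal t o * Real.exp (-d) ^ internal t o = 1 := by
    rw [← mul_pow, ← Real.exp_add, add_neg_cancel, Real.exp_zero, one_pow]
  have e3 : (1 - size t o / n : ℝ) ^ size t o * d ^ size t o =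
      (n - size t o : ℝ) ^ size t o * (d / n) ^ size t o := by
    rw [← mul_pow, ← mul_pow]
    congr 1
    field_simp
  rw [e1, treeRatio, hK]
  calc _ = ((1 - size t o / n : ℝ) ^ size t o * d ^ size t o) *
      (Real.exp d ^ internal t o * Real.exp (-d) ^ internal t o) *
      ((orderings t o : ℝ)⁻¹ * (leafFactor q t o * ((1 - M / n) ^ ((size t o + 1) ^ 2) *
      (1 - d * internal t o / n) ^ n) * c o)) := by ring
    _ = _ := by rw [e2, e3]; ring

end

/-! ### Balls and local tests -/

section

variable {n : ℕ} {g g' : SimpleGraph (Fin n)} {y y' : Labels n} {i : Fin n}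

theorem mem_ball_zero {v : Fin n} : v ∈ ball g 0 i ↔ v = i := by
  change g.edist i v ≤ (0 : ℕ) ↔ _
  rw [Nat.cast_zero, nonpos_iff_eq_zero, SimpleGraph.edist_eq_zero_iff, eq_comm]

theorem ball_mono {s r : ℕ} (h : s ≤ r) : ball g s i ⊆ ball g r i := fun v hv =>
  le_trans (show g.edist i v ≤ s from hv) (by exact_mod_cast h)

theorem mem_ball_succ_of_adj {s : ℕ} {w v : Fin n} (hw : w ∈ ball g s i) (h : g.Adj w v) :
    v ∈ ball g (s + 1) i := by
  have h1 : g.edist i w ≤ s := hw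
  have h2 : g.edist w v = 1 := SimpleGraph.edist_eq_one_iff_adj.2 h
  change g.edist i v ≤ (s + 1 : ℕ)
  rw [Nat.cast_add, Nat.cast_one]
  exact (SimpleGraph.edist_triangle (v := w)).trans (add_le_add h1 h2.le)

theorem mem_ball_succ {s : ℕ} {v : Fin n} :
    v ∈ ball g (s + 1) i ↔ v = i ∨ ∃ w ∈ ball g s i, g.Adj w v := by
  constructor
  · intro h
    have h1 : g.edist v i ≤ (s + 1 : ℕ) := by rw [SimpleGraph.edist_comm]; exact h
    obtain ⟨p, hp⟩ := SimpleGraph.exists_walk_of_edist_ne_top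
      (ne_top_of_le_ne_top (ENat.natCast_ne_top _) h1)
    rw [← hp, Nat.cast_le] at h1
    cases p with
    | nil => exact Or.inl rfl
    | cons ha p' =>
      refine Or.inr ⟨_, ?_, ha.symm⟩
      change g.edist i _ ≤ s
      rw [SimpleGraph.edist_comm]
      refine (SimpleGraph.edist_le p').trans ?_
      rw [SimpleGraph.Walk.length_cons] at h1
      exact_mod_cast Nat.le_of_succ_le_succ h1
  · rintro (rfl | ⟨w, hw, h⟩)
    · exact ball_mono (Nat.zero_le _) (mem_ball_zero.2 rfl)
    · exact mem_ball_succ_of_adj hw h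

theorem edist_eq_iff {r : ℕ} {v : Fin n} :
    g.edist i v = r ↔ v ∈ ball g r i ∧ ∀ s < r, v ∉ ball g s i := by
  constructor
  · intro h
    refine ⟨h.le, fun s hs hv => ?_⟩
    have : g.edist i v ≤ s := hv
    rw [h, Nat.cast_le] at this
    omega
  · rintro ⟨h1, h2⟩
    have h1' : g.edist i v ≤ r := h1
    obtain ⟨m, hm⟩ := ENat.ne_top_iff_exists.1 (ne_top_of_le_ne_top (ENat.natCast_ne_top _) h1')
    rw [← hm, Nat.cast_le] at h1'
    rcases h1'.lt_or_eq with h3 | h3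
    · exact absurd (show g.edist i v ≤ m from hm.ge) (h2 m h3)
    · rw [← hm, h3]

theorem ballGraph_adj {r : ℕ} {u v : Fin n} :
    (ballGraph g r i).Adj u v ↔ u ∈ ball g r i ∧ v ∈ ball g r i ∧ g.Adj u v := by
  simp only [ballGraph, SimpleGraph.map_adj, SimpleGraph.comap_adj]
  constructor
  · rintro ⟨a, b, h, rfl, rfl⟩
    exact ⟨a.2, b.2, h⟩
  · rintro ⟨hu, hv, h⟩
    exact ⟨⟨u, hu⟩, ⟨v, hv⟩, h, rfl, rfl⟩

theorem ball_eq_of_le {r s : ℕ} (hb : ball g r i = ball g' r i)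
    (hg : ballGraph g r i = ballGraph g' r i) (hs : s ≤ r) : ball g s i = ball g' s i := by
  induction s with
  | zero => ext v; rw [mem_ball_zero, mem_ball_zero]
  | succ s ih =>
    have ih' := ih (by omega)
    ext v
    constructor
    · intro hv
      rcases mem_ball_succ.1 hv with rfl | ⟨w, hw, ha⟩
      · exact mem_ball_succ.2 (Or.inl rfl)
      · have h1 := ballGraph_adj.2 ⟨ball_mono (by omega) hw, ball_mono hs hv, ha⟩
        rw [hg] at h1
        exact mem_ball_succ_of_adj (ih' ▸ hw) (ballGraph_adj.1 h1).2.2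
    · intro hv
      rcases mem_ball_succ.1 hv with rfl | ⟨w, hw, ha⟩
      · exact mem_ball_succ.2 (Or.inl rfl)
      · have h1 := ballGraph_adj.2 ⟨ball_mono (by omega) hw, ball_mono hs hv, ha⟩
        rw [← hg] at h1
        exact mem_ball_succ_of_adj (ih' ▸ hw) (ballGraph_adj.1 h1).2.2

theorem boundaryLabels_eq {r : ℕ} (hb : ball g r i = ball g' r i)
    (hg : ballGraph g r i = ballGraph g' r i) (hy : ∀ v ∈ ball g r i, y v = y' v) :
    boundaryLabels g y r i = boundaryLabels g' y' r i := by
  funext v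
  have h1 : g.edist i v = r ↔ g'.edist i v = r := by
    rw [edist_eq_iff, edist_eq_iff, hb]
    exact and_congr_right fun _ => forall₂_congr fun s hs => by rw [ball_eq_of_le hb hg hs.le]
  unfold boundaryLabels
  split_ifs with h2 h3 h3
  exacts [hy v h2.le, absurd (h1.1 h2) h3, absurd (h1.2 h3) h2, rfl]

theorem locTest_eq {p q d : ℝ} {ψ : Matrix (Fin 2) (Fin 2) ℝ} {r : ℕ}
    (hb : ball g r i = ball g' r i) (hg : ballGraph g r i = ballGraph g' r i)
    (hy : boundaryLabels g y r i = boundaryLabels g' y' r i) :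
    locTest p q ψ d r n g y i = locTest p q ψ d r n g' y' i := by
  have : SameBall r i g y = SameBall r i g' y' := by
    funext ω
    simp only [SameBall, hb, hg, hy]
  simp only [locTest, this]

theorem isLocal_locTest (p q d : ℝ) (ψ : Matrix (Fin 2) (Fin 2) ℝ) (r n : ℕ) :
    IsLocal r (locTest p q ψ d r n) := fun _ _ _ _ _ hb hg hy =>
  locTest_eq hb hg (boundaryLabels_eq hb hg hy)

theorem bpMessage_congr {p : ℝ} {ψ : Matrix (Fin 2) (Fin 2) ℝ} {r : ℕ}
    (hb : ball g r i = ball g' r i) (hg : ballGraph g r i = ballGraph g' r i)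
    (hy : ∀ v ∈ ball g r i, y v = y' v) {m s : ℕ} (hms : m + s ≤ r) {v : Fin n}
    (hv : v ∈ ball g s i) (u : Option (Fin n)) (x : Fin 2) :
    bpMessage p ψ g y m v u x = bpMessage p ψ g' y' m v u x := by
  classical
  induction m generalizing s v u x with
  | zero => rw [bpMessage, bpMessage, hy v (ball_mono (by omega) hv)]
  | succ m ih =>
    have hadj : ∀ w, g.Adj v w ↔ g'.Adj v w := by
      intro w
      have hv' : v ∈ ball g' s i := by
        rw [← ball_eq_of_le hb hg (show s ≤ r by omega)]
        exact hv
      constructor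
      · intro ha
        have h1 := ballGraph_adj.2 ⟨ball_mono (show s ≤ r by omega) hv,
          ball_mono (show s + 1 ≤ r by omega) (mem_ball_succ_of_adj hv ha), ha⟩
        rw [hg] at h1
        exact (ballGraph_adj.1 h1).2.2
      · intro ha
        have h1 := ballGraph_adj.2 ⟨ball_mono (show s ≤ r by omega) hv',
          ball_mono (show s + 1 ≤ r by omega) (mem_ball_succ_of_adj hv' ha), ha⟩
        rw [← hg] at h1
        exact (ballGraph_adj.1 h1).2.2
    rw [bpMessage, bpMessage]
    congr 1
    refine Finset.prod_congr (Finset.filter_congr fun w _ => by rw [hadj]) fun w hw =>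
      Finset.sum_congr rfl fun x' _ => ?_
    rw [ih (s := s + 1) (by omega)
      (mem_ball_succ_of_adj hv ((hadj w).2 (Finset.mem_filter.1 hw).2.1))]

theorem isLocal_bpTest (p : ℝ) (ψ : Matrix (Fin 2) (Fin 2) ℝ) (r n : ℕ) :
    IsLocal r (bpTest p ψ r n) := by
  intro i g g' y y' hb hg hy
  have h := fun x => bpMessage_congr (p := p) (ψ := ψ) hb hg hy (m := r) (s := 0) le_rfl
    (mem_ball_zero.2 rfl) none x
  simp only [bpTest, h]

/-- The belief propagation test based on the labels at distance exactly `r` only. -/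
noncomputable def boundaryBpTest (p : ℝ) (ψ : Matrix (Fin 2) (Fin 2) ℝ) (r n : ℕ) : Estimator n :=
  fun g y i => bpTest p ψ r n g (boundaryLabels g y r i) i

/-- In a ball with cycles, belief propagation may end at distance less than `r` and read labels that
`locTest` does not use. Fed with the boundary labels only, it is a function of the same data as
`locTest` and can be compared with it. -/
theorem boundaryBpTest_eq_of_sameBall {p : ℝ} {ψ : Matrix (Fin 2) (Fin 2) ℝ} {r : ℕ}
    {ω : Outcome n} (h : SameBall r i g y ω) :
    boundaryBpTest p ψ r n ω.2.1 (observed ω) i = boundaryBpTest p ψ r n g y i :=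
  isLocal_bpTest p ψ r n i _ _ _ _ h.1 h.2.1 fun v _ => by rw [h.2.2]

section

variable {t : ℕ} {o : Shape t} {φ : Node t o → Fin n}

/-- A vertex of depth less than `t` has no neighbours outside the tree, so up to radius `t` the
balls grow along the tree. -/
theorem TreeAt.mem_ball_iff (h : TreeAt t o g y φ) (hr : φ (root t o) = i) {s : ℕ} (hs : s ≤ t)
    {v : Fin n} : v ∈ ball g s i ↔ ∃ a, depth t o a ≤ s ∧ φ a = v := by
  induction s generalizing v with
  | zero =>
    rw [mem_ball_zero]
    constructor
    · rintro rfl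
      exact ⟨root t o, (depth_root t o).le, hr⟩
    · rintro ⟨a, ha, rfl⟩
      cases hp : parent t o a with
      | none => rw [parent_eq_none_iff.1 hp, hr]
      | some u => have := depth_parent _ _ hp; omega
  | succ s ih =>
    rw [mem_ball_succ]
    constructor
    · rintro (rfl | ⟨w, hw, ha⟩)
      · exact ⟨root t o, (depth_root t o).le.trans (Nat.zero_le _), hr⟩
      · obtain ⟨a, hda, rfl⟩ := (ih (by omega)).1 hw
        obtain ⟨b, rfl⟩ := h.closed a (leafLabel_eq_none_iff.2 (by omega)) _ ha
        refine ⟨b, ?_, rfl⟩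
        rcases (h.adj _ _).1 ha with hp | hp <;> have := depth_parent _ _ hp <;> omega
    · rintro ⟨a, ha, rfl⟩
      cases hp : parent t o a with
      | none => rw [parent_eq_none_iff.1 hp, hr]; exact Or.inl rfl
      | some u =>
        have := depth_parent _ _ hp
        exact Or.inr ⟨φ u, (ih (by omega)).2 ⟨u, by omega, rfl⟩, (h.adj _ _).2 (Or.inl hp)⟩

theorem TreeAt.ball_eq (h : TreeAt t o g y φ) (hr : φ (root t o) = i) :
    ball g t i = Set.range φ := by
  ext v
  rw [h.mem_ball_iff hr le_rfl]
  exact ⟨fun ⟨a, _, ha⟩ => ⟨a, ha⟩, fun ⟨a, ha⟩ => ⟨a, depth_le a, ha⟩⟩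

theorem TreeAt.edist_eq (h : TreeAt t o g y φ) (hr : φ (root t o) = i) (a : Node t o) :
    g.edist i (φ a) = depth t o a := by
  rw [edist_eq_iff]
  refine ⟨(h.mem_ball_iff hr (depth_le a)).2 ⟨a, le_rfl, rfl⟩, fun s hs hv => ?_⟩
  obtain ⟨b, hb, hab⟩ := (h.mem_ball_iff hr (hs.le.trans (depth_le a))).1 hv
  rw [h.inj hab] at hb
  omega

theorem TreeAt.boundaryLabels_eq (h : TreeAt t o g y φ) (hr : φ (root t o) = i) (a : Node t o) :
    boundaryLabels g y t i (φ a) = (leafLabel t o a).elim none id := by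
  unfold boundaryLabels
  have key : g.edist i (φ a) = t ↔ depth t o a = t := by rw [h.edist_eq hr, Nat.cast_inj]
  cases hl : leafLabel t o a with
  | none => rw [if_neg (mt key.1 (leafLabel_eq_none_iff.1 hl).ne), Option.elim_none]
  | some z =>
    rw [if_pos, h.leaf_eq a z hl, Option.elim_some, id]
    refine key.2 (le_antisymm (depth_le a) (not_lt.1 fun hlt => ?_))
    rw [leafLabel_eq_none_iff.2 hlt] at hl
    cases hl

theorem TreeAt.boundary (h : TreeAt t o g y φ) (hr : φ (root t o) = i) :
    TreeAt t o g (boundaryLabels g y t i) φ :=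
  ⟨h.inj, h.adj, h.closed, fun a z hz => by rw [h.boundaryLabels_eq hr, hz]; rfl⟩

/-- The ball, its graph and its boundary labels can all be read off from the shape and `φ`. Thus the
test is constant on a tree, and its value there need not be computed. -/
theorem TreeAt.locTest_eq {p q d : ℝ} {ψ : Matrix (Fin 2) (Fin 2) ℝ} (h : TreeAt t o g y φ)
    (h' : TreeAt t o g' y' φ) (hr : φ (root t o) = i) :
    locTest p q ψ d t n g y i = locTest p q ψ d t n g' y' i := by
  have hb : ball g t i = ball g' t i := by rw [h.ball_eq hr, h'.ball_eq hr]
  refine SBM.locTest_eq hb ?_ ?_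
  · ext u v
    rw [ballGraph_adj, ballGraph_adj, ← hb, h.ball_eq hr]
    refine and_congr_right fun hu => and_congr_right fun hv => ?_
    obtain ⟨a, rfl⟩ := hu
    obtain ⟨b, rfl⟩ := hv
    rw [h.adj, h'.adj]
  · funext v
    by_cases hv : v ∈ Set.range φ
    · obtain ⟨a, rfl⟩ := hv
      rw [h.boundaryLabels_eq hr, h'.boundaryLabels_eq hr]
    · have h1 : ¬ g.edist i v = t := fun h1 => hv (h.ball_eq hr ▸ h1.le)
      have h2 : ¬ g'.edist i v = t := fun h1 => hv (h'.ball_eq hr ▸ h1.le)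
      rw [boundaryLabels, boundaryLabels, if_neg h1, if_neg h2]

theorem TreeAt.bpTest_eq {p : ℝ} {ψ : Matrix (Fin 2) (Fin 2) ℝ} (h : TreeAt t o g y φ)
    (hr : φ (root t o) = i) :
    bpTest p ψ t n g y i = decision p (msg p ψ t o 0) (msg p ψ t o 1) := by
  have := h.match
  rw [hr] at this
  simp only [bpTest, bpMessage_eq_msg this]

theorem TreeAt.boundaryBpTest_eq {p : ℝ} {ψ : Matrix (Fin 2) (Fin 2) ℝ} (h : TreeAt t o g y φ)
    (hr : φ (root t o) = i) :
    boundaryBpTest p ψ t n g y i = decision p (msg p ψ t o 0) (msg p ψ t o 1) :=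
  (h.boundary hr).bpTest_eq hr

end

end

/-! ### Optimality of the likelihood ratio tests -/

/-- Thresholding `u / v` at `p / (1 - p)` compares `u / p` with `v / (1 - p)`. For `u = v = 0` the
convention `0 / 0 = 0` selects label 2, which is harmless in a tie. -/
theorem decision_cases {p : ℝ} (hp0 : 0 < p) (hp1 : p < 1) {u v : ℝ} (hu : 0 ≤ u) (hv : 0 ≤ v) :
    (decision p u v = 0 ∧ v / (1 - p) ≤ u / p) ∨ (decision p u v = 1 ∧ u / p ≤ v / (1 - p)) := by
  have hp2 : 0 < 1 - p := sub_pos.2 hp1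
  have h1 : logRatio p (1 - p) ≤ logRatio u v ↔
      ENNReal.ofReal p / ENNReal.ofReal (1 - p) ≤ ENNReal.ofReal u / ENNReal.ofReal v :=
    ENNReal.log_le_log_iff
  rcases hv.eq_or_lt with rfl | hv
  · rcases hu.eq_or_lt with rfl | hu
    · right
      refine ⟨if_neg ?_, by simp⟩
      rw [h1, ← ENNReal.ofReal_div_of_pos hp2, ENNReal.ofReal_zero, ENNReal.zero_div,
        nonpos_iff_eq_zero, ENNReal.ofReal_eq_zero, not_le]
      positivity
    · left
      refine ⟨if_pos ?_, by rw [zero_div]; positivity⟩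
      rw [h1, ENNReal.ofReal_zero, ENNReal.div_zero (by simpa using hu)]
      exact le_top
  · rw [← ENNReal.ofReal_div_of_pos hp2, ← ENNReal.ofReal_div_of_pos hv,
      ENNReal.ofReal_le_ofReal_iff (by positivity), div_le_div_iff₀ hp2 hv] at h1
    by_cases h2 : p * v ≤ u * (1 - p)
    · exact Or.inl ⟨if_pos (h1.2 h2), by rw [div_le_div_iff₀ hp2 hp0]; linarith⟩
    · exact Or.inr ⟨if_neg (mt h1.1 h2), by rw [div_le_div_iff₀ hp0 hp2]; linarith⟩

section

variable {p q d : ℝ} {ψ : Matrix (Fin 2) (Fin 2) ℝ} {n : ℕ}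

theorem prob_div_prior_le_decision (h : Admissible p q d ψ) (i : Fin n) (B : Outcome n → Prop)
    (z : Fin 2) {D : Fin 2} (hD : D = decision p (condProb p q ψ d (fun ω => ω.1 i = 0) B)
      (condProb p q ψ d (fun ω => ω.1 i = 1) B)) :
    prob p q ψ d (fun ω => ω.1 i = z ∧ B ω) / prior p z ≤
      prob p q ψ d (fun ω => ω.1 i = D ∧ B ω) / prior p D := by
  have h0 : ∀ A : Outcome n → Prop, 0 ≤ prob p q ψ d A :=
    prob_nonneg h.p_pos.le h.p_lt.le h.q_nonneg h.q_le
  rcases (h0 B).eq_or_lt with hB | hB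
  · have h1 : ∀ x, prob p q ψ d (fun ω => ω.1 i = x ∧ B ω) = 0 := fun x =>
      le_antisymm (hB ▸ prob_mono h.p_pos.le h.p_lt.le h.q_nonneg h.q_le fun ω hω => hω.2) (h0 _)
    simp [h1]
  · have h2 := decision_cases h.p_pos h.p_lt
      (u := condProb p q ψ d (fun ω => ω.1 i = 0) B) (v := condProb p q ψ d (fun ω => ω.1 i = 1) B)
      (div_nonneg (h0 _) hB.le) (div_nonneg (h0 _) hB.le)
    rw [← hD] at h2
    simp only [condProb] at h2
    rw [div_right_comm, div_right_comm (prob p q ψ d fun ω => ω.1 i = 0 ∧ B ω),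
      div_le_div_iff_of_pos_right hB, div_le_div_iff_of_pos_right hB] at h2
    have e0 : prior p 0 = p := if_pos rfl
    have e1 : prior p 1 = 1 - p := if_neg (by decide)
    rcases h2 with ⟨h2, h3⟩ | ⟨h2, h3⟩ <;> rw [h2] <;> fin_cases z <;>
      simp only [Fin.zero_eta, Fin.mk_one, e0, e1] <;> first | exact h3 | exact le_rfl

theorem score_eq_sum_weight (p q : ℝ) (ψ : Matrix (Fin 2) (Fin 2) ℝ) (d : ℝ) (T : Estimator n)
    (i : Fin n) : score p q ψ d T id i = ∑ ω : Outcome n,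
      if ω.1 i = T ω.2.1 (observed ω) i then weight p q ψ d ω / prior p (ω.1 i) else 0 := by
  classical
  simp only [score, prob_eq_sum_ite, Finset.sum_div]
  rw [Finset.sum_comm]
  refine Finset.sum_congr rfl fun ω _ => ?_
  rw [Fintype.sum_eq_single (ω.1 i)]
  · split_ifs with h1 h2 h2
    · rfl
    · exact absurd h1.1.symm h2
    · exact absurd ⟨h2.symm, rfl⟩ h1
    · exact zero_div _
  · intro x hx
    rw [if_neg fun h => hx h.2.symm, zero_div]

/-- The Neyman–Pearson argument: the score is a sum over the values of `I`. On each fibre a test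
contributes the probability of one label divided by its prior, and the decision rule selects the
larger of the two. -/
theorem score_le_of_info (h : Admissible p q d ψ) {κ : Type} (I : Outcome n → κ)
    (T D : Estimator n) (i : Fin n)
    (hT : ∀ ω ω', I ω = I ω' → T ω.2.1 (observed ω) i = T ω'.2.1 (observed ω') i)
    (hD : ∀ ω, D ω.2.1 (observed ω) i = decision p
      (condProb p q ψ d (fun ω' => ω'.1 i = 0) (fun ω' => I ω' = I ω))
      (condProb p q ψ d (fun ω' => ω'.1 i = 1) (fun ω' => I ω' = I ω))) :
    score p q ψ d T id i ≤ score p q ψ d D id i := by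
  classical
  have key : ∀ (T : Estimator n) (ω₀ : Outcome n),
      (∀ ω, I ω = I ω₀ → T ω.2.1 (observed ω) i = T ω₀.2.1 (observed ω₀) i) →
      ∑ ω : Outcome n with I ω = I ω₀,
        (if ω.1 i = T ω.2.1 (observed ω) i then weight p q ψ d ω / prior p (ω.1 i) else 0) =
      prob p q ψ d (fun ω => ω.1 i = T ω₀.2.1 (observed ω₀) i ∧ I ω = I ω₀) /
        prior p (T ω₀.2.1 (observed ω₀) i) := by
    intro T ω₀ hT
    rw [prob_eq_sum_ite, Finset.sum_div, Finset.sum_filter]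
    refine Finset.sum_congr rfl fun ω _ => ?_
    by_cases hI : I ω = I ω₀
    · rw [if_pos hI, hT ω hI]
      by_cases hx : ω.1 i = T ω₀.2.1 (observed ω₀) i
      · rw [if_pos hx, if_pos ⟨hx, hI⟩, hx]
      · rw [if_neg hx, if_neg fun h => hx h.1, zero_div]
    · rw [if_neg hI, if_neg fun h => hI h.2, zero_div]
  have hm : ∀ ω ∈ (Finset.univ : Finset (Outcome n)), I ω ∈ Finset.univ.image I :=
    fun ω hω => Finset.mem_image_of_mem I hω
  rw [score_eq_sum_weight, score_eq_sum_weight, ← Finset.sum_fiberwise_of_maps_to hm,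
    ← Finset.sum_fiberwise_of_maps_to hm]
  refine Finset.sum_le_sum fun k hk => ?_
  obtain ⟨ω₀, -, rfl⟩ := Finset.mem_image.1 hk
  rw [key T ω₀ fun ω hω => hT ω ω₀ hω, key D ω₀ fun ω hω => by rw [hD, hD, hω]]
  exact prob_div_prior_le_decision h i _ _ (hD ω₀)

theorem score_le_score_optTest (h : Admissible p q d ψ) (T : Estimator n) (i : Fin n) :
    score p q ψ d T id i ≤ score p q ψ d (optTest p q ψ d n) id i := by
  refine score_le_of_info h (fun ω => (ω.2.1, observed ω)) T _ i (fun ω ω' hω => ?_) fun ω => ?_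
  · rw [Prod.mk.injEq] at hω
    rw [hω.1, hω.2]
  · simp only [Prod.mk.injEq]
    rfl

theorem score_le_score_locTest (h : Admissible p q d ψ) {r : ℕ} (T : Estimator n) (i : Fin n)
    (hT : ∀ g y (ω : Outcome n), SameBall r i g y ω → T ω.2.1 (observed ω) i = T g y i) :
    score p q ψ d T id i ≤ score p q ψ d (locTest p q ψ d r n) id i := by
  refine score_le_of_info h (fun ω => (ball ω.2.1 r i, ballGraph ω.2.1 r i,
    boundaryLabels ω.2.1 (observed ω) r i)) T _ i (fun ω ω' hω => ?_) fun ω => ?_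
  · simp only [Prod.mk.injEq] at hω
    exact hT _ _ _ hω
  · simp only [Prod.mk.injEq]
    rfl

theorem score_nonneg (h : Admissible p q d ψ) (T : Estimator n) (σ : Fin 2 → Fin 2) (i : Fin n) :
    0 ≤ score p q ψ d T σ i :=
  Finset.sum_nonneg fun x _ => div_nonneg
    (prob_nonneg h.p_pos.le h.p_lt.le h.q_nonneg h.q_le _) (h.prior_pos x).le

/-- Given its label, a vertex is classified either correctly or wrongly. This converts lower bounds
for errors into upper bounds for success. -/
theorem score_add_score_swap (h : Admissible p q d ψ) (T : Estimator n) (i : Fin n) :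
    score p q ψ d T id i + score p q ψ d T (fun x => 1 - x) i = 2 := by
  classical
  have h1 : ∀ x : Fin 2, prob p q ψ d (fun ω => T ω.2.1 (observed ω) i = x ∧ ω.1 i = x) /
      prior p x + prob p q ψ d (fun ω => T ω.2.1 (observed ω) i = 1 - x ∧ ω.1 i = x) / prior p x
      = 1 := by
    intro x
    rw [← add_div, div_eq_one_iff_eq (h.prior_pos x).ne', ← prob_label (p := p) (q := q) (ψ := ψ)
      (d := d) i x]
    simp_rw [prob_eq_sum_ite]
    rw [← Finset.sum_add_distrib]
    refine Finset.sum_congr rfl fun ω _ => ?_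
    have h2 : ∀ a b : Fin 2, (a = b ∧ ¬ a = 1 - b) ∨ (¬ a = b ∧ a = 1 - b) := by decide
    by_cases hx : ω.1 i = x
    · simp only [hx, and_true, if_true]
      rcases h2 (T ω.2.1 (observed ω) i) x with ⟨h3, h4⟩ | ⟨h3, h4⟩
      · rw [if_pos h3, if_neg h4, add_zero]
      · rw [if_neg h3, if_pos h4, zero_add]
    · simp [hx]
  rw [score, score, ← Finset.sum_add_distrib]
  simp only [id, h1]
  simp

theorem pSucc_eq_score (T : Estimator n) :
    pSucc p q ψ d n T = 1 / (n : ℝ) * ∑ i : Fin n, (score p q ψ d T id i - 1) := by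
  simp only [pSucc, condProb, prob_label, score, Fin.sum_univ_two, id]

theorem le_pSucc (hn : 0 < n) {T : Estimator n} {c : ℝ}
    (hc : ∀ i, c ≤ score p q ψ d T id i - 1) : c ≤ pSucc p q ψ d n T := by
  have hn' : (0 : ℝ) < n := by exact_mod_cast hn
  have := Finset.sum_le_sum fun i (_ : i ∈ Finset.univ) => hc i
  rw [pSucc_eq_score, one_div, inv_mul_eq_div, le_div_iff₀ hn']
  simpa [mul_comm] using this

theorem pSucc_le (hn : 0 < n) {T : Estimator n} {c : ℝ}
    (hc : ∀ i, score p q ψ d T id i - 1 ≤ c) : pSucc p q ψ d n T ≤ c := by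
  have hn' : (0 : ℝ) < n := by exact_mod_cast hn
  have := Finset.sum_le_sum fun i (_ : i ∈ Finset.univ) => hc i
  rw [pSucc_eq_score, one_div, inv_mul_eq_div, div_le_iff₀ hn']
  simpa [mul_comm] using this

theorem pSucc_mono {T T' : Estimator n}
    (hT : ∀ i, score p q ψ d T id i ≤ score p q ψ d T' id i) :
    pSucc p q ψ d n T ≤ pSucc p q ψ d n T' := by
  rw [pSucc_eq_score, pSucc_eq_score]
  exact mul_le_mul_of_nonneg_left (Finset.sum_le_sum fun i _ => sub_le_sub_right (hT i) 1)
    (by positivity)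

theorem abs_pSucc_le_one (h : Admissible p q d ψ) (hn : 0 < n) (T : Estimator n) :
    |pSucc p q ψ d n T| ≤ 1 := by
  rw [abs_le]
  refine ⟨le_pSucc hn fun i => ?_, pSucc_le hn fun i => ?_⟩
  · linarith [score_nonneg h T id i]
  · linarith [score_nonneg h T (fun x => 1 - x) i, score_add_score_swap h T i]

/-! ### The limit of the success probability -/

/-- A finite set `F` of shapes carries all of the sum but less than `η`, and `treeRatio` tends to
one on it. The bound is uniform in the test and the vertex, and nothing has to be known about the
other neighbourhoods. -/
theorem eventually_score_ge (h : Admissible p q d ψ) {t : ℕ} {c : Shape t → ℝ} (hc : ∀ o, 0 ≤ c o)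
    {s : ℝ} (hs : HasSum (fun o => shapeFactor q d t o * c o) s) {η : ℝ} (hη : 0 < η) :
    ∀ᶠ n : ℕ in atTop, ∀ (T : Estimator n) (σ : Fin 2 → Fin 2) (i : Fin n),
      (∀ o, ∀ φ : Node t o → Fin n, φ (root t o) = i →
        ∃ τ, (∀ g y, TreeAt t o g y φ → T g y i = τ) ∧
          c o ≤ ∑ x, if τ = σ x then msg p ψ t o x / prior p x else 0) →
      s - η ≤ score p q ψ d T σ i := by
  obtain ⟨F, hF⟩ := ((tendsto_order.1 hs).1 (s - η) (by linarith)).exists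
  set M := ∑ x, ∑ x', d * ψ x x' with hMdef
  have hM : ∀ x x', d * ψ x x' ≤ M := fun x x' =>
    (Finset.single_le_sum (f := fun x' => d * ψ x x')
      (fun z _ => (mul_pos h.d_pos (h.pos x z)).le) (Finset.mem_univ x')).trans
    (Finset.single_le_sum (f := fun x => ∑ x', d * ψ x x')
      (fun z _ => Finset.sum_nonneg fun z' _ => (mul_pos h.d_pos (h.pos z z')).le)
      (Finset.mem_univ x))
  have hlim : Tendsto (fun n : ℕ => ∑ o ∈ F, treeRatio d M t o n * (shapeFactor q d t o * c o))
      atTop (𝓝 (∑ o ∈ F, shapeFactor q d t o * c o)) := by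
    have := tendsto_finsetSum F fun o _ =>
      (tendsto_treeRatio d M t o).mul_const (shapeFactor q d t o * c o)
    simpa only [one_mul] using this
  have e1 := (tendsto_order.1 hlim).1 (s - η) hF
  have e2 : ∀ᶠ n : ℕ in atTop, M ≤ n := tendsto_natCast_atTop_atTop.eventually_ge_atTop M
  have e3 : ∀ᶠ n : ℕ in atTop, ∀ o ∈ F, d * (size t o + 1) ≤ n :=
    (Finset.eventually_all F).2 fun o _ => tendsto_natCast_atTop_atTop.eventually_ge_atTop _
  have e4 : ∀ᶠ n : ℕ in atTop, ∀ o ∈ F, size t o ≤ n :=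
    (Finset.eventually_all F).2 fun o _ => eventually_ge_atTop _
  filter_upwards [e1, e2, e3, e4] with n h1 h2 h3 h4 T σ i hT
  exact h1.le.trans (score_ge h hM h2 h3 h4 T σ i hc fun o _ => hT o)

/-- With `u`, `v` the conditional probabilities of a shape, `max u v = v + (u - v)⁺` and `min u v =
u - (u - v)⁺`, while `u` and `v` each have total mass one. -/
theorem hasSum_max_shapeProb (h : Admissible p q d ψ) (t : ℕ) :
    HasSum (fun o => shapeFactor q d t o * max (msg p ψ t o 0 / p) (msg p ψ t o 1 / (1 - p)))
      (1 + treeAdvantage p q d ψ t) ∧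
    HasSum (fun o => shapeFactor q d t o * min (msg p ψ t o 0 / p) (msg p ψ t o 1 / (1 - p)))
      (1 - treeAdvantage p q d ψ t) := by
  have hp := h.p_pos
  have hp2 : 0 < 1 - p := sub_pos.2 h.p_lt
  have h0 : HasSum (fun o => shapeProb p q d ψ t o 0 / p) 1 := by
    have := (hasSum_shapeProb h t 0).div_const p
    rwa [show prior p 0 = p from if_pos rfl, div_self hp.ne'] at this
  have h1 : HasSum (fun o => shapeProb p q d ψ t o 1 / (1 - p)) 1 := by
    have := (hasSum_shapeProb h t 1).div_const (1 - p)
    rwa [show prior p 1 = 1 - p from if_neg (by decide), div_self hp2.ne'] at this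
  have h2 : HasSum (fun o => max 0 (shapeProb p q d ψ t o 0 / p -
      shapeProb p q d ψ t o 1 / (1 - p)))
      (treeAdvantage p q d ψ t) :=
    (h0.summable.of_nonneg_of_le (fun o => le_max_left _ _) fun o => max_le
      (div_nonneg (shapeProb_nonneg h t o 0) hp.le)
      (sub_le_self _ (div_nonneg (shapeProb_nonneg h t o 1) hp2.le))).hasSum
  constructor
  · refine (h1.add h2).congr_fun fun o => ?_
    rw [mul_max_of_nonneg _ _ (shapeFactor_nonneg h t o), ← mul_div_assoc, ← mul_div_assoc]
    change max (shapeProb p q d ψ t o 0 / p) (shapeProb p q d ψ t o 1 / (1 - p)) = _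
    rcases le_total (shapeProb p q d ψ t o 0 / p) (shapeProb p q d ψ t o 1 / (1 - p)) with h3 | h3
    · rw [max_eq_right h3, max_eq_left (by linarith), add_zero]
    · rw [max_eq_left h3, max_eq_right (by linarith), add_sub_cancel]
  · refine (h0.sub h2).congr_fun fun o => ?_
    rw [mul_min_of_nonneg _ _ (shapeFactor_nonneg h t o), ← mul_div_assoc, ← mul_div_assoc]
    change min (shapeProb p q d ψ t o 0 / p) (shapeProb p q d ψ t o 1 / (1 - p)) = _
    rcases le_total (shapeProb p q d ψ t o 0 / p) (shapeProb p q d ψ t o 1 / (1 - p)) with h3 | h3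
    · rw [min_eq_left h3, max_eq_left (by linarith), sub_zero]
    · rw [min_eq_right h3, max_eq_right (by linarith), sub_sub_cancel]

theorem eventually_le_score (h : Admissible p q d ψ) (t : ℕ) {η : ℝ} (hη : 0 < η) :
    ∀ᶠ n : ℕ in atTop, ∀ (T : Estimator n) (i : Fin n),
      (∀ o, ∀ φ : Node t o → Fin n, φ (root t o) = i → ∀ g y, TreeAt t o g y φ →
        T g y i = decision p (msg p ψ t o 0) (msg p ψ t o 1)) →
      treeAdvantage p q d ψ t - η ≤ score p q ψ d T id i - 1 := by
  filter_upwards [eventually_score_ge h (c := fun o => max (msg p ψ t o 0 / p)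
    (msg p ψ t o 1 / (1 - p))) (fun o => le_max_of_le_left (div_nonneg (msg_nonneg h t o 0)
      h.p_pos.le)) (hasSum_max_shapeProb h t).1 hη] with n hn T i hT
  have := hn T id i fun o φ hr => ⟨_, hT o φ hr, ?_⟩
  · linarith
  · have e0 : prior p 0 = p := if_pos rfl
    have e1 : prior p 1 = 1 - p := if_neg (by decide)
    rcases decision_cases h.p_pos h.p_lt (msg_nonneg h t o 0) (msg_nonneg h t o 1)
      with ⟨h1, h2⟩ | ⟨h1, h2⟩
    · simp [h1, max_eq_left h2, e0]
    · simp [h1, max_eq_right h2, e1]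

/-- Only constancy on trees is used: whichever label is answered, the error has at least the smaller
of the two likelihoods. -/
theorem eventually_score_le (h : Admissible p q d ψ) (t : ℕ) {η : ℝ} (hη : 0 < η) :
    ∀ᶠ n : ℕ in atTop, ∀ (T : Estimator n) (i : Fin n),
      (∀ o, ∀ φ : Node t o → Fin n, φ (root t o) = i → ∀ g y g' y', TreeAt t o g y φ →
        TreeAt t o g' y' φ → T g y i = T g' y' i) →
      score p q ψ d T id i - 1 ≤ treeAdvantage p q d ψ t + η := by
  filter_upwards [eventually_score_ge h (c := fun o => min (msg p ψ t o 0 / p)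
    (msg p ψ t o 1 / (1 - p))) (fun o => le_min (div_nonneg (msg_nonneg h t o 0) h.p_pos.le)
      (div_nonneg (msg_nonneg h t o 1) (sub_pos.2 h.p_lt).le))
    (hasSum_max_shapeProb h t).2 hη] with n hn T i hT
  have := hn T (fun x => 1 - x) i fun o φ hr => ?_
  · linarith [score_add_score_swap h T i]
  · have h1 : ∃ τ, ∀ g y, TreeAt t o g y φ → T g y i = τ := by
      by_cases hex : ∃ g y, TreeAt t o g y φ
      · obtain ⟨g, y, hgy⟩ := hex
        exact ⟨T g y i, fun g' y' h' => hT o φ hr _ _ _ _ h' hgy⟩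
      · push Not at hex
        exact ⟨0, fun g y hgy => absurd hgy (hex g y)⟩
    obtain ⟨τ, hτ⟩ := h1
    refine ⟨τ, hτ, ?_⟩
    have e0 : prior p 0 = p := if_pos rfl
    have e1 : prior p 1 = 1 - p := if_neg (by decide)
    fin_cases τ <;> simp [e0, e1]

theorem tendsto_pSucc (h : Admissible p q d ψ) (t : ℕ) (T : (n : ℕ) → Estimator n)
    (h1 : ∀ η > 0, ∀ᶠ n in atTop, ∀ i,
      treeAdvantage p q d ψ t - η ≤ score p q ψ d (T n) id i - 1)
    (h2 : ∀ n, ∀ o, ∀ φ : Node t o → Fin n, ∀ g y g' y', TreeAt t o g y φ →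
        TreeAt t o g' y' φ → T n g y (φ (root t o)) = T n g' y' (φ (root t o))) :
    Tendsto (fun n => pSucc p q ψ d n (T n)) atTop (𝓝 (treeAdvantage p q d ψ t)) := by
  refine Metric.tendsto_nhds.2 fun ε hε => ?_
  filter_upwards [h1 (ε / 2) (half_pos hε), eventually_score_le h t (half_pos hε),
    eventually_gt_atTop 0] with n a1 a2 hn
  rw [Real.dist_eq]
  have b1 := le_pSucc hn a1
  have b2 := pSucc_le hn fun i => a2 (T n) i fun o φ hr g y g' y' hg hg' =>
      hr ▸ h2 n o φ _ _ _ _ hg hg'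
  have : |pSucc p q ψ d n (T n) - treeAdvantage p q d ψ t| ≤ ε / 2 := by
    rw [abs_le]; constructor <;> linarith
  linarith

theorem tendsto_pSucc_bpTest (h : Admissible p q d ψ) (t : ℕ) :
    Tendsto (fun n => pSucc p q ψ d n (bpTest p ψ t n)) atTop
      (𝓝 (treeAdvantage p q d ψ t)) := by
  refine tendsto_pSucc h t (fun n => bpTest p ψ t n) (fun η hη => ?_)
    fun n o φ g y g' y' hg hg' => by rw [hg.bpTest_eq rfl, hg'.bpTest_eq rfl]
  filter_upwards [eventually_le_score h t hη] with n hn i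
  exact hn _ i fun o φ hr g y hg => hg.bpTest_eq hr

/-- The upper bound comes from constancy on trees, the lower one from optimality among tests using
the ball and its boundary labels. -/
theorem tendsto_pSucc_locTest (h : Admissible p q d ψ) (t : ℕ) :
    Tendsto (fun n => pSucc p q ψ d n (locTest p q ψ d t n)) atTop
      (𝓝 (treeAdvantage p q d ψ t)) := by
  refine tendsto_pSucc h t (fun n => locTest p q ψ d t n) (fun η hη => ?_)
    fun n o φ g y g' y' hg hg' => hg.locTest_eq hg' rfl
  filter_upwards [eventually_le_score h t hη] with n hn i
  refine (hn (boundaryBpTest p ψ t n) i fun o φ hr g y hg => hg.boundaryBpTest_eq hr).trans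
    (sub_le_sub_right (score_le_score_locTest h _ i fun g y ω hω => ?_) 1)
  exact boundaryBpTest_eq_of_sameBall hω

theorem treeAdvantage_le_liminf (h : Admissible p q d ψ) (t : ℕ) :
    treeAdvantage p q d ψ t ≤
      liminf (fun n => pSucc p q ψ d n (optTest p q ψ d n)) atTop := by
  rw [← (tendsto_pSucc_locTest h t).liminf_eq]
  refine liminf_le_liminf (Eventually.of_forall fun n => pSucc_mono fun i =>
    score_le_score_optTest h _ i) (tendsto_pSucc_locTest h t).isBoundedUnder_ge ?_
  refine (isBoundedUnder_of_eventually_le (a := 1) ?_).isCoboundedUnder_ge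
  filter_upwards [eventually_gt_atTop 0] with n hn
  exact (abs_le.1 (abs_pSucc_le_one h hn _)).2

theorem liminf_pSucc_optTest_le_one (h : Admissible p q d ψ) :
    liminf (fun n => pSucc p q ψ d n (optTest p q ψ d n)) atTop ≤ 1 := by
  have h1 : ∀ᶠ n : ℕ in atTop, |pSucc p q ψ d n (optTest p q ψ d n)| ≤ 1 := by
    filter_upwards [eventually_gt_atTop 0] with n hn
    exact abs_pSucc_le_one h hn _
  exact liminf_le_of_frequently_le (h1.mono fun n hn => (abs_le.1 hn).2).frequently
    (isBoundedUnder_of_eventually_ge (h1.mono fun n hn => (abs_le.1 hn).1))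

end

/-! ### Parameters for large `d` and conclusion -/

theorem eventually_admissible {p q lam : ℝ} (hp0 : 0 < p) (hp1 : p < 1) (hq0 : 0 ≤ q) (hq1 : q ≤ 1)
    {a b c : ℝ → ℝ} (hab : ∀ d : ℝ, 0 < d → p * a d + (1 - p) * b d = 1)
    (hbc : ∀ d : ℝ, 0 < d → p * b d + (1 - p) * c d = 1)
    (hlam : ∀ d : ℝ, 0 < d → d * (1 - b d) ^ 2 = lam) :
    ∀ᶠ d in atTop, Admissible p q d (affinity (a d) (b d) (c d)) := by
  have hp2 : 0 < 1 - p := sub_pos.2 hp1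
  set ε := min p (1 - p) with hε
  have hε0 : 0 < ε := lt_min hp0 hp2
  have hε1 : ε ≤ p := min_le_left _ _
  have hε2 : ε ≤ 1 - p := min_le_right _ _
  filter_upwards [eventually_gt_atTop 0, eventually_gt_atTop (lam / ε ^ 2)] with d hd hd2
  rw [div_lt_iff₀ (by positivity), ← hlam d hd] at hd2
  -- Once `d > lam / ε ^ 2`, `|1 - b| < min p (1 - p)`. Then `b > 0`, and `(1 - p) b` and `p b` are
  -- less than 1, which forces `a` and `c` to be positive.
  have h1 := abs_lt_of_sq_lt_sq (lt_of_mul_lt_mul_left hd2 hd.le) hε0.le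
  rw [abs_lt] at h1
  have hb : 0 < b d := by linarith
  have ha : 0 < a d := by
    have : (1 - p) * b d < 1 := by nlinarith
    exact pos_of_mul_pos_right (by linarith [hab d hd] : 0 < p * a d) hp0.le
  have hc : 0 < c d := by
    have : p * b d < 1 := by nlinarith
    exact pos_of_mul_pos_right (by linarith [hbc d hd] : 0 < (1 - p) * c d) hp2.le
  refine ⟨hp0, hp1, hq0, hq1, hd, fun x x' => ?_, fun x => ?_, fun x x' => ?_⟩
  · fin_cases x <;> fin_cases x' <;> simpa [affinity]
  · fin_cases x
    · simpa [affinity, prior] using hab d hd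
    · simpa [affinity, prior] using hbc d hd
  · fin_cases x <;> fin_cases x' <;> simp [affinity]

end SBM

theorem mainTheorem8 (p q lam : ℝ) (hp0 : 0 < p) (hp1 : p < 1) (hq0 : 0 ≤ q) (hq1 : q ≤ 1)
    (a b c : ℝ → ℝ)
    (hab : ∀ d : ℝ, 0 < d → p * a d + (1 - p) * b d = 1)
    (hbc : ∀ d : ℝ, 0 < d → p * b d + (1 - p) * c d = 1)
    (hlam : ∀ d : ℝ, 0 < d → d * (1 - b d) ^ 2 = lam) :
    ∃ μ : ℝ, 0 ≤ μ ∧ Tendsto (SBM.muSeq p q lam) atTop (𝓝 μ) ∧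
      SBM.gaussSucc μ ≤
        liminf (fun d : ℝ => liminf (fun n : ℕ =>
          SBM.pSucc p q (SBM.affinity (a d) (b d) (c d)) d n
            (SBM.optTest p q (SBM.affinity (a d) (b d) (c d)) d n)) atTop) atTop ∧
      (∀ (r : ℕ) (d : ℝ) (n : ℕ),
        SBM.IsLocal r (SBM.locTest p q (SBM.affinity (a d) (b d) (c d)) d r n)) ∧
      SBM.IteratedLimit (fun r d n =>
          SBM.pSucc p q (SBM.affinity (a d) (b d) (c d)) d n
            (SBM.locTest p q (SBM.affinity (a d) (b d) (c d)) d r n)) (SBM.gaussSucc μ) ∧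
      (∀ (r : ℕ) (d : ℝ) (n : ℕ),
        SBM.IsLocal r (SBM.bpTest p (SBM.affinity (a d) (b d) (c d)) r n)) ∧
      SBM.IteratedLimit (fun r d n =>
          SBM.pSucc p q (SBM.affinity (a d) (b d) (c d)) d n
            (SBM.bpTest p (SBM.affinity (a d) (b d) (c d)) r n)) (SBM.gaussSucc μ) := by
  have hadm := SBM.eventually_admissible hp0 hp1 hq0 hq1 hab hbc hlam
  have hlam0 : 0 ≤ lam := by
    rw [← hlam 1 one_pos]
    positivity
  obtain ⟨μ, hμ, hlim⟩ := SBM.exists_tendsto_muSeq hp0 hp1 hq0 hlam0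
  obtain ⟨v, hv, hvlim⟩ := SBM.exists_tendsto_treeAdvantage (q := q) hadm
    (lam := lam) ((eventually_gt_atTop 0).mono hlam) hlam0 hμ hlim
  refine ⟨μ, hμ, hlim, ?_, fun r d n => SBM.isLocal_locTest _ _ _ _ _ _, ?_,
    fun r d n => SBM.isLocal_bpTest _ _ _ _, ?_⟩
  -- For each fixed radius, the limiting advantage in the tree bounds the optimal success from
  -- below; the radius is sent to infinity last.
  · refine le_of_tendsto hvlim (Eventually.of_forall fun r => ?_)
    rw [← (hv r).liminf_eq]
    exact liminf_le_liminf (hadm.mono fun d hd => SBM.treeAdvantage_le_liminf hd r)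
      (hv r).isBoundedUnder_ge (isBoundedUnder_of_eventually_le
        (hadm.mono fun d hd => SBM.liminf_pSucc_optTest_le_one hd)).isCoboundedUnder_ge
  · exact ⟨_, v, fun r => hadm.mono fun d hd => SBM.tendsto_pSucc_locTest hd r, hv, hvlim⟩
  · exact ⟨_, v, fun r => hadm.mono fun d hd => SBM.tendsto_pSucc_bpTest hd r, hv, hvlim⟩
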